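/- **Setting.** Let $n\ge 1$ and let $\mathcal A_1,\dots,\mathcal A_m$ be convex sets of real positive semidefinite $n\times n$ matrices; write $A\bullet B=\mathrm{Tr}(AB)$. The robust packing SDP is $$z_P=\sup\{I\bullet X:\ X\succeq 0,\ A\bullet X\le 1\ \ \forall i\in[m],\ \forall A\in\mathcal A_i\},$$ and the robust covering SDP is $$z_D=\inf\Big\{\sum_{i=1}^m \mu_i(\mathcal A_i):\ \mu_i\text{ a finite discrete measure on }\mathcal A_i,\ \ \sum_{i=1}^m\int_{\mathcal A_i}A\,d\mu_i(A)\succeq I\Big\}.$$ A pair $(X,\mu)$ is $\eta$-optimal if both are feasible, $z_P\ge I\bullet X\ge(1-\eta)\sum_i\mu_i(\mathcal A_i)$ and $\sum_i\mu_i(\mathcal A_i)\ge z_D$. Assume that $A_1,\dots,A_r\in\bigcup_i\mathcal A_i$ are given (each with an index $i$ of a set containing it) with $\bar A=A_1+\dots+A_r\succ0$, and put $$\psi=\frac{r\cdot\max\{\lambda_{\max}(A):A\in\bigcup_i\mathcal A_i\}}{\lambda_{\min}(\bar A)}\ \ (\ge 1).$$ Suppose an oracle returns, for each $Y\succeq0$,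 a pair $(i,A)$ maximizing $A\bullet Y$ over $i\in[m]$, $A\in\mathcal A_i$, in time $\mathcal T$. **Algorithm.** For $0<\epsilon<\frac12$ set $\epsilon_s=2^{-(s+1)}$. The algorithm keeps a finitely supported weight vector $y$ on pairs $(i,A)$, $A\in\mathcal A_i$, with $F(y)=\sum_{(i,A)} y_{(i,A)}A$, and starts with $y=\frac1r\sum_{j\le r}\mathbf 1_{A_j}$, $s=0$. While $\epsilon_s>\epsilon$ it performs phase $s$: set $\nu\leftarrow1$, and while $\nu>\epsilon_s$ do the following. Choose $\theta$ with $(1-\delta_s)\theta^*\le\theta<\theta^*$, where $\delta_s=\epsilon_s^3/(32n)$ and $\theta^*$ is the smallest positive root of $\frac{\epsilon_s\theta}{n}\mathrm{Tr}(F(y)-\theta I)^{-1}=1$; put $X=\frac{\epsilon_s\theta}{n}(F(y)-\theta I)^{-1}$; let $(i,A)$ be a maximizer of $A\bullet X$ over $i\in[m]$, $A\in\mathcal A_i$; put $\nu=\frac{A\bullet X-F(y)\bullet X}{A\bullet X+F(y)\bullet X}$ and $\tau=\frac{\epsilon_s\theta\nu}{4n(A\bullet X+F(y)\bullet X)}$;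 replace $y$ by $(1-\tau)y+\tau\mathbf 1_{(i,A)}$. When the phase ends, increase $s$ by $1$. At the end, with $e$ the accuracy of the last phase and $X,\theta$, $y$ (before its update) those of the last iteration, return $\hat X=\frac{(1-e)X}{(1+e)^2\theta}$ and $\hat y=y/\theta$, the latter being read as the discrete measures with atoms $A$ of mass $\hat y_{(i,A)}$ in $\mathcal A_i$. **Theorem.** (1) There is an absolute constant $C$ such that, for every such instance and every $0<\epsilon<\frac12$, every pair $(\hat X,\hat y)$ returned by a run of the algorithm satisfies $\hat y\ge0$ and is a $C\epsilon$-optimal primal–dual pair, the dual part being a finitely supported discrete measure. (2) Let $\omega$ be any exponent such that $n\times n$ matrices can be multiplied in $O(n^\omega)$ operations on a real RAM (a fixed program with arrays of natural numbers and of reals, unit-cost arithmetic operations and comparisons, no rounding and no roots). Then there are a fixed real RAM program with access to the oracle and constants $C,k$ (depending only on $\omega$) such that, for every such instance and every $0<\epsilon<\frac12$, given $n,r,\epsilon$ and $A_1,\dots,A_r$ with their indices, the program halts with an output $(\hat X,\hat y)$ of a run of the algorithm, in total time (steps plus $\mathcal T$ for each oracle call) at most $$C\Big(1+\log\frac n\epsilon\Big)^k\Big(\frac{n^{\omega+1}\log(2\psi)}{\epsilon^{2.5}}+\frac{n\,\mathcal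 T\log(2\psi)}{\epsilon^2}\Big)+C\,r\,n^2 .$$ That is, the time is $\widetilde O\big(n^{\omega+1}\log(2\psi)/\epsilon^{2.5}+n\mathcal T\log(2\psi)/\epsilon^2\big)$ apart from the time $O(rn^2)$ for reading the $r$ starting matrices and writing the part of $\hat y$ supported on them. -/

import Mathlib

open MeasureTheory

noncomputable section

/-! ### Robust packing/covering SDPs in normalized form -/

/-- Square real matrices of order `n`. -/
abbrev SqMat (n : ℕ) : Type := Matrix (Fin n) (Fin n) ℝ

/-- The product (equivalently, Borel) `σ`-algebra on matrices. -/
instance SqMat.instMeasurableSpace (n : ℕ) : MeasurableSpace (SqMat n) :=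
  inferInstanceAs (MeasurableSpace (Fin n → Fin n → ℝ))

/-- The inner product `A • X = Tr (A X)`. -/
def frob {n : ℕ} (A X : SqMat n) : ℝ := (A * X).trace

/-- The largest eigenvalue of a symmetric matrix (of positive order). -/
def lamMax {n : ℕ} (A : SqMat n) : ℝ := sSup (spectrum ℝ A)

/-- The smallest eigenvalue of a symmetric matrix (of positive order). -/
def lamMin {n : ℕ} (A : SqMat n) : ℝ := sInf (spectrum ℝ A)

/-- Data of a robust normalized packing/covering pair: convex uncertainty sets
`𝒜 1, …, 𝒜 m` of positive semidefinite `n × n` matrices, and `r` members of their union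
(`start j` lies in `𝒜 (startIdx j)`) whose sum is positive definite. -/
structure RobustSDP (n m r : ℕ) where
  𝒜 : Fin m → Set (SqMat n)
  posSemidef : ∀ i, ∀ A ∈ 𝒜 i, A.PosSemidef
  convex : ∀ i, Convex ℝ (𝒜 i)
  startIdx : Fin r → Fin m
  start : Fin r → SqMat n
  start_mem : ∀ j, start j ∈ 𝒜 (startIdx j)
  sum_start_posDef : (∑ j, start j).PosDef

namespace RobustSDP

variable {n m r : ℕ} (P : RobustSDP n m r)

/-- Feasibility for the robust packing problem. -/
def PrimalFeasible (X : SqMat n) : Prop :=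
  X.PosSemidef ∧ ∀ i, ∀ A ∈ P.𝒜 i, frob A X ≤ 1

/-- The value `z_P` of the packing problem: the supremum of `I • X = Tr X`. -/
def primalValue : EReal :=
  ⨆ (X : SqMat n) (_ : P.PrimalFeasible X), ((X.trace : ℝ) : EReal)

/-- A (finite) discrete measure on a set `S` of matrices: it is carried by a countable subset
of `S`. -/
def IsDiscreteOn (μ : Measure (SqMat n)) (S : Set (SqMat n)) : Prop :=
  IsFiniteMeasure μ ∧ ∃ D : Set (SqMat n), D.Countable ∧ D ⊆ S ∧ μ Dᶜ = 0

/-- The matrix `∑ i, ∫ A dμ_i(A)`, the integrals being taken entrywise. -/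
def dualMatrix (μ : Fin m → Measure (SqMat n)) : SqMat n :=
  Matrix.of fun a b => ∑ i, ∫ A, A a b ∂(μ i)

/-- Feasibility for the robust covering problem. -/
def DualFeasible (μ : Fin m → Measure (SqMat n)) : Prop :=
  (∀ i, IsDiscreteOn (μ i) (P.𝒜 i)) ∧
  (∀ i a b, Integrable (fun A : SqMat n => A a b) (μ i)) ∧
  (dualMatrix μ - 1).PosSemidef

/-- The covering objective: the total mass `∑ i, ∫ 1 dμ_i`. -/
def dualObjective (μ : Fin m → Measure (SqMat n)) : ℝ := ∑ i, (μ i).real Set.univ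

/-- The value `z_D` of the covering problem. -/
def dualValue : EReal :=
  ⨅ (μ : Fin m → Measure (SqMat n)) (_ : P.DualFeasible μ), ((dualObjective μ : ℝ) : EReal)

/-- `(X, μ)` is an `η`-optimal primal-dual pair: both are feasible, and
`z_P ≥ I • X ≥ (1 - η) * objective(μ)` and `objective(μ) ≥ z_D`. -/
def IsOptimalPair (η : ℝ) (X : SqMat n) (μ : Fin m → Measure (SqMat n)) : Prop :=
  P.PrimalFeasible X ∧ P.DualFeasible μ ∧
  ((X.trace : ℝ) : EReal) ≤ P.primalValue ∧
  (1 - η) * dualObjective μ ≤ X.trace ∧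
  P.dualValue ≤ ((dualObjective μ : ℝ) : EReal)

/-- `p = (i, A)` maximizes `A • Y` over `i ∈ [m]`, `A ∈ 𝒜 i`. -/
def IsArgmax (Y : SqMat n) (p : Fin m × SqMat n) : Prop :=
  p.2 ∈ P.𝒜 p.1 ∧ ∀ i, ∀ A ∈ P.𝒜 i, frob A Y ≤ frob p.2 Y

/-- `ψ = r * max λ_max(A) / λ_min(A_1 + ⋯ + A_r)`, the maximum being over all `A` in the
uncertainty sets. -/
def psi : ℝ :=
  r * sSup {l : ℝ | ∃ i, ∃ A ∈ P.𝒜 i, l = lamMax A} / lamMin (∑ j, P.start j)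

/-! ### The logarithmic-potential algorithm -/

/-- A finitely supported family of weights `y (i, A)`. -/
abbrev Weights (n m : ℕ) : Type := (Fin m × SqMat n) →₀ ℝ

/-- `F(y) = ∑ y (i, A) * A`. -/
def combine (y : Weights n m) : SqMat n := y.sum fun p w => w • p.2

/-- The discrete measures with atoms given by (nonnegative) weights `y`. -/
def toMeasure (y : Weights n m) (i : Fin m) : Measure (SqMat n) :=
  ∑ p ∈ y.support.filter (fun p => p.1 = i), ENNReal.ofReal (y p) • Measure.dirac p.2

/-- The accuracy `ε_s = 2^{-(s+1)}` of phase `s`. -/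
def phaseEps (s : ℕ) : ℝ := (1 / 2) ^ (s + 1)

/-- The starting weights `y(0) = (1/r) ∑ j, 1_{A_j}`. -/
def initWeights : Weights n m :=
  ∑ j, Finsupp.single (P.startIdx j, P.start j) (1 / (r : ℝ))

/-- `θ` is a `δ`-(lower) approximation of the smallest positive root `θ*` of
`(e θ / n) Tr (F - θ I)⁻¹ = 1`. (Where `F - θ I` is singular, Mathlib's inverse is `0`, so that
such a `θ` is not a root.) -/
def IsApproxRoot (e δ : ℝ) (F : SqMat n) (θ : ℝ) : Prop :=
  ∃ θs : ℝ, IsLeast {x : ℝ | 0 < x ∧ e * x / n * ((F - x • (1 : SqMat n))⁻¹).trace = 1} θs ∧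
    (1 - δ) * θs ≤ θ ∧ θ < θs

/-- State of the algorithm: phase `s`, error `ν(t)`, weights `y(t)`, and `y(t-1)`, `θ(t-1)`,
`X(t-1)`. -/
structure AlgState (n m : ℕ) where
  s : ℕ
  ν : ℝ
  y : Weights n m
  yPrev : Weights n m
  θ : ℝ
  X : SqMat n

/-- The initial state (the last three components are placeholders). -/
def algInit : AlgState n m := ⟨0, 1, P.initWeights, 0, 0, 0⟩

/-- One iteration of the inner loop, in a phase with accuracy `e`. The approximation `θ` of the
root and the maximizer `p = (i, A)` may be any admissible ones. -/
def AlgIteration (e : ℝ) (y : Weights n m) (θ : ℝ) (X : SqMat n) (ν : ℝ) (y' : Weights n m) :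
    Prop :=
  IsApproxRoot e (e ^ 3 / (32 * n)) (combine y) θ ∧
  X = (e * θ / n) • (combine y - θ • (1 : SqMat n))⁻¹ ∧
  ∃ p : Fin m × SqMat n, P.IsArgmax X p ∧
    ν = (frob p.2 X - frob (combine y) X) / (frob p.2 X + frob (combine y) X) ∧
    ∃ τ : ℝ, τ = e * θ * ν / (4 * n * (frob p.2 X + frob (combine y) X)) ∧
      y' = (1 - τ) • y + τ • Finsupp.single p 1

/-- The transitions of the algorithm run with accuracy `ε`. When `ν` has dropped to the accuracy
of the current phase the next phase begins, with `ν` reset to `1`. -/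
inductive AlgStep (ε : ℝ) : AlgState n m → AlgState n m → Prop
  | inner (q : AlgState n m) (θ : ℝ) (X : SqMat n) (ν : ℝ) (y' : Weights n m)
      (houter : ε < phaseEps q.s) (hinner : phaseEps q.s < q.ν)
      (hiter : P.AlgIteration (phaseEps q.s) q.y θ X ν y') :
      AlgStep ε q ⟨q.s, ν, y', q.y, θ, X⟩
  | nextPhase (q : AlgState n m)
      (houter : ε < phaseEps q.s) (hinner : q.ν ≤ phaseEps q.s) :
      AlgStep ε q ⟨q.s + 1, 1, q.y, q.yPrev, q.θ, q.X⟩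

/-- `(X, y)` is returned by some run of the algorithm with accuracy `ε`: a state with
`ε_s ≤ ε` is reached from the initial one, and with `e = ε_{s-1}`
`X = (1-e) X(t-1) / ((1+e)² θ(t-1))`, `y = y(t-1) / θ(t-1)`. -/
def AlgReturns (ε : ℝ) (X : SqMat n) (y : Weights n m) : Prop :=
  ∃ q : AlgState n m, Relation.ReflTransGen (P.AlgStep ε) P.algInit q ∧
    phaseEps q.s ≤ ε ∧
    X = ((1 - phaseEps (q.s - 1)) / ((1 + phaseEps (q.s - 1)) ^ 2 * q.θ)) • q.X ∧
    y = (1 / q.θ) • q.yPrev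

end RobustSDP

/-! ### A real random access machine with an oracle

Programs are finite texts of a structured language acting on arrays of natural numbers and arrays
of reals. Natural numbers serve as counters and addresses, reals can only be added, subtracted,
multiplied, divided and compared (no rounding, no roots). Expressions occurring in a program have
bounded size, so each assignment and each test costs one step. -/

namespace RealRAM

/-- Memory: `nat a k` and `real a k` are the cells number `k` of the `a`-th array of natural
numbers and of reals. -/
structure Store where
  nat : ℕ → ℕ → ℕ
  real : ℕ → ℕ → ℝ

inductive NatExp where
  | lit (k : ℕ)
  | get (a : ℕ) (idx : NatExp)
  | add (e f : NatExp)
  | sub (e f : NatExp)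
  | mul (e f : NatExp)

def NatExp.eval (σ : Store) : NatExp → ℕ
  | .lit k => k
  | .get a idx => σ.nat a (idx.eval σ)
  | .add e f => e.eval σ + f.eval σ
  | .sub e f => e.eval σ - f.eval σ
  | .mul e f => e.eval σ * f.eval σ

inductive RealExp where
  | ofNat (e : NatExp)
  | get (a : ℕ) (idx : NatExp)
  | add (e f : RealExp)
  | sub (e f : RealExp)
  | mul (e f : RealExp)
  | div (e f : RealExp)

def RealExp.eval (σ : Store) : RealExp → ℝ
  | .ofNat e => (e.eval σ : ℝ)
  | .get a idx => σ.real a (idx.eval σ)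
  | .add e f => e.eval σ + f.eval σ
  | .sub e f => e.eval σ - f.eval σ
  | .mul e f => e.eval σ * f.eval σ
  | .div e f => e.eval σ / f.eval σ

inductive Test where
  | natLt (e f : NatExp)
  | realLt (e f : RealExp)
  | not (b : Test)
  | and (b c : Test)

def Test.Holds (σ : Store) : Test → Prop
  | .natLt e f => e.eval σ < f.eval σ
  | .realLt e f => e.eval σ < f.eval σ
  | .not b => ¬ b.Holds σ
  | .and b c => b.Holds σ ∧ c.Holds σ

inductive Program where
  | skip
  | setNat (a : ℕ) (idx e : NatExp)
  | setReal (a : ℕ) (idx : NatExp) (e : RealExp)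
  | seq (c d : Program)
  | ite (b : Test) (c d : Program)
  | loop (b : Test) (c : Program)
  /-- Submit the matrix in the real array `src`; the answer is put into cell `0` of the array
  `iDst` of natural numbers and into the real array `dst`. -/
  | callOracle (src iDst dst : ℕ)

/-- An oracle that answers an `n × n` matrix by a number and an `n × n` matrix. -/
structure Oracle where
  n : ℕ
  answer : SqMat n → ℕ × SqMat n

/-- The `n × n` matrix stored row by row in a real array, from cell `off` on. -/
def Store.matrix (σ : Store) (n a off : ℕ) : SqMat n :=
  Matrix.of fun i j => σ.real a (off + (i : ℕ) * n + (j : ℕ))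

def Store.writeNat (σ : Store) (a k v : ℕ) : Store :=
  { σ with nat := Function.update σ.nat a (Function.update (σ.nat a) k v) }

def Store.writeReal (σ : Store) (a k : ℕ) (v : ℝ) : Store :=
  { σ with real := Function.update σ.real a (Function.update (σ.real a) k v) }

/-- Cells `0, …, n² - 1` of the real array `a` receive the entries of `M`, row by row. -/
def Store.writeMatrix (σ : Store) (n a : ℕ) (M : SqMat n) : Store :=
  { σ with
    real := Function.update σ.real a fun k =>
      if h : k < n * n then
        M ⟨k / n, Nat.div_lt_of_lt_mul h⟩
          ⟨k % n, Nat.mod_lt k (Nat.pos_of_ne_zero fun h0 => by simp [h0] at h)⟩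
      else σ.real a k }

/-- `Exec 𝒪 c σ σ' steps calls`: program `c` started with memory `σ` halts with memory `σ'`, after
`steps` elementary steps and `calls` oracle calls. A call is charged `1 + n²` steps for the
transfer of data, in addition to the time of the oracle itself. -/
inductive Exec (𝒪 : Oracle) : Program → Store → Store → ℕ → ℕ → Prop
  | skip (σ : Store) : Exec 𝒪 .skip σ σ 1 0
  | setNat (σ : Store) (a : ℕ) (idx e : NatExp) :
      Exec 𝒪 (.setNat a idx e) σ (σ.writeNat a (idx.eval σ) (e.eval σ)) 1 0
  | setReal (σ : Store) (a : ℕ) (idx : NatExp) (e : RealExp) :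
      Exec 𝒪 (.setReal a idx e) σ (σ.writeReal a (idx.eval σ) (e.eval σ)) 1 0
  | seq {c d : Program} {σ σ₁ σ₂ : Store} {s₁ s₂ k₁ k₂ : ℕ}
      (hc : Exec 𝒪 c σ σ₁ s₁ k₁) (hd : Exec 𝒪 d σ₁ σ₂ s₂ k₂) :
      Exec 𝒪 (.seq c d) σ σ₂ (s₁ + s₂) (k₁ + k₂)
  | iteTrue {b : Test} {c d : Program} {σ σ₁ : Store} {s k : ℕ}
      (hb : b.Holds σ) (hc : Exec 𝒪 c σ σ₁ s k) :
      Exec 𝒪 (.ite b c d) σ σ₁ (1 + s) k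
  | iteFalse {b : Test} {c d : Program} {σ σ₁ : Store} {s k : ℕ}
      (hb : ¬ b.Holds σ) (hd : Exec 𝒪 d σ σ₁ s k) :
      Exec 𝒪 (.ite b c d) σ σ₁ (1 + s) k
  | loopTrue {b : Test} {c : Program} {σ σ₁ σ₂ : Store} {s₁ s₂ k₁ k₂ : ℕ}
      (hb : b.Holds σ) (hc : Exec 𝒪 c σ σ₁ s₁ k₁) (hl : Exec 𝒪 (.loop b c) σ₁ σ₂ s₂ k₂) :
      Exec 𝒪 (.loop b c) σ σ₂ (1 + s₁ + s₂) (k₁ + k₂)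
  | loopFalse {b : Test} {c : Program} {σ : Store} (hb : ¬ b.Holds σ) :
      Exec 𝒪 (.loop b c) σ σ 1 0
  | callOracle (σ : Store) (src iDst dst : ℕ) :
      Exec 𝒪 (.callOracle src iDst dst) σ
        ((σ.writeNat iDst 0 (𝒪.answer (σ.matrix 𝒪.n src 0)).1).writeMatrix 𝒪.n dst
          (𝒪.answer (σ.matrix 𝒪.n src 0)).2)
        (1 + 𝒪.n * 𝒪.n) 1

/-- Matrix multiplication takes `O(n^ω)` operations: some program multiplies any two `n × n`
matrices (in the real arrays `0` and `1`, with `n` in cell `0` of the array `0` of natural numbers,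
whatever the other contents of the memory) in at most `C n^ω` steps without calling an oracle,
leaving the product in the real array `2`. -/
def IsMatMulExponent (ω : ℝ) : Prop :=
  ∃ (prog : Program) (C : ℝ), ∀ (𝒪 : Oracle) (σ : Store) (n : ℕ), 0 < n → σ.nat 0 0 = n →
    ∃ (σ' : Store) (steps : ℕ), Exec 𝒪 prog σ σ' steps 0 ∧
      (steps : ℝ) ≤ C * (n : ℝ) ^ ω ∧
      σ'.matrix n 2 0 = σ.matrix n 0 0 * σ.matrix n 1 0

/-- The oracle of the machine that computes `(i, A) = f Y`. -/
def oracleOf {n m : ℕ} (f : SqMat n → Fin m × SqMat n) : Oracle where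
  n := n
  answer Y := (((f Y).1 : ℕ), (f Y).2)

/-- The input: `n` and `r` in cells `0` and `1` of the array `0` of natural numbers, `ε` in cell `0`
of the real array `0`, the matrices `A_1, …, A_r` one after the other in the real array `1`, and
their indices in the array `1` of natural numbers; all other cells are `0`. -/
def inputStore {n m r : ℕ} (P : RobustSDP n m r) (ε : ℝ) : Store where
  nat a k :=
    if a = 0 then (if k = 0 then n else if k = 1 then r else 0)
    else if h : a = 1 ∧ k < r then (P.startIdx ⟨k, h.2⟩ : ℕ)
    else 0
  real a k :=
    if a = 0 then (if k = 0 then ε else 0)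
    else if a = 1 then
      ∑ j : Fin r, ∑ i : Fin n, ∑ l : Fin n,
        if k = (j : ℕ) * (n * n) + (i : ℕ) * n + (l : ℕ) then P.start j i l else 0
    else 0

/-- The output: `X` is in the real array `2`, and `y` is the sum of `K` weighted atoms, where `K` is
in cell `0` of the array `2` of natural numbers, and the index, the weight and the matrix of the
`k`-th atom are in cell `k` of the array `3` of natural numbers, in cell `k` of the real array `3`,
and in the real array `4` from cell `k n²` on. -/
def OutputIs {n m : ℕ} (σ : Store) (X : SqMat n) (y : RobustSDP.Weights n m) : Prop :=
  X = σ.matrix n 2 0 ∧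
  ∃ idx : Fin (σ.nat 2 0) → Fin m, (∀ k : Fin (σ.nat 2 0), σ.nat 3 k = (idx k : ℕ)) ∧
    y = ∑ k : Fin (σ.nat 2 0),
      Finsupp.single (idx k, σ.matrix n 4 ((k : ℕ) * (n * n))) (σ.real 3 k)

end RealRAM

end

/-! For weights `y` of total mass `1` with `F = F(y)` consider the potential `Φ_e(y, θ) = log θ +
(e/n) log det (F - θ I)` (`pot`) on the region `θ > 0`, `F - θ I` positive definite. For fixed `F`
it is maximal where `(e θ / n) Tr (F - θ I)⁻¹ = 1`, that is at `θ*` (`pot_le_tangent`), and the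
matrix `X` of the algorithm is `θ` times its gradient in `F`. Moving towards the oracle's answer is
therefore an ascent step for `Φ_e`.

Optimality (`isOptimalPair_of_returns`). As `F - θ I` is positive definite, `y / θ` is a covering of
mass `1 / θ`. Since `F • X = θ (e + Tr X)` and `Tr X < 1`, the stopping rule `ν ≤ e` gives `(1 - e)
A • X ≤ (1 + e)² θ` for every `A`, so the returned multiple of `X` is a packing. Finally `Tr X ≥ 1 -
e²/16`, because `θ` is close enough to `θ*`, so the two objectives differ by a factor `1 - O(e)`.

Number of iterations (`RunOf.le`). A second order bound for `log det` shows that a step gains `e ν²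
/ (6 n)`, while the inexact root costs at most `e³ / (16 n)`; so as long as `ν > e` the potential
grows by `e³ / (10 n)` per step (`pot_gain_of_lt`). In phase `0` the potential ranges over an
interval of length `(3/2) log (2 ψ)`. When a phase of accuracy `e` ends, the tangent at the last
iterate shows that the potential of accuracy `e / 2` is within `7 e` of its maximum (`pot_half_le`).
Hence phase `0` takes `O(n log (2 ψ))` steps and phase `s ≥ 1` takes `O(n / ε_s²)`, a geometric sum.

Running time (`mainProg_runs`, `cost_le`). The root is found by bisection on an interval with end
ratio `2 n`, in `O(log (n / ε))` rounds (`rootProg_runs`). A round inverts `F - θ I` and tests its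
definiteness by recursion on `2 × 2` blocks, in `O(log n)` times the cost of a multiplication
(`exists_invPost`, `resolvent_runs`). An iteration makes one oracle call, and keeping the weights up
to a common factor makes their update cost `O(n²)` (`iterTail_runs`). Since a multiplication program
must write `n²` cells, `ω ≥ 2` and all terms `n²` are absorbed. The resulting bound has `ε²` in both
denominators, which is stronger than the claim. -/

noncomputable section

/-! ### Spectral formulas for the shifted matrix `F - x I`. -/

namespace Matrix.IsHermitian

variable {n : ℕ} {F : SqMat n}

theorem eq_conj_diagonal (hF : F.IsHermitian) :
    F = (hF.eigenvectorUnitary : SqMat n) * diagonal hF.eigenvalues *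
      star (hF.eigenvectorUnitary : SqMat n) := by
  conv_lhs => rw [hF.spectral_theorem, Unitary.conjStarAlgAut_apply]
  rfl

theorem sub_smul_one_eq (hF : F.IsHermitian) (x : ℝ) :
    F - x • (1 : SqMat n) = (hF.eigenvectorUnitary : SqMat n) *
      diagonal (fun i => hF.eigenvalues i - x) * star (hF.eigenvectorUnitary : SqMat n) := by
  have h1 : diagonal (fun i => hF.eigenvalues i - x)
      = diagonal hF.eigenvalues - x • (1 : SqMat n) := by
    ext i j
    by_cases h : i = j <;> simp [h]
  rw [h1, mul_sub, sub_mul, ← hF.eq_conj_diagonal]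
  simp

theorem posDef_sub_smul_one_iff (hF : F.IsHermitian) (x : ℝ) :
    (F - x • (1 : SqMat n)).PosDef ↔ ∀ i, x < hF.eigenvalues i := by
  rw [hF.sub_smul_one_eq x, IsUnit.posDef_star_right_conjugate_iff, posDef_diagonal_iff]
  · simp
  · exact (Unitary.toUnits hF.eigenvectorUnitary).isUnit

theorem trace_inv_sub_smul_one (hF : F.IsHermitian) {x : ℝ} (hx : ∀ i, hF.eigenvalues i ≠ x) :
    ((F - x • (1 : SqMat n))⁻¹).trace = ∑ i, (hF.eigenvalues i - x)⁻¹ := by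
  have h : (F - x • (1 : SqMat n))⁻¹ = (hF.eigenvectorUnitary : SqMat n) *
      diagonal (fun i => (hF.eigenvalues i - x)⁻¹) *
        star (hF.eigenvectorUnitary : SqMat n) := by
    apply inv_eq_right_inv
    rw [hF.sub_smul_one_eq x]
    have hU : star (hF.eigenvectorUnitary : SqMat n) * (hF.eigenvectorUnitary : SqMat n) = 1 :=
      Unitary.coe_star_mul_self _
    have hU' : (hF.eigenvectorUnitary : SqMat n) * star (hF.eigenvectorUnitary : SqMat n) = 1 :=
      Unitary.coe_mul_star_self _
    have hD : diagonal (fun i => hF.eigenvalues i - x) *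
        diagonal (fun i => (hF.eigenvalues i - x)⁻¹) = (1 : SqMat n) := by
      rw [diagonal_mul_diagonal, ← diagonal_one]
      congr 1
      funext i
      exact mul_inv_cancel₀ (sub_ne_zero.2 (hx i))
    generalize (hF.eigenvectorUnitary : SqMat n) = U at *
    calc U * diagonal (fun i => hF.eigenvalues i - x) * star U *
          (U * diagonal (fun i => (hF.eigenvalues i - x)⁻¹) * star U)
        = U * (diagonal (fun i => hF.eigenvalues i - x) * (star U * U) *
          diagonal (fun i => (hF.eigenvalues i - x)⁻¹)) * star U := by simp only [mul_assoc]
      _ = 1 := by rw [hU, mul_one, hD, mul_one, hU']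
  rw [h, trace_mul_cycle, Unitary.coe_star_mul_self, one_mul, trace_diagonal]

theorem trace_mul_self_eq_sum (hF : F.IsHermitian) :
    (F * F).trace = ∑ i, hF.eigenvalues i ^ 2 := by
  have hU : star (hF.eigenvectorUnitary : SqMat n) * (hF.eigenvectorUnitary : SqMat n) = 1 :=
    Unitary.coe_star_mul_self _
  conv_lhs => rw [hF.eq_conj_diagonal]
  generalize (hF.eigenvectorUnitary : SqMat n) = U at *
  have : U * diagonal hF.eigenvalues * star U * (U * diagonal hF.eigenvalues * star U)
      = U * (diagonal hF.eigenvalues * (star U * U) * diagonal hF.eigenvalues) * star U := by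
    simp only [mul_assoc]
  rw [this, hU, mul_one, trace_mul_cycle, hU, one_mul, diagonal_mul_diagonal, trace_diagonal]
  simp [sq]

theorem det_sub_smul_one (hF : F.IsHermitian) (x : ℝ) :
    (F - x • (1 : SqMat n)).det = ∏ i, (hF.eigenvalues i - x) := by
  have hU : star (hF.eigenvectorUnitary : SqMat n) * (hF.eigenvectorUnitary : SqMat n) = 1 :=
    Unitary.coe_star_mul_self _
  rw [hF.sub_smul_one_eq x, det_mul_comm, ← mul_assoc, hU, one_mul, det_diagonal]

theorem trace_eq_sum (hF : F.IsHermitian) : F.trace = ∑ i, hF.eigenvalues i :=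
  hF.trace_eq_sum_eigenvalues

end Matrix.IsHermitian

/-! ### Traces of semidefinite matrices, and first and second order bounds for `log det`. -/

namespace Matrix

variable {n : ℕ}

theorem PosSemidef.exists_eq_conjTranspose_mul_self {A : SqMat n} (hA : A.PosSemidef) :
    ∃ C : SqMat n, A = Cᴴ * C := by
  refine ⟨diagonal (fun i => √(hA.1.eigenvalues i)) *
    star (hA.1.eigenvectorUnitary : SqMat n), ?_⟩
  conv_lhs => rw [hA.1.eq_conj_diagonal]
  generalize (hA.1.eigenvectorUnitary : SqMat n) = U at *
  have h : diagonal hA.1.eigenvalues = diagonal (fun i => √(hA.1.eigenvalues i)) *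
      diagonal (fun i => √(hA.1.eigenvalues i)) := by
    rw [diagonal_mul_diagonal]
    congr 1
    funext i
    exact (Real.mul_self_sqrt (hA.eigenvalues_nonneg i)).symm
  rw [h, conjTranspose_mul, diagonal_conjTranspose, star_eq_conjTranspose,
    conjTranspose_conjTranspose, star_trivial]
  simp only [mul_assoc]

theorem PosSemidef.trace_mul_nonneg {A B : SqMat n} (hA : A.PosSemidef) (hB : B.PosSemidef) :
    0 ≤ (A * B).trace := by
  obtain ⟨C, rfl⟩ := hA.exists_eq_conjTranspose_mul_self
  rw [mul_assoc, trace_mul_comm]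
  exact (hB.mul_mul_conjTranspose_same C).trace_nonneg

theorem PosSemidef.trace_mul_self_le {A : SqMat n} (hA : A.PosSemidef) :
    (A * A).trace ≤ A.trace ^ 2 := by
  rw [hA.1.trace_mul_self_eq_sum, hA.1.trace_eq_sum]
  exact Finset.sum_sq_le_sq_sum_of_nonneg fun i _ => hA.eigenvalues_nonneg i

/-- A congruence that normalizes a positive definite matrix. -/
theorem PosDef.exists_normalize {M : SqMat n} (hM : M.PosDef) :
    ∃ R : SqMat n, IsUnit R ∧ R * M * Rᴴ = 1 ∧ M⁻¹ = Rᴴ * R := by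
  obtain ⟨R, hR⟩ := hM.inv.posSemidef.exists_eq_conjTranspose_mul_self
  have hMu : IsUnit M.det := (isUnit_iff_isUnit_det M).1 hM.isUnit
  have h1 : (M * Rᴴ) * R = 1 := by rw [mul_assoc, ← hR, mul_nonsing_inv _ hMu]
  have h2 : R * (M * Rᴴ) = 1 := mul_eq_one_comm.1 h1
  exact ⟨R, IsUnit.of_mul_eq_one _ h2, by rw [mul_assoc, h2], hR⟩

theorem PosDef.log_det_le {Q : SqMat n} (hQ : Q.PosDef) : Real.log Q.det ≤ Q.trace - n := by
  rw [hQ.1.det_eq_prod_eigenvalues, hQ.1.trace_eq_sum]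
  simp only [RCLike.ofReal_real_eq_id, id]
  rw [Real.log_prod fun i _ => (hQ.eigenvalues_pos i).ne']
  calc _ ≤ ∑ i, (hQ.1.eigenvalues i - 1) :=
        Finset.sum_le_sum fun i _ => Real.log_le_sub_one_of_pos (hQ.eigenvalues_pos i)
    _ = _ := by simp

/-- Congruence by `R` divides every determinant by `det M`, so differences of `log det` survive the
normalization of `M` to the identity. -/
theorem log_det_normalize {M Z R : SqMat n} (hM : M.PosDef) (hZ : Z.PosDef)
    (hR : R * M * Rᴴ = 1) :
    Real.log (R * Z * Rᴴ).det = Real.log Z.det - Real.log M.det := by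
  have h : R.det * M.det * Rᴴ.det = 1 := by rw [← det_mul, ← det_mul, hR, det_one]
  have hM0 := hM.det_pos
  have h' : (R * Z * Rᴴ).det = Z.det / M.det := by
    rw [det_mul, det_mul, eq_div_iff hM0.ne']
    linear_combination Z.det * h
  rw [h', Real.log_div hZ.det_pos.ne' hM0.ne']

/-- Concavity of `log det`: the tangent at `M` lies above. -/
theorem PosDef.log_det_le_tangent {M Z : SqMat n} (hM : M.PosDef) (hZ : Z.PosDef) :
    Real.log Z.det ≤ Real.log M.det + (M⁻¹ * Z).trace - n := by
  obtain ⟨R, hRu, hR, hinv⟩ := hM.exists_normalize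
  have hQ : (R * Z * Rᴴ).PosDef := (IsUnit.posDef_star_right_conjugate_iff hRu).2 hZ
  have h := hQ.log_det_le
  rw [log_det_normalize hM hZ hR, trace_mul_comm, ← mul_assoc, ← hinv] at h
  linarith

/-- A quantitative lower bound for `log det` along the segment from `M` towards `M + A - F`. -/
theorem PosDef.log_det_add_smul {M A F : SqMat n} (hM : M.PosDef) (hA : A.PosSemidef)
    (hF : F.PosSemidef) {τ : ℝ} (hτ : 0 ≤ τ)
    (hτ' : τ * ((M⁻¹ * A).trace + (M⁻¹ * F).trace) ≤ 1 / 4) :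
    (M + τ • (A - F)).PosDef ∧
      Real.log M.det + τ * ((M⁻¹ * A).trace - (M⁻¹ * F).trace)
        - 4 / 3 * (τ * ((M⁻¹ * A).trace + (M⁻¹ * F).trace)) ^ 2
        ≤ Real.log (M + τ • (A - F)).det := by
  obtain ⟨R, hRu, hR, hinv⟩ := hM.exists_normalize
  have hA' := hA.mul_mul_conjTranspose_same R
  have hF' := hF.mul_mul_conjTranspose_same R
  have htA : (R * A * Rᴴ).trace = (M⁻¹ * A).trace := by
    rw [trace_mul_comm, ← mul_assoc, hinv]
  have htF : (R * F * Rᴴ).trace = (M⁻¹ * F).trace := by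
    rw [trace_mul_comm, ← mul_assoc, hinv]
  rw [← htA, ← htF] at hτ' ⊢
  -- The identity is written as `- (-1) • 1`, so that the spectral lemmas for `B - x • 1` apply with
  -- `x = -1`.
  have hQ : R * (M + τ • (A - F)) * Rᴴ = τ • (R * A * Rᴴ - R * F * Rᴴ) - (-1 : ℝ) • 1 := by
    rw [mul_add, add_mul, hR]
    simp [mul_sub, sub_mul, add_comm]
  have hZ0 : (M + τ • (A - F)).PosDef ↔ (R * (M + τ • (A - F)) * Rᴴ).PosDef :=
    (IsUnit.posDef_star_right_conjugate_iff hRu).symm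
  have hlog := fun hZ => log_det_normalize (Z := M + τ • (A - F)) hM hZ hR
  generalize R * A * Rᴴ = A' at *
  generalize R * F * Rᴴ = F' at *
  have hB : (τ • (A' - F')).IsHermitian := by
    have := (hA'.1.sub hF'.1)
    unfold IsHermitian at *
    rw [conjTranspose_smul, this]; simp
  have ha := hA'.trace_nonneg
  have hf := hF'.trace_nonneg
  -- The cross term of `Tr (A' - F')²` is `-2 Tr (A' F') ≤ 0`, and `Tr A'² ≤ (Tr A')²`; so traces
  -- alone control the sum of squares.
  have hsq : ∑ i, hB.eigenvalues i ^ 2 ≤ (τ * (A'.trace + F'.trace)) ^ 2 := by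
    rw [← hB.trace_mul_self_eq_sum]
    have e1 : ((τ • (A' - F')) * (τ • (A' - F'))).trace
        = τ ^ 2 * ((A' * A').trace - 2 * (A' * F').trace + (F' * F').trace) := by
      simp only [Algebra.smul_mul_assoc, Algebra.mul_smul_comm, mul_sub, sub_mul, smul_sub,
        trace_sub, trace_smul, smul_eq_mul, trace_mul_comm F' A']
      ring
    rw [e1, mul_pow]
    have h1 := hA'.trace_mul_self_le
    have h2 := hF'.trace_mul_self_le
    have h3 := hA'.trace_mul_nonneg hF'
    exact mul_le_mul_of_nonneg_left (by nlinarith) (sq_nonneg τ)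
  have habs : ∀ i, |hB.eigenvalues i| ≤ 1 / 4 := fun i => by
    refine abs_le_of_sq_le_sq (a := hB.eigenvalues i) (b := 1 / 4) ?_ (by norm_num)
    calc _ ≤ ∑ i, hB.eigenvalues i ^ 2 :=
          Finset.single_le_sum (f := fun i => hB.eigenvalues i ^ 2)
            (fun i _ => sq_nonneg _) (Finset.mem_univ i)
      _ ≤ _ := hsq
      _ ≤ _ := by
        have : 0 ≤ τ * (A'.trace + F'.trace) := by positivity
        nlinarith
  have hpd : (M + τ • (A - F)).PosDef := by
    rw [hZ0, hQ, hB.posDef_sub_smul_one_iff]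
    intro i
    have := abs_le.1 (habs i)
    linarith [this.1]
  refine ⟨hpd, ?_⟩
  have hl := hlog hpd
  rw [hQ, hB.det_sub_smul_one] at hl
  have hne : ∀ i ∈ Finset.univ, hB.eigenvalues i - -1 ≠ 0 := fun i _ => by
    have := (abs_le.1 (habs i)).1
    intro h; linarith
  rw [Real.log_prod hne] at hl
  -- `log (1 + b) ≥ 1 - 1/(1 + b) = b - b²/(1 + b)`, and `1 + b ≥ 3/4`; this is where `4/3` comes
  -- from.
  have hge : ∑ i, (hB.eigenvalues i - 4 / 3 * hB.eigenvalues i ^ 2)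
      ≤ ∑ i, Real.log (hB.eigenvalues i - -1) := by
    refine Finset.sum_le_sum fun i _ => ?_
    have h1 := abs_le.1 (habs i)
    generalize hB.eigenvalues i = b at *
    have hpos : 0 < b - -1 := by linarith
    have := Real.one_sub_inv_le_log_of_pos hpos
    refine le_trans ?_ this
    rw [le_sub_iff_add_le, ← le_sub_iff_add_le', inv_le_iff_one_le_mul₀ hpos]
    nlinarith [mul_nonneg (sq_nonneg b) (by linarith : 0 ≤ b + 1 / 4)]
  rw [Finset.sum_sub_distrib, ← hB.trace_eq_sum, ← Finset.mul_sum] at hge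
  have htB : (τ • (A' - F')).trace = τ * (A'.trace - F'.trace) := by simp
  rw [htB] at hge
  linarith

end Matrix

/-! ### The equation `(e θ / n) Tr (F - θ I)⁻¹ = 1` and its root. -/

namespace RobustSDP

variable {n : ℕ} {F : SqMat n} {e : ℝ}

/-- The function `θ ↦ (e θ / n) Tr (F - θ I)⁻¹`. -/
def normTrace (e : ℝ) (F : SqMat n) (x : ℝ) : ℝ :=
  e * x / n * ((F - x • (1 : SqMat n))⁻¹).trace

theorem posDef_sub_smul_mono (hF : F.IsHermitian) {x y : ℝ} (hxy : x ≤ y)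
    (hy : (F - y • (1 : SqMat n)).PosDef) : (F - x • (1 : SqMat n)).PosDef := by
  rw [hF.posDef_sub_smul_one_iff] at *
  exact fun i => hxy.trans_lt (hy i)

theorem trace_inv_of_posDef (hF : F.IsHermitian) {x : ℝ}
    (hx : (F - x • (1 : SqMat n)).PosDef) :
    ((F - x • (1 : SqMat n))⁻¹).trace = ∑ i, (hF.eigenvalues i - x)⁻¹ :=
  hF.trace_inv_sub_smul_one fun i => (((hF.posDef_sub_smul_one_iff x).1 hx) i).ne'

/-- Below the smallest eigenvalue both factors increase: the prefactor `e x / n` and every summand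
`1 / (λ i - x)`. -/
theorem normTrace_strictMono (hF : F.IsHermitian) (hn : 0 < n) (he : 0 < e) {x y : ℝ}
    (hx : 0 < x) (hxy : x < y) (hy : (F - y • (1 : SqMat n)).PosDef) :
    normTrace e F x < normTrace e F y := by
  have hn' : (0 : ℝ) < n := by exact_mod_cast hn
  rw [normTrace, normTrace, trace_inv_of_posDef hF hy,
    trace_inv_of_posDef hF (posDef_sub_smul_mono hF hxy.le hy)]
  have hy' := (hF.posDef_sub_smul_one_iff y).1 hy
  have hpos : ∀ i, 0 < hF.eigenvalues i - y := fun i => sub_pos.2 (hy' i)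
  have : Nonempty (Fin n) := ⟨⟨0, hn⟩⟩
  have h1 : ∑ i, (hF.eigenvalues i - x)⁻¹ < ∑ i, (hF.eigenvalues i - y)⁻¹ := by
    refine Finset.sum_lt_sum_of_nonempty Finset.univ_nonempty fun i _ => ?_
    exact inv_strictAnti₀ (hpos i) (by linarith)
  have h0 : 0 ≤ ∑ i, (hF.eigenvalues i - x)⁻¹ :=
    Finset.sum_nonneg fun i _ => (inv_pos.2 (by linarith [hpos i])).le
  have h2 : e * x / n < e * y / n := by gcongr
  have h3 : 0 < e * x / n := by positivity
  nlinarith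

/-- Intermediate value theorem. With `l` the smallest eigenvalue, `x₀` and `x₁` are chosen so that
`l - x₀ = e x₀` and `l - x₁ = e x₁ / n`: at `x₀` all `n` summands are at most `1 / (e x₀)`, at `x₁`
the summand of `l` alone already gives `1`. -/
theorem exists_root (hF : F.PosDef) (hn : 0 < n) (he : 0 < e) :
    ∃ x : ℝ, 0 < x ∧ (F - x • (1 : SqMat n)).PosDef ∧ normTrace e F x = 1 := by
  have hn' : (0 : ℝ) < n := by exact_mod_cast hn
  have hn1 : (1 : ℝ) ≤ n := by exact_mod_cast hn
  have : Nonempty (Fin n) := ⟨⟨0, hn⟩⟩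
  obtain ⟨i₀, hi₀⟩ := Finite.exists_min hF.1.eigenvalues
  set l := hF.1.eigenvalues i₀ with hl
  have hl0 : 0 < l := hF.eigenvalues_pos i₀
  set x₀ := l / (1 + e)
  set x₁ := l / (1 + e / n)
  have hen : 0 < e / n := by positivity
  have hle : x₀ ≤ x₁ := by
    apply div_le_div_of_nonneg_left hl0.le (by positivity)
    gcongr
    exact div_le_self he.le hn1
  have hx₀ : 0 < x₀ := by positivity
  have hx₁ : x₁ < l := by
    rw [div_lt_iff₀ (by positivity)]
    nlinarith
  have hpd : ∀ x ≤ x₁, (F - x • (1 : SqMat n)).PosDef := fun x hx => by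
    rw [hF.1.posDef_sub_smul_one_iff]
    exact fun i => (hx.trans_lt hx₁).trans_le (hi₀ i)
  have hform : ∀ x ≤ x₁, normTrace e F x = e * x / n * ∑ i, (hF.1.eigenvalues i - x)⁻¹ :=
    fun x hx => by rw [normTrace, trace_inv_of_posDef hF.1 (hpd x hx)]
  have hcont : ContinuousOn (normTrace e F) (Set.Icc x₀ x₁) := by
    refine ContinuousOn.congr (f := fun x => e * x / n * ∑ i, (hF.1.eigenvalues i - x)⁻¹) ?_
      fun x hx => hform x hx.2
    refine ContinuousOn.mul (by fun_prop) (continuousOn_finsetSum _ fun i _ => ?_)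
    refine ContinuousOn.inv₀ (by fun_prop) fun x hx => ?_
    have := hi₀ i
    have := hx.2
    apply ne_of_gt
    linarith
  have hlow : normTrace e F x₀ ≤ 1 := by
    rw [hform _ hle]
    have hlx : l - x₀ = e * x₀ := by
      simp only [x₀]
      field_simp
      ring
    have : ∑ i, (hF.1.eigenvalues i - x₀)⁻¹ ≤ ∑ _i : Fin n, (e * x₀)⁻¹ := by
      refine Finset.sum_le_sum fun i _ => ?_
      rw [← hlx]
      have := hi₀ i
      exact inv_anti₀ (by linarith) (by linarith)
    calc _ ≤ e * x₀ / n * ∑ _i : Fin n, (e * x₀)⁻¹ :=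
          mul_le_mul_of_nonneg_left this (by positivity)
      _ = 1 := by simp; field_simp
  have hhigh : 1 ≤ normTrace e F x₁ := by
    rw [hform _ le_rfl]
    have hlx : l - x₁ = e * x₁ / n := by
      simp only [x₁]
      field_simp
      ring
    have hx₁0 : 0 < x₁ := hx₀.trans_le hle
    have : (e * x₁ / n)⁻¹ ≤ ∑ i, (hF.1.eigenvalues i - x₁)⁻¹ := by
      rw [← hlx]
      refine Finset.single_le_sum (f := fun i => (hF.1.eigenvalues i - x₁)⁻¹) (fun i _ => ?_)
        (Finset.mem_univ i₀)
      have := hi₀ i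
      exact (inv_pos.2 (by linarith)).le
    calc 1 = e * x₁ / n * (e * x₁ / n)⁻¹ := (mul_inv_cancel₀ (by positivity)).symm
      _ ≤ _ := mul_le_mul_of_nonneg_left this (by positivity)
  obtain ⟨x, hx, hx1⟩ := intermediate_value_Icc hle hcont ⟨hlow, hhigh⟩
  exact ⟨x, hx₀.trans_le hx.1, hpd x hx.2, hx1⟩

/-- In the positive definite range there is only one root, and it is the least positive one. -/
theorem isLeast_root (hF : F.IsHermitian) (hn : 0 < n) (he : 0 < e) {x : ℝ} (hx : 0 < x)
    (hpd : (F - x • (1 : SqMat n)).PosDef) (h1 : normTrace e F x = 1) :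
    IsLeast {x : ℝ | 0 < x ∧ e * x / n * ((F - x • (1 : SqMat n))⁻¹).trace = 1} x := by
  refine ⟨⟨hx, h1⟩, fun y hy => ?_⟩
  by_contra! hlt
  have := normTrace_strictMono hF hn he hy.1 hlt hpd
  rw [h1] at this
  exact this.ne hy.2

/-- The definition asks for the least positive root. The function is strictly increasing as long as
`F - x I` is positive definite and attains `1` there, so the least root is the one in that range;
all later arguments use this form. -/
theorem isApproxRoot_iff (hF : F.PosDef) (hn : 0 < n) (he : 0 < e) {δ θ : ℝ} :
    IsApproxRoot e δ F θ ↔ ∃ θs, 0 < θs ∧ (F - θs • (1 : SqMat n)).PosDef ∧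
      normTrace e F θs = 1 ∧ (1 - δ) * θs ≤ θ ∧ θ < θs := by
  constructor
  · rintro ⟨θs, hleast, h1, h2⟩
    obtain ⟨x, hx, hpd, hx1⟩ := exists_root hF hn he
    obtain rfl := hleast.unique (isLeast_root hF.1 hn he hx hpd hx1)
    exact ⟨θs, hx, hpd, hx1, h1, h2⟩
  · rintro ⟨θs, h0, hpd, h1, h2⟩
    exact ⟨θs, isLeast_root hF.1 hn he h0 hpd h1, h2⟩

/-- What bisection can decide from one inversion. Definiteness has to be tested too: past the
smallest eigenvalue the scaled trace can again be below `1`. -/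
theorem lt_root_iff (hF : F.IsHermitian) (hn : 0 < n) (he : 0 < e) {θs θ : ℝ}
    (hs : (F - θs • (1 : SqMat n)).PosDef) (hs1 : normTrace e F θs = 1) (hθ : 0 < θ)
    (hs0 : 0 < θs) :
    θ < θs ↔ (F - θ • (1 : SqMat n)).PosDef ∧ normTrace e F θ < 1 := by
  constructor
  · intro h
    exact ⟨posDef_sub_smul_mono hF h.le hs, hs1 ▸ normTrace_strictMono hF hn he hθ h hs⟩
  · rintro ⟨h1, h2⟩
    by_contra! h
    rcases h.eq_or_lt with rfl | h
    · linarith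
    · linarith [normTrace_strictMono hF hn he hs0 h h1]

/-- The weighted summands are positive and add up to `1`, so each is at most `1`: the root keeps a
relative distance `e / n` from the spectrum. -/
theorem root_gap (hF : F.IsHermitian) (hn : 0 < n) (he : 0 < e) {θs : ℝ}
    (hs0 : 0 < θs) (hs : (F - θs • (1 : SqMat n)).PosDef) (hs1 : normTrace e F θs = 1)
    (i : Fin n) : e * θs / n ≤ hF.eigenvalues i - θs := by
  have hn' : (0 : ℝ) < n := by exact_mod_cast hn
  have hpos : ∀ i, 0 < hF.eigenvalues i - θs :=
    fun i => sub_pos.2 ((hF.posDef_sub_smul_one_iff θs).1 hs i)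
  rw [normTrace, trace_inv_of_posDef hF hs] at hs1
  have h1 : (hF.eigenvalues i - θs)⁻¹ ≤ ∑ i, (hF.eigenvalues i - θs)⁻¹ :=
    Finset.single_le_sum (f := fun i => (hF.eigenvalues i - θs)⁻¹)
      (fun i _ => (inv_pos.2 (hpos i)).le) (Finset.mem_univ i)
  have h2 : e * θs / n * (hF.eigenvalues i - θs)⁻¹ ≤ 1 := by
    rw [← hs1]
    exact mul_le_mul_of_nonneg_left h1 (by positivity)
  rwa [← div_eq_mul_inv, div_le_one (hpos i)] at h2

/-- By `root_gap`, lowering `θs` by at most `δ θs` stretches each distance to the spectrum by a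
factor at most `1 + δ n / e`. With `δ = e³/(32 n)` this factor is `1 + e²/32`, which keeps `Tr X`
within `O(e²)` of `1`. -/
theorem normTrace_lower (hF : F.IsHermitian) (hn : 0 < n) (he : 0 < e) {θs θ δ : ℝ}
    (hs0 : 0 < θs) (hs : (F - θs • (1 : SqMat n)).PosDef) (hs1 : normTrace e F θs = 1)
    (hδ0 : 0 ≤ δ) (hδ : δ < 1) (h1 : (1 - δ) * θs ≤ θ) (h2 : θ < θs) :
    1 - δ ≤ normTrace e F θ * (1 + δ * n / e) := by
  have hn' : (0 : ℝ) < n := by exact_mod_cast hn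
  have hpos : ∀ i, 0 < hF.eigenvalues i - θs :=
    fun i => sub_pos.2 ((hF.posDef_sub_smul_one_iff θs).1 hs i)
  have hθ0 : 0 < θ := lt_of_lt_of_le (mul_pos (by linarith) hs0) h1
  have hgap := root_gap hF hn he hs0 hs hs1
  rw [normTrace, trace_inv_of_posDef hF hs] at hs1
  rw [normTrace, trace_inv_of_posDef hF (posDef_sub_smul_mono hF h2.le hs)]
  have hterm : ∀ i, (hF.eigenvalues i - θs)⁻¹ ≤
      (hF.eigenvalues i - θ)⁻¹ * (1 + δ * n / e) := fun i => by
    have hp := hpos i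
    have hq : 0 < hF.eigenvalues i - θ := by linarith
    rw [← div_eq_inv_mul, le_div_iff₀ hq, ← div_eq_inv_mul, div_le_iff₀ hp]
    have h3 : θs - θ ≤ δ * θs := by linarith
    have h4 : δ * θs ≤ δ * n / e * (hF.eigenvalues i - θs) := by
      calc δ * θs = δ * n / e * (e * θs / n) := by field_simp
        _ ≤ _ := mul_le_mul_of_nonneg_left (hgap i) (by positivity)
    linarith
  have hsum : ∑ i, (hF.eigenvalues i - θs)⁻¹ ≤
      (∑ i, (hF.eigenvalues i - θ)⁻¹) * (1 + δ * n / e) := by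
    rw [Finset.sum_mul]
    exact Finset.sum_le_sum fun i _ => hterm i
  have h0 : 0 ≤ ∑ i, (hF.eigenvalues i - θs)⁻¹ :=
    Finset.sum_nonneg fun i _ => (inv_pos.2 (hpos i)).le
  calc 1 - δ = (1 - δ) * (e * θs / n * ∑ i, (hF.eigenvalues i - θs)⁻¹) := by rw [hs1, mul_one]
    _ = e * ((1 - δ) * θs) / n * ∑ i, (hF.eigenvalues i - θs)⁻¹ := by ring
    _ ≤ e * θ / n * ∑ i, (hF.eigenvalues i - θs)⁻¹ := by gcongr
    _ ≤ e * θ / n * ((∑ i, (hF.eigenvalues i - θ)⁻¹) * (1 + δ * n / e)) := by gcongr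
    _ = _ := by ring

/-- A positive starting interval for the search of the root. -/
theorem root_mem_Ioo (hF : F.PosDef) (hn : 0 < n) (he : 0 < e) (he1 : e < 1) {θs : ℝ}
    (hs0 : 0 < θs) (hs : (F - θs • (1 : SqMat n)).PosDef) (hs1 : normTrace e F θs = 1) :
    0 < (F⁻¹).trace ∧ 1 / (2 * (F⁻¹).trace) < θs ∧ θs < n / (F⁻¹).trace := by
  have hn' : (0 : ℝ) < n := by exact_mod_cast hn
  have : Nonempty (Fin n) := ⟨⟨0, hn⟩⟩
  have htr : (F⁻¹).trace = ∑ i, (hF.1.eigenvalues i)⁻¹ := by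
    have h := trace_inv_of_posDef hF.1 (x := 0) (by simpa using hF)
    simpa using h
  have hpos : ∀ i, 0 < hF.1.eigenvalues i := hF.eigenvalues_pos
  have ht : 0 < (F⁻¹).trace := hF.inv.trace_pos
  have hle : ∀ i, (hF.1.eigenvalues i)⁻¹ ≤ (F⁻¹).trace := fun i => by
    rw [htr]
    exact Finset.single_le_sum (f := fun i => (hF.1.eigenvalues i)⁻¹)
      (fun i _ => (inv_pos.2 (hpos i)).le) (Finset.mem_univ i)
  set t := (F⁻¹).trace
  have hlam : ∀ i, 1 / t ≤ hF.1.eigenvalues i := fun i => by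
    rw [one_div]
    exact inv_le_of_inv_le₀ (hpos i) (hle i)
  -- At `x = 1/(2t)` every distance to the spectrum is at least `x`, so the scaled trace is at most
  -- `e < 1`. Only `t = Tr F⁻¹`, not the spectrum, has to be computed for this.
  have hhalf : ∀ i, 1 / (2 * t) ≤ hF.1.eigenvalues i - 1 / (2 * t) := fun i => by
    have := hlam i
    have h2 : 1 / t = 1 / (2 * t) + 1 / (2 * t) := by field_simp; norm_num
    linarith
  have ht2 : 0 < 1 / (2 * t) := by positivity
  refine ⟨ht, (lt_root_iff hF.1 hn he hs hs1 ht2 hs0).2 ?_, ?_⟩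
  · have hpd : (F - (1 / (2 * t)) • (1 : SqMat n)).PosDef := by
      rw [hF.1.posDef_sub_smul_one_iff]
      intro i
      linarith [hhalf i]
    refine ⟨hpd, ?_⟩
    rw [normTrace, trace_inv_of_posDef hF.1 hpd]
    have h3 : ∑ i, (hF.1.eigenvalues i - 1 / (2 * t))⁻¹ ≤ ∑ _i : Fin n, (1 / (2 * t))⁻¹ :=
      Finset.sum_le_sum fun i _ => inv_anti₀ ht2 (hhalf i)
    calc _ ≤ e * (1 / (2 * t)) / n * ∑ _i : Fin n, (1 / (2 * t))⁻¹ := by gcongr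
      _ = e := by simp; field_simp
      _ < 1 := he1
  -- `θs < λ i` for every `i`, so `θs ∑ 1/λ i < n`.
  · rw [lt_div_iff₀ ht, htr, Finset.mul_sum]
    have hlt := (hF.1.posDef_sub_smul_one_iff θs).1 hs
    calc ∑ i, θs * (hF.1.eigenvalues i)⁻¹ < ∑ _i : Fin n, (1 : ℝ) := by
          refine Finset.sum_lt_sum_of_nonempty Finset.univ_nonempty fun i _ => ?_
          rw [← div_eq_mul_inv, div_lt_one (hpos i)]
          exact hlt i
      _ = n := by simp

/-! ### The inner product -/

theorem frob_smul_right (c : ℝ) (A X : SqMat n) : frob A (c • X) = c * frob A X := by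
  simp [frob]

theorem frob_nonneg {A X : SqMat n} (hA : A.PosSemidef) (hX : X.PosSemidef) : 0 ≤ frob A X :=
  hA.trace_mul_nonneg hX

/-- Writing `F = (F - θ I) + θ I` gives `F (F - θ I)⁻¹ = I + θ (F - θ I)⁻¹`; at the exact root `F •
X = θ (1 + e)`. -/
theorem frob_self_resolvent {θ : ℝ} (hn : 0 < n) (hpd : (F - θ • (1 : SqMat n)).PosDef) :
    frob F ((e * θ / n) • (F - θ • (1 : SqMat n))⁻¹) = θ * (e + normTrace e F θ) := by
  have hn' : (n : ℝ) ≠ 0 := by positivity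
  have hu := (Matrix.isUnit_iff_isUnit_det _).1 hpd.isUnit
  have h1 : F * (F - θ • (1 : SqMat n))⁻¹ = 1 + θ • (F - θ • (1 : SqMat n))⁻¹ := by
    have h2 : F = (F - θ • (1 : SqMat n)) + θ • (1 : SqMat n) := by simp
    conv_lhs => rw [h2]
    rw [add_mul, ← h2, Matrix.mul_nonsing_inv _ hu]
    simp
  rw [frob_smul_right, frob, h1, normTrace]
  simp
  field_simp

end RobustSDP

namespace RobustSDP

variable {n m r : ℕ} (P : RobustSDP n m r)

/-! ### Weights -/

theorem combine_eq (y : Weights n m) : combine y = Finsupp.linearCombination ℝ Prod.snd y := rfl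

theorem combine_convex (c : ℝ) (y : Weights n m) (p : Fin m × SqMat n) :
    combine ((1 - c) • y + c • Finsupp.single p 1) = combine y + c • (p.2 - combine y) := by
  simp only [combine_eq, map_add, map_smul, map_sub, Finsupp.linearCombination_single, one_smul,
    sub_smul, smul_sub]
  abel

/-- The sum of the weights. -/
def mass (y : Weights n m) : ℝ := Finsupp.linearCombination ℝ (fun _ => (1 : ℝ)) y

theorem mass_eq_sum (y : Weights n m) : mass y = ∑ p ∈ y.support, y p := by
  simp [mass, Finsupp.linearCombination_apply, Finsupp.sum]

theorem mass_convex (c : ℝ) (y : Weights n m) (p : Fin m × SqMat n) :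
    mass ((1 - c) • y + c • Finsupp.single p 1) = (1 - c) * mass y + c := by
  simp [mass]

theorem frob_combine (y : Weights n m) (X : SqMat n) :
    frob (combine y) X = ∑ p ∈ y.support, y p * frob p.2 X := by
  simp [combine, frob, Finsupp.sum, Finset.sum_mul, Matrix.trace_sum]

/-- Convex weights on members of the uncertainty sets whose combination is positive definite. -/
structure Good (y : Weights n m) : Prop where
  nonneg : ∀ p, 0 ≤ y p
  mem : ∀ p, y p ≠ 0 → p.2 ∈ P.𝒜 p.1
  mass_eq : mass y = 1
  posDef : (combine y).PosDef

variable {P}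

/-- A convex combination cannot exceed the maximum of a linear functional. Hence `F(y) • X ≤ A • X`
for the oracle's `A`, and `ν ≥ 0`. -/
theorem Good.frob_combine_le {y : Weights n m} (hy : P.Good y) {X : SqMat n} {a : ℝ}
    (h : ∀ i, ∀ A ∈ P.𝒜 i, frob A X ≤ a) : frob (combine y) X ≤ a := by
  rw [frob_combine]
  calc _ ≤ ∑ p ∈ y.support, y p * a := Finset.sum_le_sum fun p hp =>
        mul_le_mul_of_nonneg_left (h _ _ (hy.mem p (Finsupp.mem_support_iff.1 hp))) (hy.nonneg p)
    _ = a := by rw [← Finset.sum_mul, ← mass_eq_sum, hy.mass_eq, one_mul]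

theorem Good.convex {y : Weights n m} (hy : P.Good y) {c : ℝ} (h0 : 0 ≤ c) (h1 : c < 1)
    {p : Fin m × SqMat n} (hp : p.2 ∈ P.𝒜 p.1) :
    P.Good ((1 - c) • y + c • Finsupp.single p 1) where
  nonneg q := by
    have h3 := hy.nonneg q
    have h4 : 0 ≤ (Finsupp.single p (1 : ℝ)) q := by
      rw [Finsupp.single_apply]; split_ifs <;> norm_num
    have h5 : 0 ≤ 1 - c := by linarith
    simp only [Finsupp.add_apply, Finsupp.smul_apply, smul_eq_mul]
    positivity
  mem q hq := by
    by_cases h : q = p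
    · rwa [h]
    · apply hy.mem
      intro h0
      simp [h0, Ne.symm h] at hq
  mass_eq := by rw [mass_convex, hy.mass_eq]; ring
  posDef := by
    have h5 : 0 < 1 - c := by linarith
    have : combine ((1 - c) • y + c • Finsupp.single p 1) = (1 - c) • combine y + c • p.2 := by
      simp [combine_eq]
    rw [this]
    exact (hy.posDef.smul h5).add_posSemidef ((P.posSemidef _ _ hp).smul h0)

theorem pos_of_start (P : RobustSDP n m r) (hn : 0 < n) : 0 < r := by
  rcases Nat.eq_zero_or_pos r with rfl | h
  · have : Nonempty (Fin n) := ⟨⟨0, hn⟩⟩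
    have := P.sum_start_posDef.trace_pos
    simp at this
  · exact h

theorem combine_initWeights (P : RobustSDP n m r) :
    combine P.initWeights = (1 / (r : ℝ)) • ∑ j, P.start j := by
  simp [combine_eq, initWeights, Finset.smul_sum]

theorem good_initWeights (P : RobustSDP n m r) (hn : 0 < n) : P.Good P.initWeights := by
  have hr : (0 : ℝ) < r := by exact_mod_cast P.pos_of_start hn
  have h1r : 0 < 1 / (r : ℝ) := by positivity
  refine ⟨fun p => ?_, fun p hp => ?_, ?_, ?_⟩
  · rw [initWeights, Finsupp.finsetSum_apply]
    refine Finset.sum_nonneg fun j _ => ?_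
    rw [Finsupp.single_apply]; split_ifs <;> positivity
  · rw [initWeights, Finsupp.finsetSum_apply] at hp
    obtain ⟨j, _, hj⟩ := Finset.exists_ne_zero_of_sum_ne_zero hp
    rw [Finsupp.single_apply] at hj
    split_ifs at hj with h
    · rw [← h]; exact P.start_mem j
    · exact absurd rfl hj
  · simp [mass, initWeights]
    field_simp
  · rw [combine_initWeights]
    exact P.sum_start_posDef.smul h1r

/-! ### One iteration -/

/-- What is used about an iteration with accuracy `e`: `p` is the maximizer, `τ` the step size. -/
structure IterData (P : RobustSDP n m r) (e : ℝ) (y : Weights n m) (θ : ℝ) (X : SqMat n) (ν : ℝ)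
    (p : Fin m × SqMat n) (τ : ℝ) : Prop where
  exists_root : ∃ θs, 0 < θs ∧ (combine y - θs • (1 : SqMat n)).PosDef ∧
    normTrace e (combine y) θs = 1 ∧ (1 - e ^ 3 / (32 * n)) * θs ≤ θ ∧ θ < θs
  pos : 0 < θ
  posDef : (combine y - θ • (1 : SqMat n)).PosDef
  eq : X = (e * θ / n) • (combine y - θ • (1 : SqMat n))⁻¹
  trace_eq : X.trace = normTrace e (combine y) θ
  trace_lt : X.trace < 1
  le_trace : 1 - e ^ 2 / 16 ≤ X.trace
  X_posDef : X.PosDef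
  argmax : P.IsArgmax X p
  frob_F : frob (combine y) X = θ * (e + X.trace)
  frob_le : frob (combine y) X ≤ frob p.2 X
  ν_eq : frob p.2 X - frob (combine y) X = ν * (frob p.2 X + frob (combine y) X)
  ν_nonneg : 0 ≤ ν
  ν_lt : ν < 1
  τ_eq : τ * (4 * n * (frob p.2 X + frob (combine y) X)) = e * θ * ν
  τ_nonneg : 0 ≤ τ
  τ_lt : τ < 1

theorem iterData_of {e θ ν τ : ℝ} {y : Weights n m} {X : SqMat n} {p : Fin m × SqMat n}
    (hn : 0 < n) (hy : P.Good y) (he : 0 < e) (he2 : e ≤ 1 / 2)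
    (hroot : IsApproxRoot e (e ^ 3 / (32 * n)) (combine y) θ)
    (hX : X = (e * θ / n) • (combine y - θ • (1 : SqMat n))⁻¹) (hp : P.IsArgmax X p)
    (hν : ν = (frob p.2 X - frob (combine y) X) / (frob p.2 X + frob (combine y) X))
    (hτ : τ = e * θ * ν / (4 * n * (frob p.2 X + frob (combine y) X))) :
    IterData P e y θ X ν p τ := by
  have hn' : (0 : ℝ) < n := by exact_mod_cast hn
  have hn1 : (1 : ℝ) ≤ n := by exact_mod_cast hn
  have : Nonempty (Fin n) := ⟨⟨0, hn⟩⟩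
  have hF := hy.posDef
  rw [isApproxRoot_iff hF hn he] at hroot
  have hroot' := hroot
  obtain ⟨θs, hs0, hs, hs1, h1, h2⟩ := hroot
  have hδ0 : 0 ≤ e ^ 3 / (32 * n) := by positivity
  have hδ : e ^ 3 / (32 * n) ≤ e ^ 2 / 64 := by
    rw [div_le_div_iff₀ (by positivity) (by norm_num)]
    have : e ^ 3 ≤ e ^ 2 * (1 / 2) := by nlinarith [sq_nonneg e]
    nlinarith [sq_nonneg e]
  have he2' : e ^ 2 ≤ 1 / 4 := by nlinarith
  have hδ1 : e ^ 3 / (32 * n) < 1 := by linarith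
  have hθ : 0 < θ := lt_of_lt_of_le (mul_pos (by linarith) hs0) h1
  have hpd := posDef_sub_smul_mono hF.1 h2.le hs
  have htr : X.trace = normTrace e (combine y) θ := by rw [hX]; simp [normTrace]
  have hlt := normTrace_strictMono hF.1 hn he hθ h2 hs
  rw [hs1, ← htr] at hlt
  have hlow := normTrace_lower hF.1 hn he hs0 hs hs1 hδ0 hδ1 h1 h2
  rw [← htr] at hlow
  -- Follows from `1 - δ ≤ Tr X * (1 + e²/32)` and `δ ≤ e²/64`.
  have hlow' : 1 - e ^ 2 / 16 ≤ X.trace := by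
    have h3 : e ^ 3 / (32 * n) * n / e = e ^ 2 / 32 := by field_simp
    rw [h3] at hlow
    by_contra! hc
    nlinarith [sq_nonneg e, mul_lt_mul_of_pos_right hc (by positivity : 0 < 1 + e ^ 2 / 32)]
  have hXpd : X.PosDef := by
    rw [hX]; exact hpd.inv.smul (by positivity)
  have hfF : frob (combine y) X = θ * (e + X.trace) := by
    rw [htr, hX]; exact frob_self_resolvent hn hpd
  have hle : frob (combine y) X ≤ frob p.2 X := hy.frob_combine_le hp.2
  have hfpos : 0 < frob (combine y) X := by
    rw [hfF]; apply mul_pos hθ; linarith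
  have hsum : 0 < frob p.2 X + frob (combine y) X := by linarith
  have hν0 : 0 ≤ ν := by rw [hν]; exact div_nonneg (by linarith) hsum.le
  have hν1 : ν < 1 := by rw [hν, div_lt_one hsum]; linarith
  have hτ0 : 0 ≤ τ := by rw [hτ]; positivity
  have hτeq : τ * (4 * n * (frob p.2 X + frob (combine y) X)) = e * θ * ν := by
    rw [hτ]; field_simp
  -- `e θ` is at most `F • X = θ (e + Tr X)`, and `ν < 1`.
  have hτ1 : τ < 1 := by
    rw [hτ, div_lt_one (by positivity)]
    have h4 : e * θ ≤ frob (combine y) X := by rw [hfF]; nlinarith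
    have h5 : e * θ * ν ≤ e * θ := by
      have : 0 < e * θ := by positivity
      nlinarith
    nlinarith [mul_le_mul_of_nonneg_right hn1 hsum.le]
  refine ⟨hroot', hθ, hpd, hX, htr, hlt, hlow', hXpd, hp, hfF, hle, ?_, hν0, hν1, hτeq, hτ0, hτ1⟩
  rw [hν]; field_simp

theorem AlgIteration.exists_data {e θ ν : ℝ} {y y' : Weights n m} {X : SqMat n} (hn : 0 < n)
    (hy : P.Good y) (he : 0 < e) (he2 : e ≤ 1 / 2) (h : P.AlgIteration e y θ X ν y') :
    ∃ p τ, IterData P e y θ X ν p τ ∧ y' = (1 - τ) • y + τ • Finsupp.single p 1 := by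
  obtain ⟨hroot, hX, p, hp, hν, τ, hτ, hy'⟩ := h
  exact ⟨p, τ, iterData_of hn hy he he2 hroot hX hp hν hτ, hy'⟩

namespace IterData

variable {e θ ν τ : ℝ} {y : Weights n m} {X : SqMat n} {p : Fin m × SqMat n}

/-- `ν ≤ e` means `(1 - e) A • X ≤ (1 + e) F • X` for the maximizing `A`, and `F • X ≤ (1 + e) θ`
because `Tr X < 1`. This is the packing constraint for the returned multiple of `X`. -/
theorem frob_bound (h : IterData P e y θ X ν p τ) (he2 : e ≤ 1 / 2)
    (hν : ν ≤ e) {i : Fin m} {A : SqMat n} (hA : A ∈ P.𝒜 i) :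
    (1 - e) * frob A X ≤ (1 + e) ^ 2 * θ := by
  have h1 := h.argmax.2 i A hA
  have h2 := h.ν_eq
  have h3 := h.frob_F
  have h4 := h.trace_lt
  have h5 := h.pos
  have h6 := h.le_trace
  have h7 := h.ν_nonneg
  have hf : frob (combine y) X ≤ θ * (1 + e) := by rw [h3]; nlinarith
  have hf0 : 0 ≤ frob (combine y) X := by rw [h3]; nlinarith
  have hle := h.frob_le
  have : frob p.2 X - frob (combine y) X ≤ e * (frob p.2 X + frob (combine y) X) := by
    rw [h2]; exact mul_le_mul_of_nonneg_right hν (by linarith)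
  nlinarith

theorem good (h : IterData P e y θ X ν p τ) (hy : P.Good y) :
    P.Good ((1 - τ) • y + τ • Finsupp.single p 1) :=
  hy.convex h.τ_nonneg h.τ_lt h.argmax.1

end IterData

/-! ### Runs -/

theorem phaseEps_pos (s : ℕ) : 0 < phaseEps s := by unfold phaseEps; positivity

theorem phaseEps_le (s : ℕ) : phaseEps s ≤ 1 / 2 := by
  unfold phaseEps
  calc ((1 : ℝ) / 2) ^ (s + 1) ≤ (1 / 2) ^ 1 :=
        pow_le_pow_of_le_one (by norm_num) (by norm_num) (by omega)
    _ = _ := by norm_num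

theorem phaseEps_succ (s : ℕ) : phaseEps (s + 1) = phaseEps s / 2 := by
  unfold phaseEps; ring

/-- The invariant of a run. -/
def RunInv (P : RobustSDP n m r) (ε : ℝ) (q : AlgState n m) : Prop :=
  P.Good q.y ∧
    ((q.ν = 1 ∧ (q.s = 0 ∨ ε < phaseEps (q.s - 1) ∧ P.Good q.yPrev ∧
        ∃ ν ≤ phaseEps (q.s - 1), P.AlgIteration (phaseEps (q.s - 1)) q.yPrev q.θ q.X ν q.y)) ∨
      (q.ν < 1 ∧ ε < phaseEps q.s ∧ P.Good q.yPrev ∧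
        P.AlgIteration (phaseEps q.s) q.yPrev q.θ q.X q.ν q.y))

theorem RunInv.init (P : RobustSDP n m r) (hn : 0 < n) (ε : ℝ) : RunInv P ε P.algInit :=
  ⟨P.good_initWeights hn, Or.inl ⟨rfl, Or.inl rfl⟩⟩

theorem RunInv.step (hn : 0 < n) {ε : ℝ} {q q' : AlgState n m} (hq : RunInv P ε q)
    (h : P.AlgStep ε q q') : RunInv P ε q' := by
  cases h with
  | inner θ X ν y' houter hinner hiter =>
    obtain ⟨p, τ, hd, rfl⟩ := hiter.exists_data hn hq.1 (phaseEps_pos _) (phaseEps_le _)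
    exact ⟨hd.good hq.1, Or.inr ⟨hd.ν_lt, houter, hq.1, hiter⟩⟩
  | nextPhase houter hinner =>
    refine ⟨hq.1, Or.inl ⟨rfl, Or.inr ?_⟩⟩
    rcases hq.2 with h | h
    -- An iteration always leaves `ν < 1`, so `ν = 1` marks a fresh phase; as `ε_s ≤ 1/2`, no phase
    -- ends before its first iteration.
    · have := phaseEps_le q.s
      linarith [h.1]
    · exact ⟨houter, h.2.2.1, q.ν, by simpa using hinner, by simpa using h.2.2.2⟩

theorem RunInv.of_reachable (hn : 0 < n) {ε : ℝ} {q : AlgState n m}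
    (h : Relation.ReflTransGen (P.AlgStep ε) P.algInit q) : RunInv P ε q := by
  induction h with
  | refl => exact RunInv.init P hn ε
  | tail _ h ih => exact ih.step hn h

/-! ### The returned pair -/

instance SqMat.instMeasurableSingletonClass : MeasurableSingletonClass (SqMat n) :=
  inferInstanceAs (MeasurableSingletonClass (Fin n → Fin n → ℝ))

theorem toMeasure_apply {y : Weights n m} (i : Fin m) (f : SqMat n → ℝ) (hy : ∀ p, 0 ≤ y p) :
    Integrable f (toMeasure y i) ∧
      ∫ A, f A ∂(toMeasure y i) = ∑ p ∈ y.support.filter (fun p => p.1 = i), y p * f p.2 := by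
  have hint : ∀ p ∈ y.support.filter (fun p => p.1 = i),
      Integrable f (ENNReal.ofReal (y p) • Measure.dirac p.2) := fun p _ =>
    (integrable_dirac (by simp)).smul_measure ENNReal.ofReal_ne_top
  refine ⟨integrable_finsetSum_measure.2 hint, ?_⟩
  rw [toMeasure, integral_finsetSum_measure hint]
  refine Finset.sum_congr rfl fun p _ => ?_
  rw [integral_smul_measure, integral_dirac, ENNReal.toReal_ofReal (hy p), smul_eq_mul]

instance toMeasure_isFinite (y : Weights n m) (i : Fin m) : IsFiniteMeasure (toMeasure y i) := by
  constructor
  simp [toMeasure, ENNReal.sum_lt_top]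

theorem sum_filter_fst (y : Weights n m) (f : Fin m × SqMat n → ℝ) :
    ∑ i, ∑ p ∈ y.support.filter (fun p => p.1 = i), f p = ∑ p ∈ y.support, f p :=
  Finset.sum_fiberwise _ _ _

theorem dualMatrix_toMeasure {y : Weights n m} (hy : ∀ p, 0 ≤ y p) :
    dualMatrix (toMeasure y) = combine y := by
  ext a b
  simp only [dualMatrix, Matrix.of_apply, fun i => (toMeasure_apply i (fun A : SqMat n => A a b) hy).2]
  rw [sum_filter_fst y fun p => y p * p.2 a b]
  simp [combine, Finsupp.sum, Matrix.sum_apply]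

theorem dualObjective_toMeasure {y : Weights n m} (hy : ∀ p, 0 ≤ y p) :
    dualObjective (toMeasure y) = mass y := by
  have h : ∀ i, (toMeasure y i).real Set.univ =
      ∑ p ∈ y.support.filter (fun p => p.1 = i), y p * 1 := fun i => by
    rw [← (toMeasure_apply i (fun _ => (1 : ℝ)) hy).2]
    simp
  rw [dualObjective, Finset.sum_congr rfl fun i _ => h i, sum_filter_fst y fun p => y p * 1,
    mass_eq_sum]
  simp

theorem dualFeasible_toMeasure {y : Weights n m} (hy : ∀ p, 0 ≤ y p)
    (hmem : ∀ p, y p ≠ 0 → p.2 ∈ P.𝒜 p.1) (h : (combine y - 1).PosSemidef) :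
    P.DualFeasible (toMeasure y) := by
  refine ⟨fun i => ⟨inferInstance, ((y.support.filter (fun p => p.1 = i)).image Prod.snd : Finset _),
    Finset.countable_toSet _, ?_, ?_⟩, fun i a b => (toMeasure_apply i _ hy).1, ?_⟩
  · intro A hA
    simp only [Finset.coe_image, Set.mem_image, Finset.mem_coe, Finset.mem_filter,
      Finsupp.mem_support_iff] at hA
    obtain ⟨p, ⟨hp, rfl⟩, rfl⟩ := hA
    exact hmem p hp
  · have hms : MeasurableSet (((y.support.filter (fun p => p.1 = i)).image Prod.snd :
        Finset (SqMat n)) : Set (SqMat n))ᶜ :=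
      (Finset.measurableSet _).compl
    simp only [toMeasure, Measure.coe_finsetSum, Finset.sum_apply, Finset.sum_eq_zero_iff]
    intro p hp
    rw [Measure.smul_apply, Measure.dirac_apply' _ hms]
    have : p.2 ∉ (((y.support.filter (fun p => p.1 = i)).image Prod.snd :
        Finset (SqMat n)) : Set (SqMat n))ᶜ := by
      simp only [Set.mem_compl_iff, not_not, Finset.mem_coe]
      exact Finset.mem_image_of_mem _ hp
    rw [Set.indicator_of_notMem this, smul_zero]
  · rw [dualMatrix_toMeasure hy]; exact h

/-- The comparisons with `primalValue` and `dualValue` are immediate from feasibility, so no duality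
theorem enters. The content is the feasibility of both parts and the comparison of the trace with
the mass `1 / θ`. -/
theorem isOptimalPair_of_returns (hn : 0 < n) {ε : ℝ} (hε2 : ε < 1 / 2)
    {X : SqMat n} {y : Weights n m} (h : P.AlgReturns ε X y) :
    (∀ p, 0 ≤ y p) ∧ P.IsOptimalPair (10 * ε) X (toMeasure y) := by
  obtain ⟨q, hreach, hle, rfl, rfl⟩ := h
  have hinv := RunInv.of_reachable hn hreach
  obtain ⟨_, ⟨_, h0 | ⟨-, hgood, ν, hν, hiter⟩⟩ | ⟨_, hlt, _⟩⟩ := hinv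
  -- A run cannot stop in phase `0`, whose accuracy `1/2` exceeds `ε`; nor, in the last case, inside
  -- a phase with `ε < ε_s`.
  · rw [h0] at hle
    norm_num [phaseEps] at hle
    linarith
  swap
  · linarith
  set e := phaseEps (q.s - 1) with he
  -- The last phase performed has accuracy `2 ε_s`, and `ε_s ≤ ε`.
  have hes : e ≤ 2 * ε := by
    rcases Nat.eq_zero_or_pos q.s with h0 | hs
    · rw [h0] at hle
      norm_num [phaseEps] at hle
      linarith
    · obtain ⟨s, hs'⟩ := Nat.exists_eq_succ_of_ne_zero hs.ne'
      rw [hs', Nat.succ_eq_add_one, phaseEps_succ] at hle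
      rw [he, hs', Nat.succ_eq_add_one, Nat.add_sub_cancel]
      linarith
  have he0 : 0 < e := phaseEps_pos _
  have he2 : e ≤ 1 / 2 := phaseEps_le _
  obtain ⟨p, τ, hd, -⟩ := hiter.exists_data hn hgood he0 he2
  have hθ := hd.pos
  have hcoef : 0 < (1 - e) / ((1 + e) ^ 2 * q.θ) :=
    div_pos (by linarith) (by positivity)
  have hθ' : 0 < 1 / q.θ := by positivity
  have hy0 : ∀ p, 0 ≤ ((1 / q.θ) • q.yPrev) p := fun p => by
    have := hgood.nonneg p
    simp only [Finsupp.smul_apply, smul_eq_mul]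
    positivity
  have hcomb : combine ((1 / q.θ) • q.yPrev) = (1 / q.θ) • combine q.yPrev := by
    simp [combine_eq]
  have hmass : mass ((1 / q.θ) • q.yPrev) = 1 / q.θ := by
    have := hgood.mass_eq
    unfold mass at *
    rw [map_smul, this, smul_eq_mul, mul_one]
  have hprimal : P.PrimalFeasible (((1 - e) / ((1 + e) ^ 2 * q.θ)) • q.X) := by
    refine ⟨(hd.X_posDef.smul hcoef).posSemidef, fun i A hA => ?_⟩
    rw [frob_smul_right, div_mul_eq_mul_div, div_le_one (by positivity)]
    exact hd.frob_bound he2 hν hA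
  have hdual : P.DualFeasible (toMeasure ((1 / q.θ) • q.yPrev)) := by
    refine dualFeasible_toMeasure hy0 (fun p hp => hgood.mem p fun h => ?_) ?_
    · simp [h] at hp
    · rw [hcomb]
      have : (1 / q.θ) • combine q.yPrev - 1
          = (1 / q.θ) • (combine q.yPrev - q.θ • (1 : SqMat n)) := by
        rw [smul_sub, smul_smul, one_div_mul_cancel hθ.ne', one_smul]
      rw [this]
      exact (hd.posDef.smul hθ').posSemidef
  refine ⟨hy0, hprimal, hdual, le_iSup₂_of_le _ hprimal le_rfl, ?_, iInf₂_le _ hdual⟩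
  rw [dualObjective_toMeasure hy0, hmass, Matrix.trace_smul, smul_eq_mul]
  have hT := hd.le_trace
  -- `1 - 10 ε ≤ 1 - 5 e`, and `(1 - 5 e)(1 + e)² ≤ (1 - e)(1 - e²/16)` for `0 < e ≤ 1/2`; hence the
  -- constant `10`.
  have key : (1 - 10 * ε) * (1 + e) ^ 2 ≤ (1 - e) * q.X.trace := by
    have h1 : (1 - e) * (1 - e ^ 2 / 16) ≤ (1 - e) * q.X.trace :=
      mul_le_mul_of_nonneg_left hT (by linarith)
    have h2 : (1 - 10 * ε) * (1 + e) ^ 2 ≤ (1 - 5 * e) * (1 + e) ^ 2 := by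
      apply mul_le_mul_of_nonneg_right _ (sq_nonneg _)
      linarith
    have h3 : (1 - 5 * e) * (1 + e) ^ 2 ≤ (1 - e) * (1 - e ^ 2 / 16) := by nlinarith [sq_nonneg e]
    linarith
  calc (1 - 10 * ε) * (1 / q.θ)
      = (1 - 10 * ε) * (1 + e) ^ 2 / ((1 + e) ^ 2 * q.θ) := by
        field_simp
    _ ≤ (1 - e) * q.X.trace / ((1 + e) ^ 2 * q.θ) := by gcongr
    _ = _ := by ring

end RobustSDP

namespace RobustSDP

variable {n m r : ℕ} {P : RobustSDP n m r} {F : SqMat n} {e : ℝ}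

/-! ### The logarithmic potential -/

/-- The logarithmic potential `log θ + (e/n) log det (F - θ I)`. -/
def pot (e : ℝ) (F : SqMat n) (θ : ℝ) : ℝ :=
  Real.log θ + e / n * Real.log (F - θ • (1 : SqMat n)).det

theorem log_le_log_add {x z : ℝ} (hx : 0 < x) (hz : 0 < z) :
    Real.log z ≤ Real.log x + (z / x - 1) := by
  have := Real.log_le_sub_one_of_pos (div_pos hz hx)
  rw [Real.log_div hz.ne' hx.ne'] at this
  linarith

/-- The tangent inequalities of `log` and `log det` at `x`, added up; as a function of `z / x` the
slope is `1 - normTrace e F x`. It vanishes at the root, which therefore maximizes the potential for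
fixed `F`. -/
theorem pot_le_tangent (hn : 0 < n) (he : 0 < e) {x z : ℝ} (hx : 0 < x) (hz : 0 < z)
    (hxp : (F - x • (1 : SqMat n)).PosDef) (hzp : (F - z • (1 : SqMat n)).PosDef) :
    pot e F z ≤ pot e F x + (z / x - 1) * (1 - normTrace e F x) := by
  have hn' : (0 : ℝ) < n := by exact_mod_cast hn
  have h1 := log_le_log_add hx hz
  have h2 := hxp.log_det_le_tangent hzp
  have hu := (Matrix.isUnit_iff_isUnit_det _).1 hxp.isUnit
  have h3 : ((F - x • (1 : SqMat n))⁻¹ * (F - z • (1 : SqMat n))).trace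
      = n + (x - z) * ((F - x • (1 : SqMat n))⁻¹).trace := by
    have h4 : F - z • (1 : SqMat n) = (F - x • (1 : SqMat n)) + (x - z) • (1 : SqMat n) := by
      rw [sub_smul]; abel
    conv_lhs => rw [h4]
    rw [mul_add, Matrix.nonsing_inv_mul _ hu]
    simp
  rw [h3] at h2
  have h5 : (e / n) * Real.log (F - z • (1 : SqMat n)).det ≤ (e / n) *
      (Real.log (F - x • (1 : SqMat n)).det + (x - z) * ((F - x • (1 : SqMat n))⁻¹).trace) :=
    mul_le_mul_of_nonneg_left (by linarith) (by positivity)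
  have h6 : (z / x - 1) * (1 - normTrace e F x)
      = (z / x - 1) + e / n * ((x - z) * ((F - x • (1 : SqMat n))⁻¹).trace) := by
    unfold normTrace
    field_simp
    ring
  unfold pot
  rw [h6]
  linarith

namespace IterData

variable {θ ν τ : ℝ} {y : Weights n m} {X : SqMat n} {p : Fin m × SqMat n}

theorem trace_inv_mul (h : IterData P e y θ X ν p τ) (hn : 0 < n) (he : 0 < e) (A : SqMat n) :
    ((combine y - θ • (1 : SqMat n))⁻¹ * A).trace = n / (e * θ) * frob A X := by
  have hn' : (0 : ℝ) < n := by exact_mod_cast hn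
  have := h.pos
  rw [h.eq, frob_smul_right, frob, Matrix.trace_mul_comm]
  field_simp

/-- With `M = F - θ I` the step size makes `τ M⁻¹ • (A + F) = ν/4`, hence `τ M⁻¹ • (A - F) = ν²/4`
by the definition of `ν`. The second order loss is `(4/3)(ν/4)² = ν²/12`, which leaves `ν²/6`. -/
theorem posDef_and_log_det (h : IterData P e y θ X ν p τ) (hn : 0 < n) (he : 0 < e)
    (hy : P.Good y) :
    (combine ((1 - τ) • y + τ • Finsupp.single p 1) - θ • (1 : SqMat n)).PosDef ∧
      Real.log (combine y - θ • (1 : SqMat n)).det + ν ^ 2 / 6 ≤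
        Real.log (combine ((1 - τ) • y + τ • Finsupp.single p 1) - θ • (1 : SqMat n)).det := by
  have hn' : (0 : ℝ) < n := by exact_mod_cast hn
  have hθ := h.pos
  have hτ : τ * (n / (e * θ) * frob p.2 X + n / (e * θ) * frob (combine y) X) = ν / 4 := by
    have := h.τ_eq
    field_simp
    linarith
  have hτ' : τ * (n / (e * θ) * frob p.2 X - n / (e * θ) * frob (combine y) X) = ν ^ 2 / 4 := by
    rw [← mul_sub, h.ν_eq]
    linear_combination ν * hτ
  have key := h.posDef.log_det_add_smul (P.posSemidef _ _ h.argmax.1) hy.posDef.posSemidef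
    h.τ_nonneg (by
      rw [h.trace_inv_mul hn he, h.trace_inv_mul hn he, hτ]
      linarith [h.ν_lt])
  rw [h.trace_inv_mul hn he, h.trace_inv_mul hn he, hτ, hτ'] at key
  have hF : combine ((1 - τ) • y + τ • Finsupp.single p 1) - θ • (1 : SqMat n)
      = combine y - θ • (1 : SqMat n) + τ • (p.2 - combine y) := by
    rw [combine_convex]; abel
  rw [hF]
  exact ⟨key.1, by linarith [key.2]⟩

/-- The gain of potential in one iteration. -/
theorem pot_gain (h : IterData P e y θ X ν p τ) (hn : 0 < n) (he : 0 < e) (he2 : e ≤ 1 / 2)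
    (hy : P.Good y) {θ₀ : ℝ} (h0 : 0 < θ₀) (h0p : (combine y - θ₀ • (1 : SqMat n)).PosDef) :
    pot e (combine y) θ₀ + (e / n * (ν ^ 2 / 6) - e ^ 3 / (16 * n)) ≤
      pot e (combine ((1 - τ) • y + τ • Finsupp.single p 1)) θ := by
  have hn' : (0 : ℝ) < n := by exact_mod_cast hn
  have hn1 : (1 : ℝ) ≤ n := by exact_mod_cast hn
  have hθ := h.pos
  obtain ⟨θs, hs0, hsp, hs1, hs2, hs3⟩ := h.exists_root
  -- Whatever `θ₀` was used before, the exact root `θs` has at least its potential. Replacing `θs`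
  -- by `θ` then loses at most `2 δ`: the slope at `θ` is at most `1` and `θs/θ - 1 ≤ 2 δ`.
  have h1 := pot_le_tangent hn he hs0 h0 hsp h0p
  rw [hs1, sub_self, mul_zero, add_zero] at h1
  have h2 := pot_le_tangent hn he hθ hs0 h.posDef hsp
  have hδ0 : 0 ≤ e ^ 3 / (32 * n) := by positivity
  have hδ : e ^ 3 / (32 * n) ≤ 1 / 2 := by
    rw [div_le_iff₀ (by positivity)]
    have : e ^ 3 ≤ 1 := pow_le_one₀ he.le (by linarith)
    linarith
  set δ := e ^ 3 / (32 * n) with hδdef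
  have h3 : θs / θ - 1 ≤ 2 * δ := by
    rw [sub_le_iff_le_add, div_le_iff₀ hθ]
    nlinarith [mul_nonneg hδ0 hs0.le]
  have h3' : 0 ≤ θs / θ - 1 := by
    rw [sub_nonneg, one_le_div hθ]; exact hs3.le
  have h4 : (θs / θ - 1) * (1 - normTrace e (combine y) θ) ≤ 2 * δ := by
    rw [← h.trace_eq]
    have := h.le_trace
    have : 0 ≤ X.trace := by nlinarith
    nlinarith
  have h5 := (h.posDef_and_log_det hn he hy).2
  have h6 := mul_le_mul_of_nonneg_left h5 (by positivity : 0 ≤ e / n)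
  have h7 : e ^ 3 / (16 * n) = 2 * δ := by rw [hδdef]; field_simp; norm_num
  rw [h7]
  have h8 : pot e (combine y) θ + e / n * (ν ^ 2 / 6) ≤
      pot e (combine ((1 - τ) • y + τ • Finsupp.single p 1)) θ := by
    unfold pot
    linarith
  linarith

theorem pot_gain_of_lt (h : IterData P e y θ X ν p τ) (hn : 0 < n) (he : 0 < e) (he2 : e ≤ 1 / 2)
    (hy : P.Good y) (hν : e < ν) {θ₀ : ℝ} (h0 : 0 < θ₀)
    (h0p : (combine y - θ₀ • (1 : SqMat n)).PosDef) :
    pot e (combine y) θ₀ + e ^ 3 / (10 * n) ≤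
      pot e (combine ((1 - τ) • y + τ • Finsupp.single p 1)) θ := by
  have hn' : (0 : ℝ) < n := by exact_mod_cast hn
  refine le_trans ?_ (h.pot_gain hn he he2 hy h0 h0p)
  have h1 : e / n * (e ^ 2 / 6) ≤ e / n * (ν ^ 2 / 6) := by gcongr
  -- `1/6 - 1/16 - 1/10 = 1/240 > 0`.
  have h2 : e / n * (e ^ 2 / 6) - e ^ 3 / (16 * n) - e ^ 3 / (10 * n) = e ^ 3 / n / 240 := by
    field_simp
    norm_num
  have h3 : 0 ≤ e ^ 3 / n / 240 := by positivity
  linarith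

/-- After a phase with accuracy `e` the potential of accuracy `e / 2` is nearly maximal. -/
theorem pot_half_le (h : IterData P e y θ X ν p τ) (hn : 0 < n) (he : 0 < e) (he2 : e ≤ 1 / 2)
    (hν : ν ≤ e) {y' : Weights n m} (hy' : P.Good y') {z : ℝ} (hz : 0 < z)
    (hzp : (combine y' - z • (1 : SqMat n)).PosDef) :
    pot (e / 2) (combine y') z ≤ pot (e / 2) (combine y) θ + 7 * e := by
  have hn' : (0 : ℝ) < n := by exact_mod_cast hn
  have hθ := h.pos
  have hT1 := h.trace_lt
  have hT0 := h.le_trace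
  have hf : (1 - e) * frob (combine y') X ≤ (1 + e) ^ 2 * θ := by
    have h1 : 0 < 1 - e := by linarith
    have := hy'.frob_combine_le (X := X) (a := (1 + e) ^ 2 * θ / (1 - e)) fun i A hA => by
      rw [le_div_iff₀ h1, mul_comm]
      exact h.frob_bound he2 hν hA
    rwa [le_div_iff₀ h1, mul_comm] at this
  -- Tangent at the last iterate `(F(y), θ)`. That point is not stationary for accuracy `e / 2`:
  -- about half of the slope of `log` in `z` remains. What bounds `z` is `(F(y') - z I) • X ≥ 0`
  -- together with `(1 - e) F(y') • X ≤ (1 + e)² θ`.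
  have hlog := log_le_log_add hθ hz
  have hdet := h.posDef.log_det_le_tangent hzp
  have htr : ((combine y - θ • (1 : SqMat n))⁻¹ * (combine y' - z • (1 : SqMat n))).trace
      = n / (e * θ) * (frob (combine y') X - z * X.trace) := by
    rw [h.trace_inv_mul hn he]
    simp [frob, sub_mul]
  have hpos : 0 ≤ frob (combine y') X - z * X.trace := by
    have := frob_nonneg hzp.posSemidef h.X_posDef.posSemidef
    simpa [frob, sub_mul] using this
  rw [htr] at hdet
  set f := frob (combine y') X
  set T := X.trace
  set x := z / θ with hx
  have hx0 : 0 < x := by positivity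
  have hzx : z = x * θ := by rw [hx]; field_simp
  have hg0 : 0 ≤ f / θ - x * T := by
    have : f / θ - x * T = (f - z * T) / θ := by rw [hx]; field_simp
    rw [this]; positivity
  have hg1 : (1 - e) * (f / θ) ≤ (1 + e) ^ 2 := by
    rw [mul_div_assoc', div_le_iff₀ hθ]; exact hf
  have hmul := mul_le_mul_of_nonneg_left hdet (by positivity : 0 ≤ e / 2 / n)
  have hrw : e / 2 / n * (Real.log (combine y - θ • (1 : SqMat n)).det
        + n / (e * θ) * (f - z * T) - n)
      = e / 2 / n * Real.log (combine y - θ • (1 : SqMat n)).det + (f / θ - x * T - e) / 2 := by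
    rw [hx]; field_simp; ring
  rw [hrw] at hmul
  set g := f / θ
  -- `(1 - e)(1 + 7 e) ≥ (1 + e)²` holds exactly for `0 ≤ e ≤ 1/2`.
  have hg : g ≤ 1 + 7 * e := by
    by_contra! hc
    nlinarith
  have hx5 : x ≤ 5 := by
    have : 63 / 64 ≤ T := by nlinarith
    by_contra! hc
    nlinarith
  -- `1 - T ≤ e²/16` and `x ≤ 5`. Since `x T ≤ g ≤ 1 + 7 e`, the total increase `x - 1 + (g - x T -
  -- e)/2` is then at most `7 e`.
  have hxT : x * (1 - T) ≤ e / 6 := by nlinarith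
  unfold pot
  nlinarith

end IterData

theorem trace_sub_smul_one (F : SqMat n) (x : ℝ) :
    (F - x • (1 : SqMat n)).trace = F.trace - n * x := by
  simp [mul_comm]

/-- Tangent of `log det` at `L I`, the average eigenvalue of `F` being at most `L`; definiteness
forces `θ < L`, which bounds `log θ` as well. -/
theorem pot_le_log (hn : 0 < n) (he : 0 < e) {L θ : ℝ} (hF : F.trace ≤ n * L) (hθ : 0 < θ)
    (hp : (F - θ • (1 : SqMat n)).PosDef) : pot e F θ ≤ (1 + e) * Real.log L := by
  have hn' : (0 : ℝ) < n := by exact_mod_cast hn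
  have : Nonempty (Fin n) := ⟨⟨0, hn⟩⟩
  have ht := hp.trace_pos
  rw [trace_sub_smul_one] at ht
  have hθL : θ < L := by
    have : n * θ < n * L := by linarith
    exact lt_of_mul_lt_mul_left this hn'.le
  have hL : 0 < L := hθ.trans hθL
  have h1 := (Matrix.PosDef.one.smul hL : (L • (1 : SqMat n)).PosDef).log_det_le_tangent hp
  have h2 : (L • (1 : SqMat n))⁻¹ = L⁻¹ • 1 := by
    apply Matrix.inv_eq_right_inv
    simp [hL.ne']
  rw [h2, smul_mul_assoc, one_mul, Matrix.trace_smul, trace_sub_smul_one, Matrix.det_smul,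
    Matrix.det_one, mul_one, Fintype.card_fin, Real.log_pow, smul_eq_mul] at h1
  have h3 : L⁻¹ * (F.trace - n * θ) ≤ n := by
    rw [inv_mul_le_iff₀ hL]
    nlinarith
  have h4 : Real.log (F - θ • (1 : SqMat n)).det ≤ n * Real.log L := by linarith
  have h5 := mul_le_mul_of_nonneg_left h4 (by positivity : 0 ≤ e / n)
  have h6 : e / n * (n * Real.log L) = e * Real.log L := by field_simp
  have h7 := Real.log_le_log hθ hθL.le
  unfold pot
  linarith

/-- At half of a lower bound for the spectrum, all distances to the spectrum are at least `l / 2`.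
Together with `pot_le_log` this confines the potential of the first phase. -/
theorem log_le_pot (hn : 0 < n) (he : 0 < e) (hF : F.IsHermitian) {l : ℝ} (hl : 0 < l)
    (h : ∀ i, l ≤ hF.eigenvalues i) :
    (F - (l / 2) • (1 : SqMat n)).PosDef ∧ (1 + e) * Real.log (l / 2) ≤ pot e F (l / 2) := by
  have hn' : (0 : ℝ) < n := by exact_mod_cast hn
  refine ⟨(hF.posDef_sub_smul_one_iff _).2 fun i => by linarith [h i], ?_⟩
  unfold pot
  rw [hF.det_sub_smul_one, Real.log_prod fun i _ => by
    have := h i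
    apply ne_of_gt
    linarith]
  have h1 : ∑ _i : Fin n, Real.log (l / 2) ≤ ∑ i, Real.log (hF.eigenvalues i - l / 2) :=
    Finset.sum_le_sum fun i _ => Real.log_le_log (by linarith) (by linarith [h i])
  have h2 := mul_le_mul_of_nonneg_left h1 (by positivity : 0 ≤ e / n)
  have h3 : e / n * ∑ _i : Fin n, Real.log (l / 2) = e * Real.log (l / 2) := by
    simp; field_simp
  linarith

/-! ### Extreme eigenvalues -/

theorem lamMin_le (hF : F.IsHermitian) (i : Fin n) : lamMin F ≤ hF.eigenvalues i := by
  rw [lamMin, hF.spectrum_real_eq_range_eigenvalues]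
  exact csInf_le (Set.finite_range _).bddBelow ⟨i, rfl⟩

theorem lamMin_pos (hF : F.PosDef) (hn : 0 < n) : 0 < lamMin F := by
  have : Nonempty (Fin n) := ⟨⟨0, hn⟩⟩
  rw [lamMin, hF.1.spectrum_real_eq_range_eigenvalues]
  obtain ⟨i, hi⟩ := (Set.range_nonempty hF.1.eigenvalues).csInf_mem (Set.finite_range _)
  rw [← hi]
  exact hF.eigenvalues_pos i

theorem le_lamMax (hF : F.IsHermitian) (i : Fin n) : hF.eigenvalues i ≤ lamMax F := by
  rw [lamMax, hF.spectrum_real_eq_range_eigenvalues]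
  exact le_csSup (Set.finite_range _).bddAbove ⟨i, rfl⟩

theorem trace_le_lamMax (hF : F.IsHermitian) : F.trace ≤ n * lamMax F := by
  rw [hF.trace_eq_sum]
  calc _ ≤ ∑ _i : Fin n, lamMax F := Finset.sum_le_sum fun i _ => le_lamMax hF i
    _ = _ := by simp

theorem le_trace_of_lamMin (hF : F.IsHermitian) : n * lamMin F ≤ F.trace := by
  rw [hF.trace_eq_sum]
  calc n * lamMin F = ∑ _i : Fin n, lamMin F := by simp
    _ ≤ _ := Finset.sum_le_sum fun i _ => lamMin_le hF i

theorem lamMax_le_trace (hF : F.PosSemidef) (hn : 0 < n) : lamMax F ≤ F.trace := by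
  have : Nonempty (Fin n) := ⟨⟨0, hn⟩⟩
  rw [lamMax, hF.1.spectrum_real_eq_range_eigenvalues]
  refine csSup_le (Set.range_nonempty _) ?_
  rintro _ ⟨i, rfl⟩
  rw [hF.1.trace_eq_sum]
  exact Finset.single_le_sum (f := hF.1.eigenvalues) (fun i _ => hF.eigenvalues_nonneg i)
    (Finset.mem_univ i)

/-- The maximum of the largest eigenvalues over the uncertainty sets. -/
def lamSup (P : RobustSDP n m r) : ℝ := sSup {l : ℝ | ∃ i, ∃ A ∈ P.𝒜 i, l = lamMax A}

theorem psi_eq : P.psi = r * P.lamSup / lamMin (∑ j, P.start j) := rfl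

/-- The supremum in `lamSup` takes the default value `0` on an unbounded set, so a common bound `c`
of the traces is needed; the oracle's answer for the identity matrix will supply one. -/
theorem trace_le_lamSup (hn : 0 < n) {c : ℝ} (hc : ∀ i, ∀ A ∈ P.𝒜 i, A.trace ≤ c)
    {i : Fin m} {A : SqMat n} (hA : A ∈ P.𝒜 i) : A.trace ≤ n * P.lamSup := by
  refine (trace_le_lamMax (P.posSemidef i A hA).1).trans ?_
  refine mul_le_mul_of_nonneg_left (le_csSup ⟨c, ?_⟩ ⟨i, A, hA, rfl⟩) (Nat.cast_nonneg n)
  rintro _ ⟨j, B, hB, rfl⟩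
  exact (lamMax_le_trace (P.posSemidef j B hB) hn).trans (hc j B hB)

theorem Good.trace_le {y : Weights n m} (hy : P.Good y) {c : ℝ}
    (h : ∀ i, ∀ A ∈ P.𝒜 i, A.trace ≤ c) : (combine y).trace ≤ c := by
  have := hy.frob_combine_le (X := 1) (a := c) fun i A hA => by simpa [frob] using h i A hA
  simpa [frob] using this

theorem one_le_psi (hn : 0 < n) {c : ℝ} (hc : ∀ i, ∀ A ∈ P.𝒜 i, A.trace ≤ c) : 1 ≤ P.psi := by
  have hn' : (0 : ℝ) < n := by exact_mod_cast hn
  rw [psi_eq, one_le_div (lamMin_pos P.sum_start_posDef hn)]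
  have h1 := le_trace_of_lamMin P.sum_start_posDef.1
  have h2 : (∑ j, P.start j).trace ≤ r * (n * P.lamSup) := by
    rw [Matrix.trace_sum]
    calc _ ≤ ∑ _j : Fin r, n * P.lamSup :=
          Finset.sum_le_sum fun j _ => trace_le_lamSup hn hc (P.start_mem j)
      _ = _ := by simp
  have h3 : (n : ℝ) * lamMin (∑ j, P.start j) ≤ n * (r * P.lamSup) := by linarith
  exact le_of_mul_le_mul_left h3 hn'

theorem smul_eigenvalues_ge (hF : F.IsHermitian) {c : ℝ} (hc : 0 < c)
    (hcF : (c • F).IsHermitian) (i : Fin n) : c * lamMin F ≤ hcF.eigenvalues i := by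
  by_contra! hlt
  have h1 := (hcF.posDef_sub_smul_one_iff (hcF.eigenvalues i)).not.2 (by
    push Not; exact ⟨i, le_rfl⟩)
  apply h1
  have h2 : (F - (hcF.eigenvalues i / c) • (1 : SqMat n)).PosDef := by
    rw [hF.posDef_sub_smul_one_iff]
    intro j
    rw [div_lt_iff₀' hc]
    exact hlt.trans_le (mul_le_mul_of_nonneg_left (lamMin_le hF j) hc.le)
  have h3 := h2.smul hc
  rwa [smul_sub, smul_smul, mul_div_cancel₀ _ hc.ne'] at h3

/-! ### The number of iterations -/

/-- Runs with their number of transitions. -/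
inductive RunOf (P : RobustSDP n m r) (ε : ℝ) : ℕ → AlgState n m → Prop
  | init : RunOf P ε 0 P.algInit
  | step {t : ℕ} {q q' : AlgState n m} (h : RunOf P ε t q) (hs : P.AlgStep ε q q') :
      RunOf P ε (t + 1) q'

theorem RunOf.reachable {ε : ℝ} {t : ℕ} {q : AlgState n m} (h : RunOf P ε t q) :
    Relation.ReflTransGen (P.AlgStep ε) P.algInit q := by
  induction h with
  | init => exact .refl
  | step _ hs ih => exact ih.tail hs

/-- A bound for the variation of the potential in phase `s`. -/
def potGap (P : RobustSDP n m r) (s : ℕ) : ℝ :=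
  if s = 0 then 3 / 2 * Real.log (2 * P.psi) else 14 * phaseEps s

/-- A bound for the number of transitions before phase `s`. -/
def stepBound (P : RobustSDP n m r) : ℕ → ℝ
  | 0 => 0
  -- The summand `2` counts the iteration that ends the phase, for which no gain is claimed, and the
  -- change of phase.
  | s + 1 => stepBound P s + 10 * n * potGap P s / phaseEps s ^ 3 + 2

/-- The invariant that bounds the number `t` of transitions. -/
def CountInv (P : RobustSDP n m r) (t : ℕ) (q : AlgState n m) : Prop :=
  (phaseEps q.s < q.ν ∧ ∃ b : ℝ,
      (∃ θ, 0 < θ ∧ (combine q.y - θ • (1 : SqMat n)).PosDef ∧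
        b + (t - stepBound P q.s) * (phaseEps q.s ^ 3 / (10 * n)) ≤
          pot (phaseEps q.s) (combine q.y) θ) ∧
      ∀ y, P.Good y → ∀ θ, 0 < θ → (combine y - θ • (1 : SqMat n)).PosDef →
        pot (phaseEps q.s) (combine y) θ ≤ b + potGap P q.s) ∨
    (q.ν ≤ phaseEps q.s ∧ (t : ℝ) ≤ stepBound P (q.s + 1) - 1)

theorem CountInv.le (hn : 0 < n) {t : ℕ} {q : AlgState n m} (hy : P.Good q.y)
    (h : CountInv P t q) : (t : ℝ) ≤ stepBound P (q.s + 1) - 1 ∧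
      (phaseEps q.s < q.ν → (t : ℝ) ≤ stepBound P (q.s + 1) - 2) := by
  have hn' : (0 : ℝ) < n := by exact_mod_cast hn
  have he := phaseEps_pos q.s
  rcases h with ⟨-, b, ⟨θ, h0, hp, h1⟩, h2⟩ | ⟨h1, h2⟩
  · have h3 := h1.trans (h2 _ hy θ h0 hp)
    have h4 : (t : ℝ) ≤ stepBound P (q.s + 1) - 2 := by
      rw [stepBound, add_sub_cancel_right, ← sub_le_iff_le_add', le_div_iff₀ (by positivity)]
      have h5 : (t - stepBound P q.s) * (phaseEps q.s ^ 3 / (10 * n)) ≤ potGap P q.s := by linarith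
      rw [mul_div_assoc', div_le_iff₀ (by positivity)] at h5
      linarith
    exact ⟨by linarith, fun _ => h4⟩
  · exact ⟨h2, fun h => absurd h1 (not_le.2 h)⟩

theorem CountInv.init (hn : 0 < n) {c : ℝ} (hc : ∀ i, ∀ A ∈ P.𝒜 i, A.trace ≤ c) :
    CountInv P 0 P.algInit := by
  have hr : (0 : ℝ) < r := by exact_mod_cast P.pos_of_start hn
  have he : phaseEps 0 = 1 / 2 := by norm_num [phaseEps]
  have hF := (P.good_initWeights hn).posDef.1
  have hl := lamMin_pos P.sum_start_posDef hn
  have hψ := one_le_psi hn hc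
  have hL : 0 < P.lamSup := by
    by_contra! h
    rw [psi_eq] at hψ
    have : r * P.lamSup / lamMin (∑ j, P.start j) ≤ 0 :=
      div_nonpos_of_nonpos_of_nonneg (mul_nonpos_of_nonneg_of_nonpos hr.le h) hl.le
    linarith
  set l := 1 / (r : ℝ) * lamMin (∑ j, P.start j) with hldef
  have hl0 : 0 < l := by positivity
  have hle : ∀ i, l ≤ hF.eigenvalues i := by
    have : ∀ (G : SqMat n) (hG : G.IsHermitian), G = (1 / (r : ℝ)) • ∑ j, P.start j →
        ∀ i, l ≤ hG.eigenvalues i := by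
      rintro G hG rfl i
      exact smul_eigenvalues_ge P.sum_start_posDef.1 (by positivity) hG i
    exact this _ hF P.combine_initWeights
  have hlog := log_le_pot hn (e := 1 / 2) (by norm_num) hF hl0 hle
  -- The level `b` is the bound of `log_le_pot` with `l = λ_min / r`. The bound of `pot_le_log` with
  -- `L = lamSup` exceeds it by `(3/2) log (lamSup / (l / 2)) = (3/2) log (2 ψ)`.
  refine Or.inl ⟨?_, (1 + 1 / 2) * Real.log (l / 2), ⟨l / 2, by positivity, hlog.1, ?_⟩, ?_⟩
  · simp only [algInit, he]; norm_num
  · simpa [algInit, he, stepBound] using hlog.2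
  · intro y hy θ hθ hp
    simp only [algInit, he, potGap, if_true] at *
    refine (pot_le_log hn (by norm_num)
      (hy.trace_le fun i A hA => trace_le_lamSup hn hc hA) hθ hp).trans ?_
    have h2 : 2 * P.psi = P.lamSup / (l / 2) := by
      rw [psi_eq, hldef]; field_simp
    rw [h2, Real.log_div hL.ne' (by positivity)]
    linarith

/-- Within a phase the potential rises above its starting level `b` by `ε_s³/(10 n)` per transition
and cannot exceed `b + potGap`. At a change of phase the new level is the potential of accuracy `ε_s
/ 2` at the last iterate, which `pot_half_le` compares with the maximum. -/
theorem CountInv.step (hn : 0 < n) {ε : ℝ} {t : ℕ} {q q' : AlgState n m} (hr : RunInv P ε q)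
    (h : CountInv P t q) (hs : P.AlgStep ε q q') : CountInv P (t + 1) q' := by
  have hn' : (0 : ℝ) < n := by exact_mod_cast hn
  have hle := h.le hn hr.1
  cases hs with
  | inner θ X ν y' houter hinner hiter =>
    have he := phaseEps_pos q.s
    have he2 := phaseEps_le q.s
    obtain ⟨p, τ, hd, rfl⟩ := hiter.exists_data hn hr.1 he he2
    rcases le_or_gt ν (phaseEps q.s) with hν | hν
    · refine Or.inr ⟨hν, ?_⟩
      push_cast
      linarith [hle.2 hinner]
    · rcases h with ⟨-, b, ⟨θ₀, h0, hp, h1⟩, h2⟩ | ⟨h1, -⟩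
      swap
      · linarith
      refine Or.inl ⟨hν, b, ⟨θ, hd.pos, (hd.posDef_and_log_det hn he hr.1).1, ?_⟩, h2⟩
      refine le_trans ?_ (hd.pot_gain_of_lt hn he he2 hr.1 hν h0 hp)
      push_cast
      linarith
  | nextPhase houter hinner =>
    have he := phaseEps_pos q.s
    have he2 := phaseEps_le q.s
    rcases hr.2 with ⟨h1, -⟩ | ⟨-, -, hgood, hiter⟩
    · linarith
    obtain ⟨p, τ, hd, hy⟩ := hiter.exists_data hn hgood he he2
    have hld := hd.posDef_and_log_det hn he hgood
    rw [← hy] at hld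
    refine Or.inl ⟨?_, pot (phaseEps (q.s + 1)) (combine q.yPrev) q.θ,
      ⟨q.θ, hd.pos, hld.1, ?_⟩, ?_⟩
    · have := phaseEps_le (q.s + 1)
      simp only
      linarith
    · have hneg : ((t : ℝ) + 1 - stepBound P (q.s + 1)) *
          (phaseEps (q.s + 1) ^ 3 / (10 * n)) ≤ 0 := by
        apply mul_nonpos_of_nonpos_of_nonneg
        · linarith [hle.1]
        · have := phaseEps_pos (q.s + 1)
          positivity
      -- `pot_half_le` refers to the weights before the last update. That update did not decrease
      -- `log det` at the same `θ`, so the current weights start at or above the level.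
      have h3 := mul_le_mul_of_nonneg_left
        (show Real.log (combine q.yPrev - q.θ • (1 : SqMat n)).det ≤
            Real.log (combine q.y - q.θ • (1 : SqMat n)).det by
          nlinarith [hld.2, sq_nonneg q.ν])
        (by have := phaseEps_pos (q.s + 1); positivity : 0 ≤ phaseEps (q.s + 1) / n)
      unfold pot
      push_cast
      linarith
    · intro y hy z hz hzp
      have := hd.pot_half_le hn he he2 hinner hy hz hzp
      simp only [phaseEps_succ, potGap, Nat.add_eq_zero_iff, one_ne_zero, and_false, if_false]
      linarith

/-- Phase `s ≥ 1` contributes `140 n / ε_s² + 2`. As `1/ε_s²` quadruples from phase to phase, the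
bound for the earlier phases shrinks to a quarter in the new unit, and `50 + 140 + 2 ≤ 200`. Phase
`0` contributes `10 n · (3/2) log (2 ψ) · 8 + 2`. -/
theorem stepBound_le (hn : 0 < n) (s : ℕ) :
    stepBound P (s + 1) ≤ 120 * n * Real.log (2 * P.psi) + 200 * n / phaseEps s ^ 2 := by
  have hn1 : (1 : ℝ) ≤ n := by exact_mod_cast hn
  induction s with
  | zero =>
    have he : phaseEps 0 = 1 / 2 := by norm_num [phaseEps]
    simp only [stepBound, potGap, if_true, he]
    ring_nf
    linarith
  | succ s ih =>
    rw [stepBound]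
    have he := phaseEps_pos (s + 1)
    have he1 := phaseEps_le (s + 1)
    have hs : phaseEps s = 2 * phaseEps (s + 1) := by rw [phaseEps_succ]; ring
    rw [hs] at ih
    simp only [potGap, Nat.add_eq_zero_iff, one_ne_zero, and_false, if_false]
    set e := phaseEps (s + 1)
    have h1 : 10 * n * (14 * e) / e ^ 3 = 140 * (n / e ^ 2) := by field_simp; norm_num
    have h2 : 200 * n / (2 * e) ^ 2 = 50 * (n / e ^ 2) := by field_simp; norm_num
    have h3 : 200 * n / e ^ 2 = 200 * (n / e ^ 2) := by ring
    have h4 : (1 : ℝ) ≤ n / e ^ 2 := by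
      rw [one_le_div (by positivity)]
      nlinarith
    rw [h1, h3]
    rw [h2] at ih
    linarith

theorem RunOf.runInv (hn : 0 < n) {ε : ℝ} {t : ℕ} {q : AlgState n m} (h : RunOf P ε t q) :
    RunInv P ε q := RunInv.of_reachable hn h.reachable

theorem RunOf.countInv (hn : 0 < n) {c : ℝ} (hc : ∀ i, ∀ A ∈ P.𝒜 i, A.trace ≤ c) {ε : ℝ} {t : ℕ}
    {q : AlgState n m} (h : RunOf P ε t q) : CountInv P t q := by
  induction h with
  | init => exact CountInv.init hn hc
  | step h hs ih => exact ih.step hn (h.runInv hn) hs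

theorem half_le_log_two_psi (hψ : 1 ≤ P.psi) : 1 / 2 ≤ Real.log (2 * P.psi) := by
  have h1 := Real.log_le_log (by norm_num : (0 : ℝ) < 2) (by linarith : 2 ≤ 2 * P.psi)
  have := Real.log_two_gt_d9
  linarith

theorem AlgStep.lt {ε : ℝ} {q q' : AlgState n m} (h : P.AlgStep ε q q') : ε < phaseEps q.s := by
  cases h <;> assumption

/-- The number of transitions of a run. -/
theorem RunOf.le (hn : 0 < n) {c : ℝ} (hc : ∀ i, ∀ A ∈ P.𝒜 i, A.trace ≤ c) {ε : ℝ} (hε : 0 < ε)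
    (hε2 : ε < 1 / 2) {t : ℕ} {q : AlgState n m} (h : RunOf P ε t q) :
    (t : ℝ) ≤ 500 * (n * Real.log (2 * P.psi) / ε ^ 2) := by
  have hψ := one_le_psi hn hc
  have hlog := half_le_log_two_psi hψ
  have hn1 : (1 : ℝ) ≤ n := by exact_mod_cast hn
  have hε4 : ε ^ 2 ≤ 1 / 4 := by nlinarith
  set l := Real.log (2 * P.psi)
  rw [mul_div_assoc', le_div_iff₀ (by positivity)]
  cases h with
  | init => simp; positivity
  | @step t q _ h hs =>
    have h1 := ((h.countInv hn hc).le hn (h.runInv hn).1).1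
    have h2 := stepBound_le (P := P) hn q.s
    have h3 : 200 * n / phaseEps q.s ^ 2 ≤ 200 * n / ε ^ 2 := by
      have := hs.lt
      gcongr
    have h4 : ((t + 1 : ℕ) : ℝ) ≤ 120 * n * l + 200 * n / ε ^ 2 := by push_cast; linarith
    calc ((t + 1 : ℕ) : ℝ) * ε ^ 2 ≤ (120 * n * l + 200 * n / ε ^ 2) * ε ^ 2 := by gcongr
      _ = 120 * (n * l) * ε ^ 2 + 200 * n := by field_simp
      -- Uses `ε² ≤ 1/4` and `1 ≤ 2 log (2 ψ)`, the latter because `ψ ≥ 1`.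
      _ ≤ 120 * (n * l) * (1 / 4) + 200 * (n * (2 * l)) := by
        have : (n : ℝ) * 1 ≤ n * (2 * l) := by gcongr; linarith
        gcongr
        linarith
      _ ≤ _ := by
        have : 0 ≤ (n : ℝ) * l := by positivity
        linarith

end RobustSDP

namespace RealRAM

/-! ### Total correctness with cost bounds -/

/-- Program `c` started with memory `σ` halts within `N` steps and `K` oracle calls, with a memory
that satisfies `Q`. -/
def Runs (𝒪 : Oracle) (c : Program) (σ : Store) (N : ℝ) (K : ℕ) (Q : Store → Prop) : Prop :=
  ∃ (σ' : Store) (s k : ℕ), Exec 𝒪 c σ σ' s k ∧ (s : ℝ) ≤ N ∧ k ≤ K ∧ Q σ'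

variable {𝒪 : Oracle} {b : Test} {c d : Program} {σ : Store} {N N₁ N₂ : ℝ} {K K₁ K₂ : ℕ}
  {Q Q₁ : Store → Prop}

namespace Runs

theorem mono (h : Runs 𝒪 c σ N K Q₁) (hN : N ≤ N₁) (hQ : ∀ σ', Q₁ σ' → Q σ') :
    Runs 𝒪 c σ N₁ K Q := by
  obtain ⟨σ', s, k, h1, h2, h3, h4⟩ := h
  exact ⟨σ', s, k, h1, h2.trans hN, h3, hQ _ h4⟩

theorem le (h : Runs 𝒪 c σ N K Q) (hN : N ≤ N₁) : Runs 𝒪 c σ N₁ K Q := h.mono hN fun _ h => h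

theorem skip (h : Q σ) : Runs 𝒪 .skip σ 1 0 Q := ⟨σ, 1, 0, .skip σ, by simp, le_rfl, h⟩

theorem setNat {a : ℕ} {idx e : NatExp} (h : Q (σ.writeNat a (idx.eval σ) (e.eval σ))) :
    Runs 𝒪 (.setNat a idx e) σ 1 0 Q := ⟨_, 1, 0, .setNat σ a idx e, by simp, le_rfl, h⟩

theorem setReal {a : ℕ} {idx : NatExp} {e : RealExp}
    (h : Q (σ.writeReal a (idx.eval σ) (e.eval σ))) :
    Runs 𝒪 (.setReal a idx e) σ 1 0 Q := ⟨_, 1, 0, .setReal σ a idx e, by simp, le_rfl, h⟩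

theorem seq (hc : Runs 𝒪 c σ N₁ K₁ Q₁) (hd : ∀ σ', Q₁ σ' → Runs 𝒪 d σ' N₂ K₂ Q) :
    Runs 𝒪 (.seq c d) σ (N₁ + N₂) (K₁ + K₂) Q := by
  obtain ⟨σ₁, s₁, k₁, h1, h2, h3, h4⟩ := hc
  obtain ⟨σ₂, s₂, k₂, g1, g2, g3, g4⟩ := hd σ₁ h4
  exact ⟨σ₂, s₁ + s₂, k₁ + k₂, .seq h1 g1, by push_cast; linarith, by omega, g4⟩

theorem iteTrue (hb : b.Holds σ) (h : Runs 𝒪 c σ N K Q) : Runs 𝒪 (.ite b c d) σ (1 + N) K Q := by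
  obtain ⟨σ₁, s₁, k₁, h1, h2, h3, h4⟩ := h
  exact ⟨σ₁, 1 + s₁, k₁, .iteTrue hb h1, by push_cast; linarith, h3, h4⟩

theorem iteFalse (hb : ¬ b.Holds σ) (h : Runs 𝒪 d σ N K Q) :
    Runs 𝒪 (.ite b c d) σ (1 + N) K Q := by
  obtain ⟨σ₁, s₁, k₁, h1, h2, h3, h4⟩ := h
  exact ⟨σ₁, 1 + s₁, k₁, .iteFalse hb h1, by push_cast; linarith, h3, h4⟩

theorem loopTrue (hb : b.Holds σ) (hc : Runs 𝒪 c σ N₁ K₁ Q₁)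
    (hd : ∀ σ', Q₁ σ' → Runs 𝒪 (.loop b c) σ' N₂ K₂ Q) :
    Runs 𝒪 (.loop b c) σ (1 + N₁ + N₂) (K₁ + K₂) Q := by
  obtain ⟨σ₁, s₁, k₁, h1, h2, h3, h4⟩ := hc
  obtain ⟨σ₂, s₂, k₂, g1, g2, g3, g4⟩ := hd σ₁ h4
  exact ⟨σ₂, 1 + s₁ + s₂, k₁ + k₂, .loopTrue hb h1 g1, by push_cast; linarith, by omega, g4⟩

theorem loopFalse (hb : ¬ b.Holds σ) (h : Q σ) : Runs 𝒪 (.loop b c) σ 1 0 Q :=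
  ⟨σ, 1, 0, .loopFalse hb, by simp, le_rfl, h⟩

theorem cost_nonneg (h : Runs 𝒪 c σ N K Q) : 0 ≤ N := by
  obtain ⟨_, s, _, _, h2, _⟩ := h
  exact (Nat.cast_nonneg s).trans h2

end Runs

/-! ### The arrays that a program writes -/

/-- The program contains an assignment to the array `a` of natural numbers. -/
def Program.WritesNat (a : ℕ) : Program → Prop
  | .skip => False
  | .setNat b _ _ => a = b
  | .setReal _ _ _ => False
  | .seq c d => c.WritesNat a ∨ d.WritesNat a
  | .ite _ c d => c.WritesNat a ∨ d.WritesNat a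
  | .loop _ c => c.WritesNat a
  | .callOracle _ i _ => a = i

/-- The program contains an assignment to the array `a` of reals. -/
def Program.WritesReal (a : ℕ) : Program → Prop
  | .skip => False
  | .setNat _ _ _ => False
  | .setReal b _ _ => a = b
  | .seq c d => c.WritesReal a ∨ d.WritesReal a
  | .ite _ c d => c.WritesReal a ∨ d.WritesReal a
  | .loop _ c => c.WritesReal a
  | .callOracle _ _ d => a = d

theorem Exec.nat_eq {σ' : Store} {s k : ℕ} (h : Exec 𝒪 c σ σ' s k) {a : ℕ}
    (ha : ¬ c.WritesNat a) : σ'.nat a = σ.nat a := by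
  induction h with
  | skip => rfl
  | setNat => exact Function.update_of_ne (by simpa [Program.WritesNat] using ha) _ _
  | setReal => rfl
  | seq _ _ ih1 ih2 =>
    simp only [Program.WritesNat, not_or] at ha
    rw [ih2 ha.2, ih1 ha.1]
  | iteTrue _ _ ih =>
    simp only [Program.WritesNat, not_or] at ha
    exact ih ha.1
  | iteFalse _ _ ih =>
    simp only [Program.WritesNat, not_or] at ha
    exact ih ha.2
  | loopTrue _ _ _ ih1 ih2 => rw [ih2 ha, ih1 ha]
  | loopFalse => rfl
  | callOracle => exact Function.update_of_ne (by simpa [Program.WritesNat] using ha) _ _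

theorem Exec.real_eq {σ' : Store} {s k : ℕ} (h : Exec 𝒪 c σ σ' s k) {a : ℕ}
    (ha : ¬ c.WritesReal a) : σ'.real a = σ.real a := by
  induction h with
  | skip => rfl
  | setNat => rfl
  | setReal => exact Function.update_of_ne (by simpa [Program.WritesReal] using ha) _ _
  | seq _ _ ih1 ih2 =>
    simp only [Program.WritesReal, not_or] at ha
    rw [ih2 ha.2, ih1 ha.1]
  | iteTrue _ _ ih =>
    simp only [Program.WritesReal, not_or] at ha
    exact ih ha.1
  | iteFalse _ _ ih =>
    simp only [Program.WritesReal, not_or] at ha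
    exact ih ha.2
  | loopTrue _ _ _ ih1 ih2 => rw [ih2 ha, ih1 ha]
  | loopFalse => rfl
  | callOracle => exact Function.update_of_ne (by simpa [Program.WritesReal] using ha) _ _

theorem Runs.frame (h : Runs 𝒪 c σ N K Q) :
    Runs 𝒪 c σ N K fun σ' => Q σ' ∧ (∀ a, ¬ c.WritesNat a → σ'.nat a = σ.nat a) ∧
      ∀ a, ¬ c.WritesReal a → σ'.real a = σ.real a := by
  obtain ⟨σ', s, k, h1, h2, h3, h4⟩ := h
  exact ⟨σ', s, k, h1, h2, h3, h4, fun a ha => h1.nat_eq ha, fun a ha => h1.real_eq ha⟩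

/-- An execution changes at most as many cells of an array as it has steps. -/
theorem Exec.exists_changed {σ' : Store} {s k : ℕ} (h : Exec 𝒪 c σ σ' s k) (a : ℕ) :
    ∃ S : Finset ℕ, S.card ≤ s ∧ ∀ l ∉ S, σ'.real a l = σ.real a l := by
  induction h with
  | skip => exact ⟨∅, by simp, fun _ _ => rfl⟩
  | setNat => exact ⟨∅, by simp, fun _ _ => rfl⟩
  | setReal σ b idx e =>
    refine ⟨{idx.eval σ}, by simp, fun l hl => ?_⟩
    have : l ≠ idx.eval σ := by simpa using hl
    by_cases h : a = b <;> simp [Store.writeReal, h, this]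
  | seq _ _ ih1 ih2 =>
    obtain ⟨S, h1, h2⟩ := ih1
    obtain ⟨S', h1', h2'⟩ := ih2
    refine ⟨S ∪ S', (Finset.card_union_le _ _).trans (by omega), fun l hl => ?_⟩
    simp only [Finset.mem_union, not_or] at hl
    rw [h2' l hl.2, h2 l hl.1]
  | iteTrue _ _ ih => exact ih.imp fun S h => ⟨by omega, h.2⟩
  | iteFalse _ _ ih => exact ih.imp fun S h => ⟨by omega, h.2⟩
  | loopTrue _ _ _ ih1 ih2 =>
    obtain ⟨S, h1, h2⟩ := ih1
    obtain ⟨S', h1', h2'⟩ := ih2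
    refine ⟨S ∪ S', (Finset.card_union_le _ _).trans (by omega), fun l hl => ?_⟩
    simp only [Finset.mem_union, not_or] at hl
    rw [h2' l hl.2, h2 l hl.1]
  | loopFalse => exact ⟨∅, by simp, fun _ _ => rfl⟩
  | callOracle σ src i dst =>
    refine ⟨Finset.range (𝒪.n * 𝒪.n), by simp, fun l hl => ?_⟩
    have : ¬ l < 𝒪.n * 𝒪.n := by simpa using hl
    by_cases h : a = dst <;> simp [Store.writeMatrix, Store.writeNat, h, this]

/-! ### Renaming the arrays of a program -/

def NatExp.shift : NatExp → NatExp
  | .lit k => .lit k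
  | .get a idx => .get (a + 100) idx.shift
  | .add e f => .add e.shift f.shift
  | .sub e f => .sub e.shift f.shift
  | .mul e f => .mul e.shift f.shift

def RealExp.shift : RealExp → RealExp
  | .ofNat e => .ofNat e.shift
  | .get a idx => .get (a + 100) idx.shift
  | .add e f => .add e.shift f.shift
  | .sub e f => .sub e.shift f.shift
  | .mul e f => .mul e.shift f.shift
  | .div e f => .div e.shift f.shift

def Test.shift : Test → Test
  | .natLt e f => .natLt e.shift f.shift
  | .realLt e f => .realLt e.shift f.shift
  | .not b => .not b.shift
  | .and b c => .and b.shift c.shift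

/-- The program with the number of each array increased by `100`. -/
def Program.shift : Program → Program
  | .skip => .skip
  | .setNat a idx e => .setNat (a + 100) idx.shift e.shift
  | .setReal a idx e => .setReal (a + 100) idx.shift e.shift
  | .seq c d => .seq c.shift d.shift
  | .ite b c d => .ite b.shift c.shift d.shift
  | .loop b c => .loop b.shift c.shift
  | .callOracle s i d => .callOracle (s + 100) (i + 100) (d + 100)

/-- The part of the memory that shifted programs see. -/
def Store.high (σ : Store) : Store := ⟨fun a => σ.nat (a + 100), fun a => σ.real (a + 100)⟩

theorem NatExp.eval_shift (e : NatExp) : e.shift.eval σ = e.eval σ.high := by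
  induction e <;> simp_all [NatExp.shift, NatExp.eval, Store.high]

theorem RealExp.eval_shift (e : RealExp) : e.shift.eval σ = e.eval σ.high := by
  induction e <;> simp_all [RealExp.shift, RealExp.eval, Store.high, NatExp.eval_shift]

theorem Test.holds_shift (b : Test) : b.shift.Holds σ ↔ b.Holds σ.high := by
  induction b <;> simp_all [Test.shift, Test.Holds, NatExp.eval_shift, RealExp.eval_shift]

theorem Store.high_writeNat (σ : Store) (a k v : ℕ) :
    (σ.writeNat (a + 100) k v).high = σ.high.writeNat a k v := by
  simp only [Store.high, Store.writeNat, Store.mk.injEq, and_true]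
  funext x
  by_cases h : x = a <;> simp [h]

theorem Store.high_writeReal (σ : Store) (a k : ℕ) (v : ℝ) :
    (σ.writeReal (a + 100) k v).high = σ.high.writeReal a k v := by
  simp only [Store.high, Store.writeReal, Store.mk.injEq, true_and]
  funext x
  by_cases h : x = a <;> simp [h]

theorem Store.high_writeMatrix (σ : Store) (n a : ℕ) (M : SqMat n) :
    (σ.writeMatrix n (a + 100) M).high = σ.high.writeMatrix n a M := by
  simp only [Store.high, Store.writeMatrix, Store.mk.injEq, true_and]
  funext x
  by_cases h : x = a <;> simp [h]

/-- The given multiplication program may use arbitrary arrays. Shifted by `100` it does the same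
work at the same cost in the upper part of the memory, and cannot touch the arrays below `100` that
the algorithm uses. -/
theorem Exec.shift {τ τ' : Store} {s k : ℕ} (h : Exec 𝒪 c τ τ' s k) :
    ∀ σ : Store, σ.high = τ → ∃ σ', Exec 𝒪 c.shift σ σ' s k ∧ σ'.high = τ' := by
  induction h with
  | skip => exact fun σ h => ⟨σ, .skip σ, h⟩
  | setNat τ a idx e =>
    rintro σ rfl
    refine ⟨_, .setNat σ _ _ _, ?_⟩
    rw [Store.high_writeNat, NatExp.eval_shift, NatExp.eval_shift]
  | setReal τ a idx e =>
    rintro σ rfl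
    refine ⟨_, .setReal σ _ _ _, ?_⟩
    rw [Store.high_writeReal, NatExp.eval_shift, RealExp.eval_shift]
  | seq _ _ ih1 ih2 =>
    intro σ h
    obtain ⟨σ₁, h1, h2⟩ := ih1 σ h
    obtain ⟨σ₂, g1, g2⟩ := ih2 σ₁ h2
    exact ⟨σ₂, .seq h1 g1, g2⟩
  | iteTrue hb _ ih =>
    rintro σ rfl
    obtain ⟨σ₁, h1, h2⟩ := ih σ rfl
    exact ⟨σ₁, .iteTrue ((Test.holds_shift _).2 hb) h1, h2⟩
  | iteFalse hb _ ih =>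
    rintro σ rfl
    obtain ⟨σ₁, h1, h2⟩ := ih σ rfl
    exact ⟨σ₁, .iteFalse ((Test.holds_shift _).not.2 hb) h1, h2⟩
  | loopTrue hb _ _ ih1 ih2 =>
    rintro σ rfl
    obtain ⟨σ₁, h1, h2⟩ := ih1 σ rfl
    obtain ⟨σ₂, g1, g2⟩ := ih2 σ₁ h2
    exact ⟨σ₂, .loopTrue ((Test.holds_shift _).2 hb) h1 g1, g2⟩
  | loopFalse hb =>
    rintro σ rfl
    exact ⟨σ, .loopFalse ((Test.holds_shift _).not.2 hb), rfl⟩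
  | callOracle τ src i dst =>
    rintro σ rfl
    refine ⟨_, .callOracle σ _ _ _, ?_⟩
    rw [Store.high_writeMatrix, Store.high_writeNat]
    rfl

theorem not_writesNat_shift {a : ℕ} (ha : a < 100) (c : Program) : ¬ c.shift.WritesNat a := by
  induction c <;> simp_all [Program.shift, Program.WritesNat] <;> omega

theorem not_writesReal_shift {a : ℕ} (ha : a < 100) (c : Program) : ¬ c.shift.WritesReal a := by
  induction c <;> simp_all [Program.shift, Program.WritesReal] <;> omega

/-! ### Matrix multiplication as a subprogram -/

/-- `mm` multiplies the `h × h` matrices in the real arrays `100` and `101` into the real array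
`102`, in at most `W h` steps, and writes no array with a number below `100`. -/
structure MulProg (mm : Program) (W : ℕ → ℝ) : Prop where
  runs : ∀ (𝒪 : Oracle) (σ : Store) (h : ℕ), 0 < h → σ.nat 100 0 = h →
    Runs 𝒪 mm σ (W h) 0 fun σ' => σ'.matrix h 102 0 = σ.matrix h 100 0 * σ.matrix h 101 0
  nat : ∀ a < 100, ¬ mm.WritesNat a
  real : ∀ a < 100, ¬ mm.WritesReal a
  sq_le : ∀ h : ℕ, 0 < h → (h : ℝ) * h ≤ W h
  two_mul_le : ∀ h : ℕ, 2 * W h ≤ W (h + h)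

/-- Zero factors are multiplied while the target array is full of ones: each of the `n²` cells of
the product must change, and by `Exec.exists_changed` that takes `n²` steps. -/
theorem IsMatMulExponent.sq_le {prog : Program} {C ω : ℝ}
    (h : ∀ (𝒪 : Oracle) (σ : Store) (n : ℕ), 0 < n → σ.nat 0 0 = n →
      ∃ (σ' : Store) (steps : ℕ), Exec 𝒪 prog σ σ' steps 0 ∧
        (steps : ℝ) ≤ C * (n : ℝ) ^ ω ∧
        σ'.matrix n 2 0 = σ.matrix n 0 0 * σ.matrix n 1 0) {n : ℕ} (hn : 0 < n) :
    (n : ℝ) * n ≤ C * (n : ℝ) ^ ω := by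
  obtain ⟨σ', s, hex, hs, hprod⟩ :=
    h ⟨0, fun Y => (0, Y)⟩ ⟨fun _ _ => n, fun a _ => if a = 2 then 1 else 0⟩ n hn rfl
  refine le_trans ?_ hs
  obtain ⟨S, hS, hsame⟩ := hex.exists_changed 2
  have hsub : Finset.range (n * n) ⊆ S := by
    intro l hl
    by_contra hlS
    have hl' : l < n * n := by simpa using hl
    have h1 := hsame l hlS
    have h2 := congrFun (congrFun hprod ⟨l / n, Nat.div_lt_of_lt_mul hl'⟩) ⟨l % n, Nat.mod_lt l hn⟩
    have h3 : l / n * n + l % n = l := Nat.div_add_mod' l n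
    simp only [Store.matrix, Matrix.of_apply, Matrix.mul_apply, zero_add, h3, h1] at h2
    simp at h2
  have := (Finset.card_le_card hsub).trans hS
  rw [Finset.card_range] at this
  exact_mod_cast this

theorem IsMatMulExponent.exists_mulProg {ω : ℝ} (h : IsMatMulExponent ω) :
    ∃ (mm : Program) (C : ℝ), 0 < C ∧ 2 ≤ ω ∧ MulProg mm fun n => C * (n : ℝ) ^ ω := by
  obtain ⟨prog, C, hprog⟩ := h
  have hsq := fun n hn => IsMatMulExponent.sq_le hprog (n := n) hn
  have hC : 0 < C := by
    have := hsq 1 one_pos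
    simp at this
    linarith
  -- Otherwise `n² ≤ C n^ω` would bound `n^(2 - ω)` by `C` for all `n`.
  have hω : 2 ≤ ω := by
    by_contra! hlt
    have ht := (tendsto_rpow_atTop (by linarith : 0 < 2 - ω)).comp tendsto_natCast_atTop_atTop
    obtain ⟨n, hn1, hn0⟩ := ((ht.eventually_gt_atTop C).and (Filter.eventually_gt_atTop 0)).exists
    have hn' : (0 : ℝ) < n := by exact_mod_cast hn0
    have h1 := hsq n hn0
    have h2 : (n : ℝ) * n = (n : ℝ) ^ (2 - ω) * (n : ℝ) ^ ω := by
      rw [← Real.rpow_add hn', sub_add_cancel, Real.rpow_two, sq]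
    rw [h2] at h1
    have h3 := le_of_mul_le_mul_right h1 (Real.rpow_pos_of_pos hn' ω)
    simp only [Function.comp] at hn1
    linarith
  refine ⟨prog.shift, C, hC, hω, ⟨fun 𝒪 σ h hh hσ => ?_, fun a ha => not_writesNat_shift ha _,
    fun a ha => not_writesReal_shift ha _, hsq, fun h => ?_⟩⟩
  · obtain ⟨τ', s, hex, hs, hprod⟩ := hprog 𝒪 σ.high h hh hσ
    obtain ⟨σ', h1, rfl⟩ := hex.shift σ rfl
    exact ⟨σ', s, 0, h1, hs, le_rfl, hprod⟩
  · have h1 : ((h + h : ℕ) : ℝ) ^ ω = 2 ^ ω * (h : ℝ) ^ ω := by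
      rw [← Real.mul_rpow (by norm_num) (Nat.cast_nonneg h)]
      push_cast
      ring_nf
    have h2 : (2 : ℝ) ≤ 2 ^ ω := by
      calc (2 : ℝ) = 2 ^ (1 : ℝ) := (Real.rpow_one 2).symm
        _ ≤ 2 ^ ω := Real.rpow_le_rpow_of_exponent_le (by norm_num) (by linarith)
    have h3 : 0 ≤ C * (h : ℝ) ^ ω := by positivity
    simp only [h1]
    nlinarith

/-! ### Counting loops -/

/-- `for ctr = 0, …, R - 1 do body`. -/
def forLoop (ctr : ℕ) (R : NatExp) (body : Program) : Program :=
  .seq (.setNat ctr (.lit 0) (.lit 0))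
    (.loop (.natLt (.get ctr (.lit 0)) R)
      (.seq body (.setNat ctr (.lit 0) (.add (.get ctr (.lit 0)) (.lit 1)))))

/-- The invariant `I j` is required right after the counter has been set to `j`; a round costs `B`
plus the test and the increment. -/
theorem forLoop_runs {ctr : ℕ} {Re : NatExp} {body : Program} {R : ℕ} {B : ℝ}
    (I : ℕ → Store → Prop) (h0 : I 0 (σ.writeNat ctr 0 0))
    (hR : ∀ j σ', I j σ' → Re.eval σ' = R)
    (hstep : ∀ j < R, ∀ σ', I j σ' → σ'.nat ctr 0 = j →
      Runs 𝒪 body σ' B 0 fun σ'' => σ''.nat ctr 0 = j ∧ I (j + 1) (σ''.writeNat ctr 0 (j + 1))) :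
    Runs 𝒪 (forLoop ctr Re body) σ (2 + R * (B + 2)) 0 fun σ' => I R σ' := by
  have key : ∀ d j, j + d = R → ∀ σ', I j σ' → σ'.nat ctr 0 = j →
      Runs 𝒪 (.loop (.natLt (.get ctr (.lit 0)) Re)
        (.seq body (.setNat ctr (.lit 0) (.add (.get ctr (.lit 0)) (.lit 1))))) σ'
        (1 + d * (B + 2)) 0 fun σ' => I R σ' := by
    intro d
    induction d with
    | zero =>
      intro j hj σ' hI hc
      obtain rfl : j = R := by omega
      refine (Runs.loopFalse ?_ hI).le (by simp)
      simp [Test.Holds, NatExp.eval, hR _ _ hI, hc]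
    | succ d ih =>
      intro j hj σ' hI hc
      refine (Runs.loopTrue (N₁ := B + 1) (K₁ := 0) (K₂ := 0) ?_
        (Runs.seq (K₁ := 0) (K₂ := 0) (hstep j (by omega) σ' hI hc)
          fun σ'' h'' => Runs.setNat (Q := fun τ => I (j + 1) τ ∧ τ.nat ctr 0 = j + 1) ?_)
        fun τ hτ => ih (j + 1) (by omega) τ hτ.1 hτ.2).le ?_
      · simp [Test.Holds, NatExp.eval, hR _ _ hI, hc]; omega
      · simp only [NatExp.eval, h''.1]
        exact ⟨h''.2, by simp [Store.writeNat]⟩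
      · push_cast; linarith
  refine (Runs.seq (K₁ := 0) (K₂ := 0) (Runs.setNat (Q := fun τ => τ = σ.writeNat ctr 0 0) rfl)
    fun τ hτ => key R 0 (by omega) τ (hτ ▸ h0) ?_).le (by linarith)
  rw [hτ]; simp [Store.writeNat]

/-- Entry `(i, j)` of a matrix stored row by row in a real array from cell `off` on, `i` and `j`
being the counters in the arrays `20` and `21`. -/
def cellIdx (off stride : NatExp) : NatExp :=
  .add (.add off (.mul (.get 20 (.lit 0)) stride)) (.get 21 (.lit 0))

def rd (a : ℕ) (off stride : NatExp) : RealExp := .get a (cellIdx off stride)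

/-- Store `e` (depending on the counters `i < R` and `j < C`) in the cells
`off + i * stride + j` of the real array `dst`. -/
def fill (R C : NatExp) (dst : ℕ) (off stride : NatExp) (e : RealExp) : Program :=
  forLoop 20 R (forLoop 21 C (.setReal dst (cellIdx off stride) e))

/-- The memories agree, except possibly for the counters and the real array `dst`. -/
structure Agree (dst : ℕ) (σ σ' : Store) : Prop where
  nat : ∀ a, a ≠ 20 → a ≠ 21 → σ'.nat a = σ.nat a
  real : ∀ a, a ≠ dst → σ'.real a = σ.real a

theorem Agree.refl (dst : ℕ) (σ : Store) : Agree dst σ σ := ⟨fun _ _ _ => rfl, fun _ _ => rfl⟩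

theorem Agree.writeCtr {dst : ℕ} {σ σ' : Store} (h : Agree dst σ σ') {ctr : ℕ}
    (hc : ctr = 20 ∨ ctr = 21) (k v : ℕ) : Agree dst σ (σ'.writeNat ctr k v) where
  nat a h1 h2 := by
    rw [← h.nat a h1 h2]
    exact Function.update_of_ne (by omega) _ _
  real a h1 := h.real a h1

/-- The hypothesis on `e` ranges over all memories that agree outside `dst`, so `e` must not depend
on the array being filled; a copy within one array has to pass through a second one. -/
theorem fill_runs {R C off stride : ℕ} {Re Ce offe stridee : NatExp} {dst : ℕ} {e : RealExp}
    (val : ℕ → ℕ → ℝ) (hR0 : 0 < R) (hC0 : 0 < C) (hCs : C ≤ stride)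
    (hR : ∀ σ', Agree dst σ σ' → Re.eval σ' = R) (hC : ∀ σ', Agree dst σ σ' → Ce.eval σ' = C)
    (hoff : ∀ σ', Agree dst σ σ' → offe.eval σ' = off)
    (hstr : ∀ σ', Agree dst σ σ' → stridee.eval σ' = stride)
    (hval : ∀ i < R, ∀ j < C, ∀ σ', Agree dst σ σ' → σ'.nat 20 0 = i → σ'.nat 21 0 = j →
      e.eval σ' = val i j) :
    Runs 𝒪 (fill Re Ce dst offe stridee e) σ (9 * (R * C)) 0 fun σ' => Agree dst σ σ' ∧
      (∀ i < R, ∀ j < C, σ'.real dst (off + i * stride + j) = val i j) ∧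
      ∀ k, (∀ i < R, ∀ j < C, off + i * stride + j ≠ k) → σ'.real dst k = σ.real dst k := by
  -- `C ≤ stride` keeps the rows from overlapping, so division with remainder by `stride` recovers
  -- `(i, j)`.
  have hinj : ∀ {i j i' j'}, j < C → j' < C → off + i * stride + j = off + i' * stride + j' →
      i = i' ∧ j = j' := by
    intro i j i' j' hj hj' h
    have h1 : stride * i + j = stride * i' + j' := by
      rw [mul_comm stride i, mul_comm stride i']; omega
    have h2 := congrArg (· / stride) h1
    have h3 := congrArg (· % stride) h1
    have hs : 0 < stride := by omega
    simp only [Nat.mul_add_div hs, Nat.mul_add_mod, Nat.div_eq_of_lt (show j < stride by omega),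
      Nat.div_eq_of_lt (show j' < stride by omega), Nat.mod_eq_of_lt (show j < stride by omega),
      Nat.mod_eq_of_lt (show j' < stride by omega)] at h2 h3
    omega
  -- The entries before `(i, j)` in lexicographic order have been written, and nothing outside the
  -- target cells.
  let I : ℕ → ℕ → Store → Prop := fun i j σ' => Agree dst σ σ' ∧
    (∀ i' j', j' < C → (i' < i ∨ i' = i ∧ j' < j) →
      σ'.real dst (off + i' * stride + j') = val i' j') ∧
    ∀ k, (∀ i' < R, ∀ j' < C, off + i' * stride + j' ≠ k) → σ'.real dst k = σ.real dst k
  have hI : ∀ i j σ' ctr v, (ctr = 20 ∨ ctr = 21) → I i j σ' → I i j (σ'.writeNat ctr 0 v) :=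
    fun i j σ' ctr v hc h => ⟨h.1.writeCtr hc _ _, h.2⟩
  refine (forLoop_runs (B := 2 + C * (1 + 2)) (R := R) (I := fun i σ' => I i 0 σ')
    (hI _ _ _ _ _ (Or.inl rfl) ⟨.refl _ _, fun _ _ _ h => by omega, fun _ _ => rfl⟩)
    (fun _ σ' h => hR σ' h.1) ?_).mono ?_ ?_
  · intro i hi σ₁ h₁ hc₁
    refine (forLoop_runs (B := 1) (R := C) (I := fun j σ' => I i j σ' ∧ σ'.nat 20 0 = i)
      ⟨hI _ _ _ _ _ (Or.inr rfl) h₁, by simpa [Store.writeNat] using hc₁⟩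
      (fun _ σ' h => hC σ' h.1.1) ?_).mono le_rfl ?_
    · rintro j hj σ₂ ⟨h₂, hi₂⟩ hj₂
      refine Runs.setReal ?_
      have hcell : (cellIdx offe stridee).eval σ₂ = off + i * stride + j := by
        simp [cellIdx, NatExp.eval, hoff _ h₂.1, hstr _ h₂.1, hi₂, hj₂]
      rw [hcell, hval i hi j hj σ₂ h₂.1 hi₂ hj₂]
      refine ⟨by simpa [Store.writeReal] using hj₂, hI _ _ _ _ _ (Or.inr rfl) ⟨?_, ?_, ?_⟩, ?_⟩
      · exact ⟨fun a h1 h2 => h₂.1.nat a h1 h2, fun a h1 => by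
          rw [← h₂.1.real a h1]; exact Function.update_of_ne h1 _ _⟩
      · intro i' j' hj' hlt
        simp only [Store.writeReal, Function.update_self]
        by_cases h : off + i' * stride + j' = off + i * stride + j
        · obtain ⟨rfl, rfl⟩ := hinj hj' hj h
          simp
        · rw [Function.update_of_ne h]
          refine h₂.2.1 i' j' hj' ?_
          rcases hlt with hlt | ⟨rfl, hlt⟩
          · exact Or.inl hlt
          · refine Or.inr ⟨rfl, ?_⟩
            rcases Nat.lt_succ_iff_lt_or_eq.1 hlt with h' | rfl
            · exact h'
            · exact absurd rfl h
      · intro k hk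
        simp only [Store.writeReal, Function.update_self]
        rw [Function.update_of_ne (hk i hi j hj).symm]
        exact h₂.2.2 k hk
      · simpa [Store.writeNat, Store.writeReal] using hi₂
    · rintro σ₂ ⟨h₂, hi₂⟩
      refine ⟨hi₂, hI _ _ _ _ _ (Or.inl rfl) ⟨h₂.1, fun i' j' hj' hlt => h₂.2.1 i' j' hj' ?_,
        h₂.2.2⟩⟩
      omega
  · have h1 : (1 : ℝ) ≤ R := by exact_mod_cast hR0
    have h2 : (1 : ℝ) ≤ C := by exact_mod_cast hC0
    nlinarith
  · exact fun σ' h => ⟨h.1, fun i hi j hj => h.2.1 i j hj (Or.inl hi), h.2.2⟩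

/-- Store the sum of `e` over the counters `i < R` and `j < C` in cell `0` of the real array
`dst`. -/
def acc (R C : NatExp) (dst : ℕ) (e : RealExp) : Program :=
  .seq (.setReal dst (.lit 0) (.ofNat (.lit 0)))
    (forLoop 20 R (forLoop 21 C
      (.setReal dst (.lit 0) (.add (.get dst (.lit 0)) e))))

theorem acc_runs {R C : ℕ} {Re Ce : NatExp} {dst : ℕ} {e : RealExp}
    (val : ℕ → ℕ → ℝ) (hR0 : 0 < R) (hC0 : 0 < C)
    (hR : ∀ σ', Agree dst σ σ' → Re.eval σ' = R) (hC : ∀ σ', Agree dst σ σ' → Ce.eval σ' = C)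
    (hval : ∀ i < R, ∀ j < C, ∀ σ', Agree dst σ σ' → σ'.nat 20 0 = i → σ'.nat 21 0 = j →
      e.eval σ' = val i j) :
    Runs 𝒪 (acc Re Ce dst e) σ (10 * (R * C)) 0 fun σ' => Agree dst σ σ' ∧
      σ'.real dst 0 = ∑ i ∈ Finset.range R, ∑ j ∈ Finset.range C, val i j := by
  let I : ℕ → ℕ → Store → Prop := fun i j σ' => Agree dst σ σ' ∧ σ'.real dst 0 =
    ∑ i' ∈ Finset.range i, ∑ j' ∈ Finset.range C, val i' j' + ∑ j' ∈ Finset.range j, val i j'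
  have hI : ∀ i j σ' ctr v, (ctr = 20 ∨ ctr = 21) → I i j σ' → I i j (σ'.writeNat ctr 0 v) :=
    fun i j σ' ctr v hc h => ⟨h.1.writeCtr hc _ _, h.2⟩
  have hW : ∀ {σ' : Store} (v : ℝ), Agree dst σ σ' → Agree dst σ (σ'.writeReal dst 0 v) :=
    fun v h => ⟨fun a h1 h2 => h.nat a h1 h2, fun a h1 => by
      rw [← h.real a h1]; exact Function.update_of_ne h1 _ _⟩
  refine (Runs.seq (K₁ := 0) (K₂ := 0) (N₂ := 2 + R * (2 + C * (1 + 2) + 2))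
    (Q := fun σ' => I R 0 σ')
    (Runs.setReal (Q := fun τ => τ = σ.writeReal dst 0 0) (by simp [NatExp.eval, RealExp.eval]))
    ?_).mono ?_ ?_
  · rintro τ rfl
    refine forLoop_runs (I := fun i σ' => I i 0 σ')
      (hI _ _ _ _ _ (Or.inl rfl) ⟨hW _ (.refl _ _), by simp [Store.writeReal]⟩)
      (fun _ σ' h => hR σ' h.1) ?_
    intro i hi σ₁ h₁ hc₁
    refine (forLoop_runs (B := 1) (R := C) (I := fun j σ' => I i j σ' ∧ σ'.nat 20 0 = i)
      ⟨hI _ _ _ _ _ (Or.inr rfl) h₁, by simpa [Store.writeNat] using hc₁⟩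
      (fun _ σ' h => hC σ' h.1.1) ?_).mono le_rfl ?_
    · rintro j hj σ₂ ⟨h₂, hi₂⟩ hj₂
      refine Runs.setReal ?_
      simp only [NatExp.eval, RealExp.eval, hval i hi j hj σ₂ h₂.1 hi₂ hj₂]
      refine ⟨by simpa [Store.writeReal] using hj₂,
        hI _ _ _ _ _ (Or.inr rfl) ⟨hW _ h₂.1, ?_⟩, by
          simpa [Store.writeNat, Store.writeReal] using hi₂⟩
      rw [Finset.sum_range_succ _ j, ← add_assoc, ← h₂.2]
      simp [Store.writeReal]
    · rintro σ₂ ⟨h₂, hi₂⟩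
      refine ⟨hi₂, hI _ _ _ _ _ (Or.inl rfl) ⟨h₂.1, ?_⟩⟩
      rw [h₂.2, Finset.sum_range_succ _ i]
      simp
  · have h1 : (1 : ℝ) ≤ R := by exact_mod_cast hR0
    have h2 : (1 : ℝ) ≤ C := by exact_mod_cast hC0
    nlinarith
  · exact fun σ' h => ⟨h.1, by simpa using h.2⟩

end RealRAM

/-! ### Inversion by `2 × 2` blocks -/

namespace Matrix

variable {h : ℕ}

/-- The blocks of a matrix of even order. -/
def blk₁₁ (A : SqMat (h + h)) : SqMat h := A.submatrix (Fin.castAdd h) (Fin.castAdd h)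
def blk₁₂ (A : SqMat (h + h)) : SqMat h := A.submatrix (Fin.castAdd h) (Fin.natAdd h)
def blk₂₁ (A : SqMat (h + h)) : SqMat h := A.submatrix (Fin.natAdd h) (Fin.castAdd h)
def blk₂₂ (A : SqMat (h + h)) : SqMat h := A.submatrix (Fin.natAdd h) (Fin.natAdd h)

theorem submatrix_eq_fromBlocks (A : SqMat (h + h)) :
    A.submatrix finSumFinEquiv finSumFinEquiv =
      fromBlocks (blk₁₁ A) (blk₁₂ A) (blk₂₁ A) (blk₂₂ A) := by
  ext i j
  rcases i with i | i <;> rcases j with j | j <;> simp [blk₁₁, blk₁₂, blk₂₁, blk₂₂]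

/-- The Schur complement of the first block. -/
def schur (A : SqMat (h + h)) : SqMat h := blk₂₂ A - blk₂₁ A * ((blk₁₁ A)⁻¹ * blk₁₂ A)

theorem IsHermitian.blk₂₁_eq {A : SqMat (h + h)} (hA : A.IsHermitian) : blk₂₁ A = (blk₁₂ A)ᴴ := by
  ext i j
  have := congrFun (congrFun hA (Fin.natAdd h i)) (Fin.castAdd h j)
  simpa [blk₂₁, blk₁₂] using this.symm

theorem IsHermitian.blk₁₁ {A : SqMat (h + h)} (hA : A.IsHermitian) : (blk₁₁ A).IsHermitian :=
  hA.submatrix _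

theorem IsHermitian.schur {A : SqMat (h + h)} (hA : A.IsHermitian) : (schur A).IsHermitian := by
  unfold Matrix.schur
  refine IsHermitian.sub (hA.submatrix _) ?_
  have h1 : ((Matrix.blk₁₁ A)⁻¹)ᴴ = (Matrix.blk₁₁ A)⁻¹ := hA.blk₁₁.inv
  have h2 := hA.blk₂₁_eq
  unfold IsHermitian
  rw [h2, conjTranspose_mul, conjTranspose_mul, h1, conjTranspose_conjTranspose, mul_assoc]

/-- The Schur complement decides semidefiniteness, and `det A = det A₁₁ · det S` upgrades this to
definiteness in both directions. So the recursion can detect failure at the level of single diagonal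
entries. -/
theorem IsHermitian.posDef_iff_blocks {A : SqMat (h + h)} (hA : A.IsHermitian) :
    A.PosDef ↔ (Matrix.blk₁₁ A).PosDef ∧ (Matrix.schur A).PosDef := by
  have hsub : A.PosDef → (Matrix.blk₁₁ A).PosDef := fun hp =>
    hp.submatrix (Fin.castAdd_injective h h)
  have hiff : A.PosDef ↔ (A.submatrix finSumFinEquiv finSumFinEquiv).PosDef := by
    refine ⟨fun hp => hp.submatrix (finSumFinEquiv (m := h) (n := h)).injective, fun hp => ?_⟩
    have := hp.submatrix (finSumFinEquiv (m := h) (n := h)).symm.injective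
    simpa using this
  by_cases h11 : (Matrix.blk₁₁ A).PosDef
  swap
  · exact ⟨fun hp => absurd (hsub hp) h11, fun hp => absurd hp.1 h11⟩
  let _ : Invertible (Matrix.blk₁₁ A) := h11.isUnit.invertible
  have hS : blk₂₂ A - (blk₁₂ A)ᴴ * (Matrix.blk₁₁ A)⁻¹ * blk₁₂ A = Matrix.schur A := by
    rw [Matrix.schur, hA.blk₂₁_eq, mul_assoc]
  have hdet : (A.submatrix finSumFinEquiv finSumFinEquiv).det
      = (Matrix.blk₁₁ A).det * (Matrix.schur A).det := by
    rw [submatrix_eq_fromBlocks, det_fromBlocks₁₁, invOf_eq_nonsing_inv, hA.blk₂₁_eq, hS]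
  have hpsd : (A.submatrix finSumFinEquiv finSumFinEquiv).PosSemidef ↔
      (Matrix.schur A).PosSemidef := by
    rw [submatrix_eq_fromBlocks, hA.blk₂₁_eq, PosDef.fromBlocks₁₁ _ _ h11, hS]
  rw [hiff]
  constructor
  · intro hp
    refine ⟨h11, (hpsd.1 hp.posSemidef).posDef_iff_det_ne_zero.2 fun h0 => ?_⟩
    have := hp.det_pos.ne'
    rw [hdet, h0, mul_zero] at this
    exact this rfl
  · rintro ⟨-, hp⟩
    refine (hpsd.2 hp.posSemidef).posDef_iff_det_ne_zero.2 ?_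
    rw [hdet]
    exact mul_ne_zero h11.det_pos.ne' hp.det_pos.ne'

/-- The products are grouped as the program stores them: with `P = A₁₁⁻¹`, `T = P A₁₂`, `U = A₂₁ P`
and `R = S⁻¹` the blocks of the inverse are `P + T R U`, `-(T R)`, `-(R U)` and `R`. -/
theorem PosDef.inv_eq_of_blocks {A B : SqMat (h + h)} (hA : A.PosDef)
    (h₁₁ : blk₁₁ B = (blk₁₁ A)⁻¹ +
      ((blk₁₁ A)⁻¹ * blk₁₂ A) * (schur A)⁻¹ * (blk₂₁ A * (blk₁₁ A)⁻¹))
    (h₁₂ : blk₁₂ B = -(((blk₁₁ A)⁻¹ * blk₁₂ A) * (schur A)⁻¹))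
    (h₂₁ : blk₂₁ B = -((schur A)⁻¹ * (blk₂₁ A * (blk₁₁ A)⁻¹)))
    (h₂₂ : blk₂₂ B = (schur A)⁻¹) : B = A⁻¹ := by
  obtain ⟨hp, hs⟩ := hA.1.posDef_iff_blocks.1 hA
  have hpu := (isUnit_iff_isUnit_det _).1 hp.isUnit
  have hsu := (isUnit_iff_isUnit_det _).1 hs.isUnit
  symm
  apply inv_eq_right_inv
  have hmul : A.submatrix finSumFinEquiv finSumFinEquiv *
      B.submatrix finSumFinEquiv finSumFinEquiv = 1 := by
    rw [submatrix_eq_fromBlocks, submatrix_eq_fromBlocks, fromBlocks_multiply, h₁₁, h₁₂, h₂₁, h₂₂,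
      ← fromBlocks_one]
    have hD : blk₂₂ A = schur A + blk₂₁ A * ((blk₁₁ A)⁻¹ * blk₁₂ A) := by
      rw [schur, sub_add_cancel]
    rw [hD]
    generalize schur A = S at *
    generalize blk₁₁ A = a at *
    generalize blk₁₂ A = b
    generalize blk₂₁ A = c
    have e1 : a * a⁻¹ = 1 := mul_nonsing_inv _ hpu
    have e2 : S * S⁻¹ = 1 := mul_nonsing_inv _ hsu
    have e3 : ∀ x, a * (a⁻¹ * x) = x := fun x => by rw [← mul_assoc, e1, one_mul]
    have e4 : ∀ x, S * (S⁻¹ * x) = x := fun x => by rw [← mul_assoc, e2, one_mul]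
    congr 1 <;> simp only [mul_add, add_mul, mul_neg, mul_assoc, e1, e2, e3, e4] <;> abel
  rw [submatrix_mul_equiv] at hmul
  have := congrArg (fun M => M.submatrix finSumFinEquiv.symm finSumFinEquiv.symm) hmul
  simpa using this

end Matrix

/-! ### Matrices in memory and subprograms acting on them. -/

namespace RealRAM

/-- `dbl k = 2 ^ k`. -/
def dbl : ℕ → ℕ
  | 0 => 1
  | k + 1 => dbl k + dbl k

theorem dbl_pos : ∀ k, 0 < dbl k
  | 0 => one_pos
  | k + 1 => Nat.add_pos_left (dbl_pos k) _

theorem dbl_mono : Monotone dbl := monotone_nat_of_le_succ fun k => by simp [dbl]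

/-- The memories agree on the arrays of natural numbers below `100`, except for the counters. -/
def LowNat (σ σ' : Store) : Prop := ∀ a, a < 100 → a ≠ 20 → a ≠ 21 → σ'.nat a = σ.nat a

/-- The memories agree on all arrays below `100`, except for the counters. -/
def Low (σ σ' : Store) : Prop := LowNat σ σ' ∧ ∀ a, a < 100 → σ'.real a = σ.real a

theorem LowNat.trans {σ₁ σ₂ σ₃ : Store} (h : LowNat σ₁ σ₂) (h' : LowNat σ₂ σ₃) : LowNat σ₁ σ₃ :=
  fun a h1 h2 h3 => (h' a h1 h2 h3).trans (h a h1 h2 h3)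

theorem Agree.lowNat {dst : ℕ} {σ σ' : Store} (h : Agree dst σ σ') : LowNat σ σ' :=
  fun a _ h2 h3 => h.nat a h2 h3

theorem Low.trans {σ₁ σ₂ σ₃ : Store} (h : Low σ₁ σ₂) (h' : Low σ₂ σ₃) : Low σ₁ σ₃ :=
  ⟨h.1.trans h'.1, fun a h1 => (h'.2 a h1).trans (h.2 a h1)⟩

theorem Agree.low {dst : ℕ} (hd : 100 ≤ dst) {σ σ' : Store} (h : Agree dst σ σ') : Low σ σ' :=
  ⟨h.lowNat, fun a h1 => h.real a (by omega)⟩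

/-- The matrix `M` is stored in the real array `a` from cell `off` on, with the given distance
between the rows. -/
def IsMat {R C : ℕ} (σ : Store) (a off stride : ℕ) (M : Matrix (Fin R) (Fin C) ℝ) : Prop :=
  ∀ (i : Fin R) (j : Fin C), σ.real a (off + i * stride + j) = M i j

theorem IsMat.congr {R C : ℕ} {σ σ' : Store} {a off stride : ℕ} {M : Matrix (Fin R) (Fin C) ℝ}
    (h : IsMat σ a off stride M) (hr : σ'.real a = σ.real a) : IsMat σ' a off stride M :=
  fun i j => by rw [hr]; exact h i j

theorem isMat_matrix (σ : Store) (h a off : ℕ) : IsMat σ a off h (σ.matrix h a off) :=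
  fun _ _ => rfl

theorem IsMat.matrix_eq {σ : Store} {h a off : ℕ} {M : SqMat h} (hM : IsMat σ a off h M) :
    σ.matrix h a off = M := by
  ext i j
  exact hM i j

theorem IsMat.mono {R C : ℕ} {σ σ' : Store} {a off stride : ℕ} {M : Matrix (Fin R) (Fin C) ℝ}
    (h : IsMat σ a off stride M) (hr : ∀ c, off ≤ c → σ'.real a c = σ.real a c) :
    IsMat σ' a off stride M :=
  fun i j => by rw [hr _ (by rw [add_assoc]; exact Nat.le_add_right _ _)]; exact h i j

theorem rd_eval {a i j : ℕ} {off stride : NatExp} {σ : Store} (hi : σ.nat 20 0 = i)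
    (hj : σ.nat 21 0 = j) :
    (rd a off stride).eval σ = σ.real a (off.eval σ + i * stride.eval σ + j) := by
  simp [rd, cellIdx, RealExp.eval, NatExp.eval, hi, hj]

variable {𝒪 : Oracle} {σ : Store}

theorem fill_mat_runs {R C off stride : ℕ} {Re Ce offe stridee : NatExp} {dst : ℕ} {e : RealExp}
    (M : Matrix (Fin R) (Fin C) ℝ) (hR0 : 0 < R) (hC0 : 0 < C) (hCs : C ≤ stride)
    (hR : ∀ σ', Agree dst σ σ' → Re.eval σ' = R) (hC : ∀ σ', Agree dst σ σ' → Ce.eval σ' = C)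
    (hoff : ∀ σ', Agree dst σ σ' → offe.eval σ' = off)
    (hstr : ∀ σ', Agree dst σ σ' → stridee.eval σ' = stride)
    (hval : ∀ (i : Fin R) (j : Fin C), ∀ σ', Agree dst σ σ' → σ'.nat 20 0 = i →
      σ'.nat 21 0 = j → e.eval σ' = M i j) :
    Runs 𝒪 (fill Re Ce dst offe stridee e) σ (9 * (R * C)) 0 fun σ' => Agree dst σ σ' ∧
      IsMat σ' dst off stride M ∧
      ∀ k, (∀ (i : Fin R) (j : Fin C), off + i * stride + j ≠ k) →
        σ'.real dst k = σ.real dst k := by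
  refine (fill_runs (R := R) (C := C) (off := off) (stride := stride)
    (fun i j => if h : i < R ∧ j < C then M ⟨i, h.1⟩ ⟨j, h.2⟩ else 0)
    hR0 hC0 hCs hR hC hoff hstr ?_).mono le_rfl ?_
  · intro i hi j hj σ' h h1 h2
    rw [dif_pos ⟨hi, hj⟩]
    exact hval ⟨i, hi⟩ ⟨j, hj⟩ σ' h h1 h2
  · rintro σ' ⟨h1, h2, h3⟩
    refine ⟨h1, fun i j => ?_, fun k hk => h3 k fun i hi j hj => hk ⟨i, hi⟩ ⟨j, hj⟩⟩
    rw [h2 i i.2 j j.2, dif_pos ⟨i.2, j.2⟩]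

/-- Multiply the matrices with the entries `eA` and `eB`, of order `hE`. -/
def mulTo (mm : Program) (hE : NatExp) (eA eB : RealExp) : Program :=
  .seq (fill hE hE 100 (.lit 0) hE eA)
    (.seq (fill hE hE 101 (.lit 0) hE eB) (.seq (.setNat 100 (.lit 0) hE) mm))

theorem mulTo_runs {mm : Program} {W : ℕ → ℝ} (hm : MulProg mm W) {h : ℕ} (h0 : 0 < h)
    {hE : NatExp} {eA eB : RealExp} (A B : SqMat h)
    (hh : ∀ σ', LowNat σ σ' → hE.eval σ' = h)
    (hA : ∀ (i j : Fin h), ∀ σ', Low σ σ' → σ'.nat 20 0 = i → σ'.nat 21 0 = j →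
      eA.eval σ' = A i j)
    (hB : ∀ (i j : Fin h), ∀ σ', Low σ σ' → σ'.nat 20 0 = i → σ'.nat 21 0 = j →
      eB.eval σ' = B i j) :
    Runs 𝒪 (mulTo mm hE eA eB) σ (20 * W h) 0 fun σ' => Low σ σ' ∧ IsMat σ' 102 0 h (A * B) := by
  have hsq := hm.sq_le h h0
  have h1 : (1 : ℝ) ≤ h := by exact_mod_cast h0
  refine (Runs.seq (K₁ := 0) (K₂ := 0) (N₁ := 9 * (h * h)) (N₂ := 9 * (h * h) + (1 + W h))
    (fill_mat_runs (off := 0) (stride := h) A h0 h0 le_rfl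
    (fun σ' h' => hh σ' h'.lowNat) (fun σ' h' => hh σ' h'.lowNat) (fun _ _ => rfl)
    (fun σ' h' => hh σ' h'.lowNat) fun i j σ' h' => hA i j σ' (h'.low le_rfl))
    fun σ₁ ⟨hσ₁, hM₁, _⟩ => ?_).le (by nlinarith)
  have l₁ : Low σ σ₁ := hσ₁.low le_rfl
  refine Runs.seq (K₁ := 0) (K₂ := 0)
    (fill_mat_runs (off := 0) (stride := h) B h0 h0 le_rfl
    (fun σ' h' => hh σ' (l₁.1.trans h'.lowNat)) (fun σ' h' => hh σ' (l₁.1.trans h'.lowNat))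
    (fun _ _ => rfl) (fun σ' h' => hh σ' (l₁.1.trans h'.lowNat))
    fun i j σ' h' => hB i j σ' (l₁.trans (h'.low (by norm_num))))
    fun σ₂ ⟨hσ₂, hM₂, _⟩ => ?_
  have l₂ : Low σ σ₂ := l₁.trans (hσ₂.low (by norm_num))
  refine Runs.seq (K₁ := 0) (K₂ := 0)
    (Runs.setNat (Q := fun τ => τ = σ₂.writeNat 100 0 h)
      (by simp [NatExp.eval, hh σ₂ l₂.1])) ?_
  rintro _ rfl
  refine (hm.runs 𝒪 _ h h0 (by simp [Store.writeNat])).frame.mono le_rfl ?_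
  rintro σ₄ ⟨hprod, hn, hr⟩
  refine ⟨l₂.trans ⟨fun a ha _ _ => ?_, fun a ha => hr a (hm.real a ha)⟩, fun i j => ?_⟩
  · rw [hn a (hm.nat a ha)]
    exact Function.update_of_ne (by omega) _ _
  · have e1 : (σ₂.writeNat 100 0 h).matrix h 100 0 = A :=
      IsMat.matrix_eq (hM₁.congr (hσ₂.real 100 (by norm_num)))
    have e2 : (σ₂.writeNat 100 0 h).matrix h 101 0 = B := IsMat.matrix_eq hM₂
    rw [e1, e2] at hprod
    rw [← hprod]
    rfl

/-! ### The inversion program -/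

/-- Several rounds of a loop lead from `σ` to `σ'` in at most `N` steps. -/
def Rounds (𝒪 : Oracle) (b : Test) (c : Program) (σ σ' : Store) (N : ℝ) : Prop :=
  ∀ N' K Q, Runs 𝒪 (.loop b c) σ' N' K Q → Runs 𝒪 (.loop b c) σ (N + N') K Q

theorem Rounds.trans {b : Test} {c : Program} {σ₁ σ₂ σ₃ : Store} {N₁ N₂ : ℝ}
    (h : Rounds 𝒪 b c σ₁ σ₂ N₁) (h' : Rounds 𝒪 b c σ₂ σ₃ N₂) :
    Rounds 𝒪 b c σ₁ σ₃ (N₁ + N₂) := fun N' K Q hr => by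
  rw [add_assoc]; exact h _ _ _ (h' _ _ _ hr)

theorem Rounds.le {b : Test} {c : Program} {σ₁ σ₂ : Store} {N₁ N₂ : ℝ}
    (h : Rounds 𝒪 b c σ₁ σ₂ N₁) (hN : N₁ ≤ N₂) : Rounds 𝒪 b c σ₁ σ₂ N₂ :=
  fun N' K Q hr => (h N' K Q hr).le (by linarith)

theorem Runs.exists_rounds {b : Test} {c : Program} {N : ℝ} {Q : Store → Prop} (hb : b.Holds σ)
    (h : Runs 𝒪 c σ N 0 Q) : ∃ σ', Q σ' ∧ Rounds 𝒪 b c σ σ' (1 + N) := by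
  obtain ⟨σ', s, k, h1, h2, h3, h4⟩ := h
  refine ⟨σ', h4, fun N' K Q' hr => ?_⟩
  have := Runs.loopTrue (K₁ := 0) (K₂ := K) hb
    (⟨σ', s, k, h1, h2, h3, rfl⟩ : Runs 𝒪 c σ N 0 fun τ => τ = σ') (by rintro _ rfl; exact hr)
  rwa [zero_add] at this

/-- The recursion is unrolled into one loop. Of the arrays of natural numbers, `10` holds the
current level, `11` the failure flag, `12` the stage (`0`, `1` or `2`) of each level, `13` the
powers of two, `14` the top level and `15` the length `S` of a segment. Input, inverse and the saved
matrices `P`, `T`, `U` of level `k` start at cell `k S` of the real arrays `10`, `11`, `12`, `13`,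
`14`; the real arrays `16` and `17` are scratch space. -/
def lvE : NatExp := .get 10 (.lit 0)
def lv₁E : NatExp := .sub lvE (.lit 1)
def halfE : NatExp := .get 13 lv₁E
def fullE : NatExp := .get 13 lvE
def offE : NatExp := .mul lvE (.get 15 (.lit 0))
def off₁E : NatExp := .mul lv₁E (.get 15 (.lit 0))

/-- A matrix of order one. -/
def invLeaf : Program :=
  .seq (.ite (.realLt (.ofNat (.lit 0)) (.get 10 (.lit 0))) .skip (.setNat 11 (.lit 0) (.lit 1)))
    (.seq (.setReal 11 (.lit 0) (.div (.ofNat (.lit 1)) (.get 10 (.lit 0))))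
      (.setNat 10 (.lit 0) (.lit 1)))

/-- Descend to the first diagonal block. -/
def invFirst : Program :=
  .seq (fill halfE halfE 16 (.lit 0) halfE (rd 10 offE fullE))
    (.seq (fill halfE halfE 10 off₁E halfE (rd 16 (.lit 0) halfE))
      (.seq (.setNat 12 lvE (.lit 1)) (.seq (.setNat 12 lv₁E (.lit 0))
        (.setNat 10 (.lit 0) lv₁E))))

/-- Descend to the Schur complement. -/
def invSecond (mm : Program) : Program :=
  .seq (fill halfE halfE 12 offE halfE (rd 11 off₁E halfE))
    (.seq (mulTo mm halfE (rd 12 offE halfE) (rd 10 (.add offE halfE) fullE))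
      (.seq (fill halfE halfE 13 offE halfE (rd 102 (.lit 0) halfE))
        (.seq (mulTo mm halfE (rd 10 (.add offE (.mul halfE fullE)) fullE) (rd 12 offE halfE))
          (.seq (fill halfE halfE 14 offE halfE (rd 102 (.lit 0) halfE))
            (.seq (mulTo mm halfE (rd 10 (.add offE (.mul halfE fullE)) fullE)
                (rd 13 offE halfE))
              (.seq (fill halfE halfE 16 (.lit 0) halfE
                  (.sub (rd 10 (.add (.add offE (.mul halfE fullE)) halfE) fullE)
                    (rd 102 (.lit 0) halfE)))
                (.seq (fill halfE halfE 10 off₁E halfE (rd 16 (.lit 0) halfE))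
                  (.seq (.setNat 12 lvE (.lit 2)) (.seq (.setNat 12 lv₁E (.lit 0))
                    (.setNat 10 (.lit 0) lv₁E))))))))))

/-- Assemble the inverse. -/
def invThird (mm : Program) : Program :=
  .seq (fill halfE halfE 17 (.lit 0) halfE (rd 11 off₁E halfE))
    (.seq (mulTo mm halfE (rd 13 offE halfE) (rd 17 (.lit 0) halfE))
      (.seq (fill halfE halfE 16 (.lit 0) halfE (rd 102 (.lit 0) halfE))
        (.seq (mulTo mm halfE (rd 16 (.lit 0) halfE) (rd 14 offE halfE))
          (.seq (fill halfE halfE 11 offE fullE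
              (.add (rd 12 offE halfE) (rd 102 (.lit 0) halfE)))
            (.seq (fill halfE halfE 11 (.add offE halfE) fullE
                (.sub (.ofNat (.lit 0)) (rd 16 (.lit 0) halfE)))
              (.seq (mulTo mm halfE (rd 17 (.lit 0) halfE) (rd 14 offE halfE))
                (.seq (fill halfE halfE 11 (.add offE (.mul halfE fullE)) fullE
                    (.sub (.ofNat (.lit 0)) (rd 102 (.lit 0) halfE)))
                  (.seq (fill halfE halfE 11 (.add (.add offE (.mul halfE fullE)) halfE) fullE
                      (rd 17 (.lit 0) halfE))
                    (.setNat 10 (.lit 0) (.add lvE (.lit 1)))))))))))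

def invBody (mm : Program) : Program :=
  .ite (.natLt lvE (.lit 1)) invLeaf
    (.ite (.natLt (.get 12 lvE) (.lit 1)) invFirst
      (.ite (.natLt (.get 12 lvE) (.lit 2)) (invSecond mm) (invThird mm)))

def invTest : Test := .natLt lvE (.add (.get 14 (.lit 0)) (.lit 1))

/-- The values of the scalars that control the recursion, at level `k`. -/
structure InvEnv (K S k : ℕ) (σ : Store) : Prop where
  lev : σ.nat 10 0 = k
  le : k ≤ K
  top : σ.nat 14 0 = K
  seg : σ.nat 15 0 = S
  pow : ∀ l ≤ K, σ.nat 13 l = dbl l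
  sq_le : dbl K * dbl K ≤ S

theorem InvEnv.dbl_sq_le {K S k : ℕ} (h : InvEnv K S k σ) {l : ℕ} (hl : l ≤ K) :
    dbl l * dbl l ≤ S :=
  (Nat.mul_le_mul (dbl_mono hl) (dbl_mono hl)).trans h.sq_le

theorem InvEnv.test {K S k : ℕ} (h : InvEnv K S k σ) : invTest.Holds σ := by
  have := h.le
  simp [invTest, Test.Holds, NatExp.eval, lvE, h.lev, h.top]
  omega

theorem eval_lvE {K S k : ℕ} (hσ : InvEnv K S (k + 1) σ) {σ' : Store} (hl : LowNat σ σ') :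
    lvE.eval σ' = k + 1 := by
  rw [lvE, NatExp.eval, hl 10 (by norm_num) (by norm_num) (by norm_num)]
  exact hσ.lev

theorem eval_lv₁E {K S k : ℕ} (hσ : InvEnv K S (k + 1) σ) {σ' : Store} (hl : LowNat σ σ') :
    lv₁E.eval σ' = k := by
  rw [lv₁E, NatExp.eval, eval_lvE hσ hl]; rfl

theorem eval_halfE {K S k : ℕ} (hσ : InvEnv K S (k + 1) σ) {σ' : Store} (hl : LowNat σ σ') :
    halfE.eval σ' = dbl k := by
  rw [halfE, NatExp.eval, eval_lv₁E hσ hl, hl 13 (by norm_num) (by norm_num) (by norm_num)]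
  exact hσ.pow k (by have := hσ.le; omega)

theorem eval_fullE {K S k : ℕ} (hσ : InvEnv K S (k + 1) σ) {σ' : Store} (hl : LowNat σ σ') :
    fullE.eval σ' = dbl k + dbl k := by
  rw [fullE, NatExp.eval, eval_lvE hσ hl, hl 13 (by norm_num) (by norm_num) (by norm_num)]
  exact hσ.pow (k + 1) hσ.le

theorem eval_offE {K S k : ℕ} (hσ : InvEnv K S (k + 1) σ) {σ' : Store} (hl : LowNat σ σ') :
    offE.eval σ' = (k + 1) * S := by
  rw [offE, NatExp.eval, NatExp.eval, eval_lvE hσ hl,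
    hl 15 (by norm_num) (by norm_num) (by norm_num)]
  simp [NatExp.eval, hσ.seg]

theorem eval_off₁E {K S k : ℕ} (hσ : InvEnv K S (k + 1) σ) {σ' : Store} (hl : LowNat σ σ') :
    off₁E.eval σ' = k * S := by
  rw [off₁E, NatExp.eval, NatExp.eval, eval_lv₁E hσ hl,
    hl 15 (by norm_num) (by norm_num) (by norm_num)]
  simp [NatExp.eval, hσ.seg]

end RealRAM

/-! ### Descending to the first block and to the Schur complement. -/

namespace RealRAM

variable {𝒪 : Oracle} {σ : Store} {K S k : ℕ}

theorem IsMat.blk₁₁ {a off h : ℕ} {A : SqMat (h + h)} (hA : IsMat σ a off (h + h) A) :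
    IsMat σ a off (h + h) (Matrix.blk₁₁ A) := fun i j => by
  simpa [Matrix.blk₁₁] using hA (Fin.castAdd h i) (Fin.castAdd h j)

theorem IsMat.blk₁₂ {a off h : ℕ} {A : SqMat (h + h)} (hA : IsMat σ a off (h + h) A) :
    IsMat σ a (off + h) (h + h) (Matrix.blk₁₂ A) := fun i j => by
  have := hA (Fin.castAdd h i) (Fin.natAdd h j)
  simp only [Fin.val_castAdd, Fin.val_natAdd] at this
  simp only [Matrix.blk₁₂, Matrix.submatrix_apply]
  rw [← this]
  congr 1; ring

theorem IsMat.blk₂₁ {a off h : ℕ} {A : SqMat (h + h)} (hA : IsMat σ a off (h + h) A) :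
    IsMat σ a (off + h * (h + h)) (h + h) (Matrix.blk₂₁ A) := fun i j => by
  have := hA (Fin.natAdd h i) (Fin.castAdd h j)
  simp only [Fin.val_castAdd, Fin.val_natAdd] at this
  simp only [Matrix.blk₂₁, Matrix.submatrix_apply]
  rw [← this]
  congr 1; ring

theorem IsMat.blk₂₂ {a off h : ℕ} {A : SqMat (h + h)} (hA : IsMat σ a off (h + h) A) :
    IsMat σ a (off + h * (h + h) + h) (h + h) (Matrix.blk₂₂ A) := fun i j => by
  have := hA (Fin.natAdd h i) (Fin.natAdd h j)
  simp only [Fin.val_natAdd] at this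
  simp only [Matrix.blk₂₂, Matrix.submatrix_apply]
  rw [← this]
  congr 1; ring

/-- A matrix of level `l` ends inside its segment, so writing it leaves the data of all higher
levels intact. -/
theorem lt_next_segment {h l i j : ℕ} (hS : h * h ≤ S) (hi : i < h) (hj : j < h) :
    l * S + i * h + j < (l + 1) * S := by
  have : i * h + h ≤ h * h := by nlinarith
  rw [add_mul, one_mul]
  omega

/-- Entering the next lower level. -/
theorem descend_runs (hσ : InvEnv K S (k + 1) σ) {τ : Store} (hl : LowNat σ τ) (v : ℕ) :
    Runs 𝒪 (.seq (.setNat 12 lvE (.lit v)) (.seq (.setNat 12 lv₁E (.lit 0))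
        (.setNat 10 (.lit 0) lv₁E))) τ 3 0 fun σ' =>
      InvEnv K S k σ' ∧ σ'.nat 12 k = 0 ∧ σ'.nat 12 (k + 1) = v ∧
      (∀ j, k + 1 < j → σ'.nat 12 j = σ.nat 12 j) ∧
      (∀ a, a < 100 → a ≠ 10 → a ≠ 12 → a ≠ 20 → a ≠ 21 → σ'.nat a = σ.nat a) ∧
      σ'.real = τ.real := by
  have hlv := eval_lvE hσ hl
  have h12 := hl 12 (by norm_num) (by norm_num) (by norm_num)
  refine (Runs.seq (K₁ := 0) (K₂ := 0) (N₁ := 1) (N₂ := 2)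
    (Runs.setNat (Q := fun τ₁ => τ₁ = τ.writeNat 12 (k + 1) v)
    (by rw [hlv]; rfl)) ?_).le (by norm_num)
  rintro _ rfl
  have hlv₁ : ∀ c w, lv₁E.eval (τ.writeNat 12 c w) = k := fun c w => by
    have : lvE.eval (τ.writeNat 12 c w) = lvE.eval τ := by
      simp [lvE, NatExp.eval, Store.writeNat]
    rw [lv₁E, NatExp.eval, this, hlv]; rfl
  refine (Runs.seq (K₁ := 0) (K₂ := 0) (N₁ := 1) (N₂ := 1)
    (Runs.setNat (Q := fun τ₁ => τ₁ = (τ.writeNat 12 (k + 1) v).writeNat 12 k 0)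
    (by rw [hlv₁]; rfl)) ?_).le (by norm_num)
  rintro _ rfl
  refine Runs.setNat ?_
  have hlv₂ : lv₁E.eval ((τ.writeNat 12 (k + 1) v).writeNat 12 k 0) = k := by
    have : lvE.eval ((τ.writeNat 12 (k + 1) v).writeNat 12 k 0) = lvE.eval τ := by
      simp [lvE, NatExp.eval, Store.writeNat]
    rw [lv₁E, NatExp.eval, this, hlv]; rfl
  rw [hlv₂]
  have hsame : ∀ a, a < 100 → a ≠ 10 → a ≠ 12 → a ≠ 20 → a ≠ 21 →
      (((τ.writeNat 12 (k + 1) v).writeNat 12 k 0).writeNat 10 0 k).nat a = σ.nat a :=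
    fun a h1 h2 h3 h4 h5 => by
      rw [← hl a h1 h4 h5]
      simp [Store.writeNat, h2, h3]
  refine ⟨⟨by simp [Store.writeNat, NatExp.eval], by have := hσ.le; omega, ?_, ?_, ?_, hσ.sq_le⟩,
    by simp [Store.writeNat, NatExp.eval], by simp [Store.writeNat, NatExp.eval],
    fun j hj => ?_, hsame, rfl⟩
  · exact (congrFun (hsame 14 (by norm_num) (by norm_num) (by norm_num) (by norm_num)
      (by norm_num)) 0).trans hσ.top
  · exact (congrFun (hsame 15 (by norm_num) (by norm_num) (by norm_num) (by norm_num)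
      (by norm_num)) 0).trans hσ.seg
  · intro l hlK
    exact (congrFun (hsame 13 (by norm_num) (by norm_num) (by norm_num) (by norm_num)
      (by norm_num)) l).trans (hσ.pow l hlK)
  · have h1 : j ≠ k := by omega
    have h2 : j ≠ k + 1 := by omega
    simp [Store.writeNat, h1, h2, h12]

theorem invFirst_runs (hσ : InvEnv K S (k + 1) σ) {A : SqMat (dbl k + dbl k)}
    (hA : IsMat σ 10 ((k + 1) * S) (dbl k + dbl k) A) :
    Runs 𝒪 invFirst σ (21 * (dbl k * dbl k)) 0 fun σ' =>
      (InvEnv K S k σ' ∧ σ'.nat 12 k = 0 ∧ σ'.nat 12 (k + 1) = 1 ∧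
      (∀ j, k + 1 < j → σ'.nat 12 j = σ.nat 12 j) ∧
      (∀ a, a < 100 → a ≠ 10 → a ≠ 12 → a ≠ 20 → a ≠ 21 → σ'.nat a = σ.nat a)) ∧
      IsMat σ' 10 (k * S) (dbl k) (Matrix.blk₁₁ A) ∧
      (∀ c, (k + 1) * S ≤ c → σ'.real 10 c = σ.real 10 c) ∧
      ∀ a, a ≠ 10 → a ≠ 16 → σ'.real a = σ.real a := by
  have hh := dbl_pos k
  have hS := hσ.dbl_sq_le (l := k) (by have := hσ.le; omega)
  have h1 : (1 : ℝ) ≤ dbl k := by exact_mod_cast hh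
  refine (Runs.seq (K₁ := 0) (K₂ := 0) (fill_mat_runs (off := 0) (stride := dbl k)
    (Matrix.blk₁₁ A) hh hh le_rfl
    (fun σ' h => eval_halfE hσ h.lowNat) (fun σ' h => eval_halfE hσ h.lowNat) (fun _ _ => rfl)
    (fun σ' h => eval_halfE hσ h.lowNat) fun i j σ' h hi hj => ?_)
    (N₂ := 9 * (dbl k * dbl k) + 3) ?_).le (by nlinarith)
  · rw [rd_eval hi hj, eval_offE hσ h.lowNat, eval_fullE hσ h.lowNat, h.real 10 (by norm_num)]
    exact hA.blk₁₁ i j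
  rintro σ₁ ⟨a₁, m₁, -⟩
  refine Runs.seq (K₁ := 0) (K₂ := 0) (fill_mat_runs (off := k * S) (stride := dbl k)
    (Matrix.blk₁₁ A) hh hh le_rfl
    (fun σ' h => eval_halfE hσ (a₁.lowNat.trans h.lowNat))
    (fun σ' h => eval_halfE hσ (a₁.lowNat.trans h.lowNat))
    (fun σ' h => eval_off₁E hσ (a₁.lowNat.trans h.lowNat))
    (fun σ' h => eval_halfE hσ (a₁.lowNat.trans h.lowNat)) fun i j σ' h hi hj => ?_) ?_
  · rw [rd_eval hi hj, eval_halfE hσ (a₁.lowNat.trans h.lowNat), h.real 16 (by norm_num)]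
    exact m₁ i j
  rintro σ₂ ⟨a₂, m₂, u₂⟩
  refine (descend_runs hσ (a₁.lowNat.trans a₂.lowNat) 1).mono le_rfl ?_
  rintro σ' ⟨g1, g2, g3, g4, g5, g6⟩
  refine ⟨⟨g1, g2, g3, g4, g5⟩, m₂.congr (by rw [g6]), fun c hc => ?_, fun a h1 h2 => ?_⟩
  · rw [g6, u₂ c fun i j => ?_, a₁.real 10 (by norm_num)]
    exact ((lt_next_segment hS i.2 j.2).trans_le hc).ne
  · rw [g6, a₂.real a h1, a₁.real a h2]

/-- `P` is whatever the level below left behind and is not assumed to be an inverse: after a failed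
definiteness test the program goes on with meaningless numbers, and its cost and its effect on
memory must still be known. -/
theorem invSecond_runs {mm : Program} {W : ℕ → ℝ} (hm : MulProg mm W)
    (hσ : InvEnv K S (k + 1) σ) {A : SqMat (dbl k + dbl k)} {P : SqMat (dbl k)}
    (hA : IsMat σ 10 ((k + 1) * S) (dbl k + dbl k) A) (hP : IsMat σ 11 (k * S) (dbl k) P) :
    Runs 𝒪 (invSecond mm) σ (108 * W (dbl k)) 0 fun σ' =>
      (InvEnv K S k σ' ∧ σ'.nat 12 k = 0 ∧ σ'.nat 12 (k + 1) = 2 ∧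
      (∀ j, k + 1 < j → σ'.nat 12 j = σ.nat 12 j) ∧
      (∀ a, a < 100 → a ≠ 10 → a ≠ 12 → a ≠ 20 → a ≠ 21 → σ'.nat a = σ.nat a)) ∧
      IsMat σ' 10 (k * S) (dbl k)
        (Matrix.blk₂₂ A - Matrix.blk₂₁ A * (P * Matrix.blk₁₂ A)) ∧
      IsMat σ' 12 ((k + 1) * S) (dbl k) P ∧
      IsMat σ' 13 ((k + 1) * S) (dbl k) (P * Matrix.blk₁₂ A) ∧
      IsMat σ' 14 ((k + 1) * S) (dbl k) (Matrix.blk₂₁ A * P) ∧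
      (∀ c, (k + 1) * S ≤ c → σ'.real 10 c = σ.real 10 c) ∧
      (∀ a c, a = 12 ∨ a = 13 ∨ a = 14 → (k + 1 + 1) * S ≤ c → σ'.real a c = σ.real a c) ∧
      ∀ a, a < 100 → a ≠ 10 → a ≠ 12 → a ≠ 13 → a ≠ 14 → a ≠ 16 →
        σ'.real a = σ.real a := by
  have hh := dbl_pos k
  have hS := hσ.dbl_sq_le (l := k) (by have := hσ.le; omega)
  have h1 : (1 : ℝ) ≤ dbl k := by exact_mod_cast hh
  have hsq := hm.sq_le (dbl k) hh
  refine (Runs.seq (K₁ := 0) (K₂ := 0) (fill_mat_runs (off := (k + 1) * S) (stride := dbl k)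
    P hh hh le_rfl
    (fun σ' h => eval_halfE hσ h.lowNat) (fun σ' h => eval_halfE hσ h.lowNat)
    (fun σ' h => eval_offE hσ h.lowNat)
    (fun σ' h => eval_halfE hσ h.lowNat) fun i j σ' h hi hj => ?_)
    (N₂ := 20 * W (dbl k) + (9 * (dbl k * dbl k) + (20 * W (dbl k) + (9 * (dbl k * dbl k) +
      (20 * W (dbl k) + (9 * (dbl k * dbl k) + (9 * (dbl k * dbl k) + 3))))))) ?_).le (by nlinarith)
  · rw [rd_eval hi hj, eval_off₁E hσ h.lowNat, eval_halfE hσ h.lowNat, h.real 11 (by norm_num)]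
    exact hP i j
  rintro σ₁ ⟨a₁, m₁, u₁⟩
  have l₁ := a₁.lowNat
  refine Runs.seq (K₁ := 0) (K₂ := 0) (mulTo_runs hm hh P (Matrix.blk₁₂ A)
    (fun σ' h => eval_halfE hσ (l₁.trans h))
    (fun i j σ' h hi hj => ?_) (fun i j σ' h hi hj => ?_)) ?_
  · rw [rd_eval hi hj, eval_offE hσ (l₁.trans h.1), eval_halfE hσ (l₁.trans h.1),
      h.2 12 (by norm_num)]
    exact m₁ i j
  · rw [rd_eval hi hj, NatExp.eval, eval_offE hσ (l₁.trans h.1), eval_halfE hσ (l₁.trans h.1),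
      eval_fullE hσ (l₁.trans h.1), h.2 10 (by norm_num), a₁.real 10 (by norm_num)]
    exact hA.blk₁₂ i j
  rintro σ₂ ⟨a₂, m₂⟩
  have l₂ := l₁.trans a₂.1
  refine Runs.seq (K₁ := 0) (K₂ := 0) (fill_mat_runs (off := (k + 1) * S) (stride := dbl k)
    (P * Matrix.blk₁₂ A) hh hh le_rfl
    (fun σ' h => eval_halfE hσ (l₂.trans h.lowNat)) (fun σ' h => eval_halfE hσ (l₂.trans h.lowNat))
    (fun σ' h => eval_offE hσ (l₂.trans h.lowNat))
    (fun σ' h => eval_halfE hσ (l₂.trans h.lowNat)) fun i j σ' h hi hj => ?_) ?_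
  · rw [rd_eval hi hj, eval_halfE hσ (l₂.trans h.lowNat), h.real 102 (by norm_num)]
    exact m₂ i j
  rintro σ₃ ⟨a₃, m₃, u₃⟩
  have l₃ := l₂.trans a₃.lowNat
  have r₃10 : σ₃.real 10 = σ.real 10 := by
    rw [a₃.real 10 (by norm_num), a₂.2 10 (by norm_num), a₁.real 10 (by norm_num)]
  have r₃12 : σ₃.real 12 = σ₁.real 12 := by
    rw [a₃.real 12 (by norm_num), a₂.2 12 (by norm_num)]
  refine Runs.seq (K₁ := 0) (K₂ := 0) (mulTo_runs hm hh (Matrix.blk₂₁ A) P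
    (fun σ' h => eval_halfE hσ (l₃.trans h))
    (fun i j σ' h hi hj => ?_) (fun i j σ' h hi hj => ?_)) ?_
  · rw [rd_eval hi hj, NatExp.eval, NatExp.eval, eval_offE hσ (l₃.trans h.1),
      eval_halfE hσ (l₃.trans h.1), eval_fullE hσ (l₃.trans h.1), h.2 10 (by norm_num), r₃10]
    exact hA.blk₂₁ i j
  · rw [rd_eval hi hj, eval_offE hσ (l₃.trans h.1), eval_halfE hσ (l₃.trans h.1),
      h.2 12 (by norm_num), r₃12]
    exact m₁ i j
  rintro σ₄ ⟨a₄, m₄⟩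
  have l₄ := l₃.trans a₄.1
  refine Runs.seq (K₁ := 0) (K₂ := 0) (fill_mat_runs (off := (k + 1) * S) (stride := dbl k)
    (Matrix.blk₂₁ A * P) hh hh le_rfl
    (fun σ' h => eval_halfE hσ (l₄.trans h.lowNat)) (fun σ' h => eval_halfE hσ (l₄.trans h.lowNat))
    (fun σ' h => eval_offE hσ (l₄.trans h.lowNat))
    (fun σ' h => eval_halfE hσ (l₄.trans h.lowNat)) fun i j σ' h hi hj => ?_) ?_
  · rw [rd_eval hi hj, eval_halfE hσ (l₄.trans h.lowNat), h.real 102 (by norm_num)]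
    exact m₄ i j
  rintro σ₅ ⟨a₅, m₅, u₅⟩
  have l₅ := l₄.trans a₅.lowNat
  have r₅10 : σ₅.real 10 = σ.real 10 := by
    rw [a₅.real 10 (by norm_num), a₄.2 10 (by norm_num), r₃10]
  have r₅13 : σ₅.real 13 = σ₃.real 13 := by
    rw [a₅.real 13 (by norm_num), a₄.2 13 (by norm_num)]
  refine Runs.seq (K₁ := 0) (K₂ := 0) (mulTo_runs hm hh (Matrix.blk₂₁ A) (P * Matrix.blk₁₂ A)
    (fun σ' h => eval_halfE hσ (l₅.trans h))
    (fun i j σ' h hi hj => ?_) (fun i j σ' h hi hj => ?_)) ?_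
  · rw [rd_eval hi hj, NatExp.eval, NatExp.eval, eval_offE hσ (l₅.trans h.1),
      eval_halfE hσ (l₅.trans h.1), eval_fullE hσ (l₅.trans h.1), h.2 10 (by norm_num), r₅10]
    exact hA.blk₂₁ i j
  · rw [rd_eval hi hj, eval_offE hσ (l₅.trans h.1), eval_halfE hσ (l₅.trans h.1),
      h.2 13 (by norm_num), r₅13]
    exact m₃ i j
  rintro σ₆ ⟨a₆, m₆⟩
  have l₆ := l₅.trans a₆.1
  have r₆10 : σ₆.real 10 = σ.real 10 := by rw [a₆.2 10 (by norm_num), r₅10]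
  refine Runs.seq (K₁ := 0) (K₂ := 0) (fill_mat_runs (off := 0) (stride := dbl k)
    (Matrix.blk₂₂ A - Matrix.blk₂₁ A * (P * Matrix.blk₁₂ A)) hh hh le_rfl
    (fun σ' h => eval_halfE hσ (l₆.trans h.lowNat)) (fun σ' h => eval_halfE hσ (l₆.trans h.lowNat))
    (fun _ _ => rfl)
    (fun σ' h => eval_halfE hσ (l₆.trans h.lowNat)) fun i j σ' h hi hj => ?_) ?_
  · simp only [RealExp.eval, rd_eval hi hj, NatExp.eval,
      eval_offE hσ (l₆.trans h.lowNat), eval_halfE hσ (l₆.trans h.lowNat),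
      eval_fullE hσ (l₆.trans h.lowNat), h.real 10 (by norm_num : 10 ≠ 16),
      h.real 102 (by norm_num : 102 ≠ 16), r₆10, Matrix.sub_apply]
    exact congrArg₂ _ (hA.blk₂₂ i j) (m₆ i j)
  rintro σ₇ ⟨a₇, m₇, -⟩
  have l₇ := l₆.trans a₇.lowNat
  refine Runs.seq (K₁ := 0) (K₂ := 0) (fill_mat_runs (off := k * S) (stride := dbl k)
    (Matrix.blk₂₂ A - Matrix.blk₂₁ A * (P * Matrix.blk₁₂ A)) hh hh le_rfl
    (fun σ' h => eval_halfE hσ (l₇.trans h.lowNat)) (fun σ' h => eval_halfE hσ (l₇.trans h.lowNat))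
    (fun σ' h => eval_off₁E hσ (l₇.trans h.lowNat))
    (fun σ' h => eval_halfE hσ (l₇.trans h.lowNat)) fun i j σ' h hi hj => ?_) ?_
  · rw [rd_eval hi hj, eval_halfE hσ (l₇.trans h.lowNat), h.real 16 (by norm_num)]
    exact m₇ i j
  rintro σ₈ ⟨a₈, m₈, u₈⟩
  have l₈ := l₇.trans a₈.lowNat
  have r12 : σ₈.real 12 = σ₁.real 12 := by
    rw [a₈.real 12 (by norm_num), a₇.real 12 (by norm_num), a₆.2 12 (by norm_num),
      a₅.real 12 (by norm_num), a₄.2 12 (by norm_num), r₃12]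
  have r13 : σ₈.real 13 = σ₃.real 13 := by
    rw [a₈.real 13 (by norm_num), a₇.real 13 (by norm_num), a₆.2 13 (by norm_num), r₅13]
  have r14 : σ₈.real 14 = σ₅.real 14 := by
    rw [a₈.real 14 (by norm_num), a₇.real 14 (by norm_num), a₆.2 14 (by norm_num)]
  refine (descend_runs hσ l₈ 2).mono le_rfl ?_
  rintro σ' ⟨g1, g2, g3, g4, g5, g6⟩
  refine ⟨⟨g1, g2, g3, g4, g5⟩, m₈.congr (by rw [g6]), m₁.congr (by rw [g6, r12]),
    m₃.congr (by rw [g6, r13]), m₅.congr (by rw [g6, r14]), fun c hc => ?_, fun a c ha hc => ?_,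
    fun a h1 h2 h3 h4 h5 h6 => ?_⟩
  · rw [g6, u₈ c fun i j => ((lt_next_segment hS i.2 j.2).trans_le hc).ne,
      a₇.real 10 (by norm_num), r₆10]
  · have hne : ∀ i j : Fin (dbl k), (k + 1) * S + i * dbl k + j ≠ c :=
      fun i j => ((lt_next_segment hS i.2 j.2).trans_le hc).ne
    rcases ha with rfl | rfl | rfl
    · rw [g6, r12, u₁ c hne]
    · rw [g6, r13, u₃ c hne, a₂.2 13 (by norm_num), a₁.real 13 (by norm_num)]
    · rw [g6, r14, u₅ c hne, a₄.2 14 (by norm_num), a₃.real 14 (by norm_num),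
        a₂.2 14 (by norm_num), a₁.real 14 (by norm_num)]
  · rw [g6, a₈.real a h2, a₇.real a h6, a₆.2 a h1, a₅.real a h5, a₄.2 a h1, a₃.real a h4,
      a₂.2 a h1, a₁.real a h3]

end RealRAM

/-! ### Assembling the inverse, and correctness of the recursion. -/

namespace RealRAM

variable {𝒪 : Oracle} {σ : Store} {K S k : ℕ}

theorem cell_ne {N off i j i' j' : ℕ} (hj : j < N) (hj' : j' < N) (h : i ≠ i' ∨ j ≠ j') :
    off + i * N + j ≠ off + i' * N + j' := by
  intro he
  have h1 : N * i + j = N * i' + j' := by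
    rw [mul_comm N i, mul_comm N i']; omega
  have hN : 0 < N := by omega
  have h2 := congrArg (· / N) h1
  have h3 := congrArg (· % N) h1
  simp only [Nat.mul_add_div hN, Nat.mul_add_mod, Nat.div_eq_of_lt hj, Nat.div_eq_of_lt hj',
    Nat.mod_eq_of_lt hj, Nat.mod_eq_of_lt hj'] at h2 h3
  omega

theorem IsMat.unique {R C a off stride : ℕ} {A B : Matrix (Fin R) (Fin C) ℝ}
    (hA : IsMat σ a off stride A) (hB : IsMat σ a off stride B) : A = B := by
  ext i j
  rw [← hA i j, ← hB i j]

theorem IsMat.congr_cells {R C a off stride : ℕ} {σ' : Store} {A : Matrix (Fin R) (Fin C) ℝ}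
    (hA : IsMat σ a off stride A)
    (h : ∀ (i : Fin R) (j : Fin C), σ'.real a (off + i * stride + j) =
      σ.real a (off + i * stride + j)) : IsMat σ' a off stride A :=
  fun i j => (h i j).trans (hA i j)

theorem invThird_runs {mm : Program} {W : ℕ → ℝ} (hm : MulProg mm W)
    (hσ : InvEnv K S (k + 1) σ) {P T U R : SqMat (dbl k)}
    (hP : IsMat σ 12 ((k + 1) * S) (dbl k) P) (hT : IsMat σ 13 ((k + 1) * S) (dbl k) T)
    (hU : IsMat σ 14 ((k + 1) * S) (dbl k) U) (hR : IsMat σ 11 (k * S) (dbl k) R) :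
    Runs 𝒪 (invThird mm) σ (120 * W (dbl k)) 0 fun σ' =>
      (∃ B : SqMat (dbl k + dbl k), IsMat σ' 11 ((k + 1) * S) (dbl k + dbl k) B ∧
        Matrix.blk₁₁ B = P + T * R * U ∧ Matrix.blk₁₂ B = -(T * R) ∧
        Matrix.blk₂₁ B = -(R * U) ∧ Matrix.blk₂₂ B = R) ∧
      σ'.nat 10 0 = k + 2 ∧
      (∀ a, a < 100 → a ≠ 10 → a ≠ 20 → a ≠ 21 → σ'.nat a = σ.nat a) ∧
      ∀ a, a < 100 → a ≠ 11 → a ≠ 16 → a ≠ 17 → σ'.real a = σ.real a := by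
  have hh := dbl_pos k
  have h1 : (1 : ℝ) ≤ dbl k := by exact_mod_cast hh
  have hsq := hm.sq_le (dbl k) hh
  refine (Runs.seq (K₁ := 0) (K₂ := 0) (fill_mat_runs (off := 0) (stride := dbl k)
    R hh hh le_rfl
    (fun σ' h => eval_halfE hσ h.lowNat) (fun σ' h => eval_halfE hσ h.lowNat)
    (fun _ _ => rfl)
    (fun σ' h => eval_halfE hσ h.lowNat) fun i j σ' h hi hj => ?_)
    (N₂ := 20 * W (dbl k) + (9 * (dbl k * dbl k) + (20 * W (dbl k) + (9 * (dbl k * dbl k) +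
      (9 * (dbl k * dbl k) + (20 * W (dbl k) + (9 * (dbl k * dbl k) +
      (9 * (dbl k * dbl k) + 1)))))))) ?_).le (by nlinarith)
  · rw [rd_eval hi hj, eval_off₁E hσ h.lowNat, eval_halfE hσ h.lowNat, h.real 11 (by norm_num)]
    exact hR i j
  rintro σ₁ ⟨a₁, m₁, -⟩
  have l₁ := a₁.lowNat
  refine Runs.seq (K₁ := 0) (K₂ := 0) (mulTo_runs hm hh T R
    (fun σ' h => eval_halfE hσ (l₁.trans h))
    (fun i j σ' h hi hj => ?_) (fun i j σ' h hi hj => ?_)) ?_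
  · rw [rd_eval hi hj, eval_offE hσ (l₁.trans h.1), eval_halfE hσ (l₁.trans h.1),
      h.2 13 (by norm_num), a₁.real 13 (by norm_num)]
    exact hT i j
  · rw [rd_eval hi hj, eval_halfE hσ (l₁.trans h.1), h.2 17 (by norm_num)]
    exact m₁ i j
  rintro σ₂ ⟨a₂, m₂⟩
  have l₂ := l₁.trans a₂.1
  refine Runs.seq (K₁ := 0) (K₂ := 0) (fill_mat_runs (off := 0) (stride := dbl k)
    (T * R) hh hh le_rfl
    (fun σ' h => eval_halfE hσ (l₂.trans h.lowNat)) (fun σ' h => eval_halfE hσ (l₂.trans h.lowNat))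
    (fun _ _ => rfl)
    (fun σ' h => eval_halfE hσ (l₂.trans h.lowNat)) fun i j σ' h hi hj => ?_) ?_
  · rw [rd_eval hi hj, eval_halfE hσ (l₂.trans h.lowNat), h.real 102 (by norm_num)]
    exact m₂ i j
  rintro σ₃ ⟨a₃, m₃, -⟩
  have l₃ := l₂.trans a₃.lowNat
  have r₃ : ∀ a, a < 100 → a ≠ 16 → a ≠ 17 → σ₃.real a = σ.real a := fun a h1 h2 h3 => by
    rw [a₃.real a h2, a₂.2 a h1, a₁.real a h3]
  have r₃17 : σ₃.real 17 = σ₁.real 17 := by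
    rw [a₃.real 17 (by norm_num), a₂.2 17 (by norm_num)]
  refine Runs.seq (K₁ := 0) (K₂ := 0) (mulTo_runs hm hh (T * R) U
    (fun σ' h => eval_halfE hσ (l₃.trans h))
    (fun i j σ' h hi hj => ?_) (fun i j σ' h hi hj => ?_)) ?_
  · rw [rd_eval hi hj, eval_halfE hσ (l₃.trans h.1), h.2 16 (by norm_num)]
    exact m₃ i j
  · rw [rd_eval hi hj, eval_offE hσ (l₃.trans h.1), eval_halfE hσ (l₃.trans h.1),
      h.2 14 (by norm_num), r₃ 14 (by norm_num) (by norm_num) (by norm_num)]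
    exact hU i j
  rintro σ₄ ⟨a₄, m₄⟩
  have l₄ := l₃.trans a₄.1
  refine Runs.seq (K₁ := 0) (K₂ := 0) (fill_mat_runs (off := (k + 1) * S)
    (stride := dbl k + dbl k) (P + T * R * U) hh hh (by omega)
    (fun σ' h => eval_halfE hσ (l₄.trans h.lowNat)) (fun σ' h => eval_halfE hσ (l₄.trans h.lowNat))
    (fun σ' h => eval_offE hσ (l₄.trans h.lowNat))
    (fun σ' h => eval_fullE hσ (l₄.trans h.lowNat)) fun i j σ' h hi hj => ?_) ?_
  · simp only [RealExp.eval, rd_eval hi hj, NatExp.eval, eval_offE hσ (l₄.trans h.lowNat),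
      eval_halfE hσ (l₄.trans h.lowNat), h.real 12 (by norm_num : 12 ≠ 11),
      h.real 102 (by norm_num : 102 ≠ 11), a₄.2 12 (by norm_num),
      r₃ 12 (by norm_num) (by norm_num) (by norm_num), Matrix.add_apply]
    exact congrArg₂ _ (hP i j) (m₄ i j)
  rintro σ₅ ⟨a₅, m₅, -⟩
  have l₅ := l₄.trans a₅.lowNat
  refine Runs.seq (K₁ := 0) (K₂ := 0) (fill_mat_runs (off := (k + 1) * S + dbl k)
    (stride := dbl k + dbl k) (-(T * R)) hh hh (by omega)
    (fun σ' h => eval_halfE hσ (l₅.trans h.lowNat)) (fun σ' h => eval_halfE hσ (l₅.trans h.lowNat))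
    (fun σ' h => by
      rw [NatExp.eval, eval_offE hσ (l₅.trans h.lowNat), eval_halfE hσ (l₅.trans h.lowNat)])
    (fun σ' h => eval_fullE hσ (l₅.trans h.lowNat)) fun i j σ' h hi hj => ?_) ?_
  · simp only [RealExp.eval, rd_eval hi hj, NatExp.eval,
      eval_halfE hσ (l₅.trans h.lowNat), h.real 16 (by norm_num : 16 ≠ 11),
      a₅.real 16 (by norm_num : 16 ≠ 11), a₄.2 16 (by norm_num), Matrix.neg_apply, m₃ i j]
    simp
  rintro σ₆ ⟨a₆, m₆, u₆⟩
  have l₆ := l₅.trans a₆.lowNat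
  refine Runs.seq (K₁ := 0) (K₂ := 0) (mulTo_runs hm hh R U
    (fun σ' h => eval_halfE hσ (l₆.trans h))
    (fun i j σ' h hi hj => ?_) (fun i j σ' h hi hj => ?_)) ?_
  · rw [rd_eval hi hj, eval_halfE hσ (l₆.trans h.1), h.2 17 (by norm_num),
      a₆.real 17 (by norm_num), a₅.real 17 (by norm_num), a₄.2 17 (by norm_num), r₃17]
    exact m₁ i j
  · rw [rd_eval hi hj, eval_offE hσ (l₆.trans h.1), eval_halfE hσ (l₆.trans h.1),
      h.2 14 (by norm_num), a₆.real 14 (by norm_num), a₅.real 14 (by norm_num),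
      a₄.2 14 (by norm_num), r₃ 14 (by norm_num) (by norm_num) (by norm_num)]
    exact hU i j
  rintro σ₇ ⟨a₇, m₇⟩
  have l₇ := l₆.trans a₇.1
  have r₇17 : σ₇.real 17 = σ₁.real 17 := by
    rw [a₇.2 17 (by norm_num), a₆.real 17 (by norm_num), a₅.real 17 (by norm_num),
      a₄.2 17 (by norm_num), r₃17]
  refine Runs.seq (K₁ := 0) (K₂ := 0) (fill_mat_runs
    (off := (k + 1) * S + dbl k * (dbl k + dbl k))
    (stride := dbl k + dbl k) (-(R * U)) hh hh (by omega)
    (fun σ' h => eval_halfE hσ (l₇.trans h.lowNat)) (fun σ' h => eval_halfE hσ (l₇.trans h.lowNat))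
    (fun σ' h => by
      rw [NatExp.eval, NatExp.eval, eval_offE hσ (l₇.trans h.lowNat),
        eval_halfE hσ (l₇.trans h.lowNat), eval_fullE hσ (l₇.trans h.lowNat)])
    (fun σ' h => eval_fullE hσ (l₇.trans h.lowNat)) fun i j σ' h hi hj => ?_) ?_
  · simp only [RealExp.eval, rd_eval hi hj, NatExp.eval,
      eval_halfE hσ (l₇.trans h.lowNat), h.real 102 (by norm_num : 102 ≠ 11),
      Matrix.neg_apply, m₇ i j]
    simp
  rintro σ₈ ⟨a₈, m₈, u₈⟩
  have l₈ := l₇.trans a₈.lowNat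
  refine Runs.seq (K₁ := 0) (K₂ := 0) (fill_mat_runs
    (off := (k + 1) * S + dbl k * (dbl k + dbl k) + dbl k)
    (stride := dbl k + dbl k) R hh hh (by omega)
    (fun σ' h => eval_halfE hσ (l₈.trans h.lowNat)) (fun σ' h => eval_halfE hσ (l₈.trans h.lowNat))
    (fun σ' h => by
      rw [NatExp.eval, NatExp.eval, NatExp.eval, eval_offE hσ (l₈.trans h.lowNat),
        eval_halfE hσ (l₈.trans h.lowNat), eval_fullE hσ (l₈.trans h.lowNat)])
    (fun σ' h => eval_fullE hσ (l₈.trans h.lowNat)) fun i j σ' h hi hj => ?_) ?_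
  · rw [rd_eval hi hj, eval_halfE hσ (l₈.trans h.lowNat), h.real 17 (by norm_num),
      a₈.real 17 (by norm_num), r₇17]
    exact m₁ i j
  rintro σ₉ ⟨a₉, m₉, u₉⟩
  have l₉ := l₈.trans a₉.lowNat
  refine Runs.setNat ?_
  set N := dbl k + dbl k with hN
  have e₂ : ∀ i j : ℕ, (k + 1) * S + dbl k + i * N + j = (k + 1) * S + i * N + (dbl k + j) :=
    fun i j => by ring
  have e₃ : ∀ i j : ℕ, (k + 1) * S + dbl k * N + i * N + j = (k + 1) * S + (dbl k + i) * N + j :=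
    fun i j => by ring
  have e₄ : ∀ i j : ℕ, (k + 1) * S + dbl k * N + dbl k + i * N + j =
      (k + 1) * S + (dbl k + i) * N + (dbl k + j) := fun i j => by ring
  -- In the coordinates of the full matrix two quadrants differ in the range of rows or of columns,
  -- so the later writes do not disturb the earlier ones.
  have n₁ : IsMat σ₉ 11 ((k + 1) * S) N (P + T * R * U) := by
    refine m₅.congr_cells fun i j => ?_
    rw [u₉ _ fun i' j' => ?_, u₈ _ fun i' j' => ?_, a₇.2 11 (by norm_num), u₆ _ fun i' j' => ?_]
    · rw [e₂]; exact cell_ne (by omega) (by omega) (Or.inr (by omega))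
    · rw [e₃]; exact cell_ne (by omega) (by omega) (Or.inl (by omega))
    · rw [e₄]; exact cell_ne (by omega) (by omega) (Or.inl (by omega))
  have n₂ : IsMat σ₉ 11 ((k + 1) * S + dbl k) N (-(T * R)) := by
    refine m₆.congr_cells fun i j => ?_
    rw [u₉ _ fun i' j' => ?_, u₈ _ fun i' j' => ?_, a₇.2 11 (by norm_num)]
    · rw [e₂, e₃]; exact cell_ne (by omega) (by omega) (Or.inl (by omega))
    · rw [e₂, e₄]; exact cell_ne (by omega) (by omega) (Or.inl (by omega))
  have n₃ : IsMat σ₉ 11 ((k + 1) * S + dbl k * N) N (-(R * U)) := by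
    refine m₈.congr_cells fun i j => u₉ _ fun i' j' => ?_
    rw [e₃, e₄]; exact cell_ne (by omega) (by omega) (Or.inr (by omega))
  have hB := isMat_matrix σ₉ N 11 ((k + 1) * S)
  refine ⟨⟨σ₉.matrix N 11 ((k + 1) * S), hB.congr rfl, hB.blk₁₁.unique n₁, hB.blk₁₂.unique n₂,
    hB.blk₂₁.unique n₃, hB.blk₂₂.unique m₉⟩, ?_, fun a h1 h2 h3 h4 => ?_,
    fun a h1 h2 h3 h4 => ?_⟩
  · simp [Store.writeNat, NatExp.eval, eval_lvE hσ l₉]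
  · rw [← l₉ a h1 h3 h4]
    simp [Store.writeNat, h2]
  · change σ₉.real a = _
    rw [a₉.real a h2, a₈.real a h2, a₇.2 a h1, a₆.real a h2, a₅.real a h2, a₄.2 a h1,
      r₃ a h1 h3 h4]

/-- The effect of the inversion of the matrix at level `k`. -/
structure InvPost (S k : ℕ) (σ σ' : Store) : Prop where
  lev : σ'.nat 10 0 = k + 1
  bad : σ.nat 11 0 ≠ 0 → σ'.nat 11 0 ≠ 0
  ok : ∀ A : SqMat (dbl k), IsMat σ 10 (k * S) (dbl k) A → A.IsHermitian → σ.nat 11 0 = 0 →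
    (σ'.nat 11 0 = 0 ↔ A.PosDef) ∧ (A.PosDef → IsMat σ' 11 (k * S) (dbl k) A⁻¹)
  stage : ∀ j, k < j → σ'.nat 12 j = σ.nat 12 j
  nat : ∀ a, a < 100 → a ≠ 10 → a ≠ 11 → a ≠ 12 → a ≠ 20 → a ≠ 21 → σ'.nat a = σ.nat a
  mem : ∀ a c, a = 10 ∨ a = 12 ∨ a = 13 ∨ a = 14 → (k + 1) * S ≤ c → σ'.real a c = σ.real a c
  real : ∀ a, a < 100 → a ≠ 10 → a ≠ 11 → a ≠ 12 → a ≠ 13 → a ≠ 14 → a ≠ 16 → a ≠ 17 →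
    σ'.real a = σ.real a

theorem posDef_one_iff (A : SqMat 1) : A.PosDef ↔ 0 < A 0 0 := by
  have : A = Matrix.diagonal fun _ => A 0 0 := by
    ext i j
    fin_cases i; fin_cases j; simp
  rw [this, Matrix.posDef_diagonal_iff]
  simp

theorem inv_one_apply {A : SqMat 1} (h : A 0 0 ≠ 0) (i j : Fin 1) : A⁻¹ i j = 1 / A 0 0 := by
  have hinv : A⁻¹ = Matrix.of fun _ _ => 1 / A 0 0 := by
    apply Matrix.inv_eq_right_inv
    ext i j
    rw [Subsingleton.elim i 0, Subsingleton.elim j 0, Matrix.one_apply_eq, Matrix.mul_apply,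
      Fin.sum_univ_one, Matrix.of_apply]
    field_simp
  rw [hinv, Matrix.of_apply]

/-- A nonpositive entry raises the flag; the division is carried out all the same (with `1 / 0 =
0`), so that the control flow does not depend on success. -/
theorem invLeaf_runs :
    Runs 𝒪 invLeaf σ 4 0 fun σ' => InvPost S 0 σ σ' := by
  refine (Runs.seq (K₁ := 0) (K₂ := 0) (N₁ := 1 + 1) (N₂ := 1 + 1)
    (Q₁ := fun σ₁ => σ₁.real = σ.real ∧ (∀ a, a ≠ 11 → σ₁.nat a = σ.nat a) ∧
      ((0 < σ.real 10 0 ∧ σ₁.nat 11 0 = σ.nat 11 0) ∨ (¬ 0 < σ.real 10 0 ∧ σ₁.nat 11 0 = 1)))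
    ?_ ?_).le (by norm_num)
  · by_cases hpos : 0 < σ.real 10 0
    · exact Runs.iteTrue (by simpa [Test.Holds, RealExp.eval, NatExp.eval] using hpos)
        (Runs.skip ⟨rfl, fun _ _ => rfl, Or.inl ⟨hpos, rfl⟩⟩)
    · refine Runs.iteFalse (by simpa [Test.Holds, RealExp.eval, NatExp.eval] using hpos)
        (Runs.setNat ⟨rfl, fun a ha => ?_, Or.inr ⟨hpos, ?_⟩⟩)
      · simp [Store.writeNat, ha]
      · simp [Store.writeNat, NatExp.eval]
  rintro σ₁ ⟨hr, hn, hbad⟩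
  refine Runs.seq (K₁ := 0) (K₂ := 0)
    (Runs.setReal (Q := fun τ => τ = σ₁.writeReal 11 0 (1 / σ.real 10 0))
      (by simp [RealExp.eval, NatExp.eval, hr])) ?_
  rintro _ rfl
  refine Runs.setNat ?_
  refine ⟨by simp [Store.writeNat, NatExp.eval], fun h => ?_, fun A hA _ h0 => ?_, fun j _ => ?_,
    fun a h1 h2 h3 h4 h5 h6 => ?_, fun a c ha _ => ?_, fun a h1 h2 h3 h4 h5 h6 h7 h8 => ?_⟩
  · simp only [Store.writeNat, Store.writeReal]
    rcases hbad with hb | hb <;> simp [hb.2, h]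
  · have hA0 : A (0 : Fin 1) (0 : Fin 1) = σ.real 10 0 := by
      simpa using (hA (0 : Fin 1) (0 : Fin 1)).symm
    have hpd : A.PosDef ↔ 0 < σ.real 10 0 := by rw [← hA0]; exact posDef_one_iff A
    rw [hpd]
    refine ⟨?_, fun hpos => fun i j => ?_⟩
    · simp only [Store.writeNat, Store.writeReal]
      rcases hbad with hb | hb <;> simp [hb.1, hb.2, h0]
    · have hinv := inv_one_apply (A := A) (by rw [hA0]; exact hpos.ne') i j
      have hi : (i : ℕ) = 0 := by have := i.2; simp only [dbl] at this; omega
      have hj : (j : ℕ) = 0 := by have := j.2; simp only [dbl] at this; omega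
      refine Eq.trans ?_ hinv.symm
      rw [hA0]
      simp [Store.writeNat, Store.writeReal, hi, hj]
  · simp [Store.writeNat, Store.writeReal, hn 12]
  · simp [Store.writeNat, Store.writeReal, h2, hn a h3]
  · have : a ≠ 11 := by omega
    simp [Store.writeNat, Store.writeReal, this, hr]
  · simp [Store.writeNat, Store.writeReal, h3, hr]

theorem InvEnv.congr {k' : ℕ} {σ' : Store} (h : InvEnv K S k σ) (hlev : σ'.nat 10 0 = k')
    (hk : k' ≤ K) (h13 : σ'.nat 13 = σ.nat 13) (h14 : σ'.nat 14 = σ.nat 14)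
    (h15 : σ'.nat 15 = σ.nat 15) : InvEnv K S k' σ' :=
  ⟨hlev, hk, by rw [h14]; exact h.top, by rw [h15]; exact h.seg, by rw [h13]; exact h.pow, h.sq_le⟩

/-- The recursive inversion: from level `k` the loop arrives at level `k + 1`. -/
theorem exists_invPost {mm : Program} {W : ℕ → ℝ} (hm : MulProg mm W) (k : ℕ) :
    ∀ σ, InvEnv K S k σ → σ.nat 12 k = 0 → ∃ σ', InvPost S k σ σ' ∧
      Rounds 𝒪 invTest (invBody mm) σ σ' (300 * (k + 1) * W (dbl k)) := by
  induction k with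
  | zero =>
    intro σ hσ h0
    have h1 : (1 : ℝ) ≤ W (dbl 0) := by simpa [dbl] using hm.sq_le 1 one_pos
    obtain ⟨σ', h, hr⟩ := Runs.exists_rounds (𝒪 := 𝒪) (c := invBody mm) hσ.test
      (Runs.iteTrue (by simp [Test.Holds, NatExp.eval, lvE, hσ.lev]) (invLeaf_runs (S := S)))
    exact ⟨σ', h, hr.le (by norm_num; linarith)⟩
  | succ k ih =>
    intro σ hσ h0
    have hk := hσ.le
    have hh := dbl_pos k
    have h1 : (1 : ℝ) ≤ dbl k := by exact_mod_cast hh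
    have hsq := hm.sq_le (dbl k) hh
    have hW1 : 1 ≤ W (dbl k) := by nlinarith
    have hlv : ∀ τ, InvEnv K S (k + 1) τ → lvE.eval τ = k + 1 := fun τ h => by
      simp [lvE, NatExp.eval, h.lev]
    set A := σ.matrix (dbl k + dbl k) 10 ((k + 1) * S) with hAdef
    have hA : IsMat σ 10 ((k + 1) * S) (dbl k + dbl k) A := isMat_matrix _ _ _ _
    -- descend to the first block
    obtain ⟨σ₁, ⟨⟨e₁, z₁, st₁, stg₁, n₁⟩, m₁, u₁, r₁⟩, hr₁⟩ :=
      Runs.exists_rounds (𝒪 := 𝒪) (c := invBody mm) hσ.test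
      (Runs.iteFalse (by simp [Test.Holds, hlv σ hσ, NatExp.eval])
        (Runs.iteTrue (by simp [Test.Holds, hlv σ hσ, NatExp.eval, h0]) (invFirst_runs hσ hA)))
    obtain ⟨σ₂, p₂, hr₂⟩ := ih σ₁ e₁ z₁
    have n₂ : ∀ a, a < 100 → a ≠ 10 → a ≠ 11 → a ≠ 12 → a ≠ 20 → a ≠ 21 →
        σ₂.nat a = σ.nat a := fun a h1 h2 h3 h4 h5 h6 => by
      rw [p₂.nat a h1 h2 h3 h4 h5 h6, n₁ a h1 h2 h4 h5 h6]
    have e₂ : InvEnv K S (k + 1) σ₂ := hσ.congr p₂.lev hk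
      (n₂ 13 (by norm_num) (by norm_num) (by norm_num) (by norm_num) (by norm_num) (by norm_num))
      (n₂ 14 (by norm_num) (by norm_num) (by norm_num) (by norm_num) (by norm_num) (by norm_num))
      (n₂ 15 (by norm_num) (by norm_num) (by norm_num) (by norm_num) (by norm_num) (by norm_num))
    have st₂ : σ₂.nat 12 (k + 1) = 1 := by rw [p₂.stage _ (by omega), st₁]
    have mem₂ : ∀ c, (k + 1) * S ≤ c → σ₂.real 10 c = σ.real 10 c := fun c hc => by
      rw [p₂.mem 10 c (by simp) hc, u₁ c hc]
    have hA₂ : IsMat σ₂ 10 ((k + 1) * S) (dbl k + dbl k) A := hA.mono mem₂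
    -- descend to the Schur complement
    obtain ⟨σ₃, ⟨⟨e₃, z₃, st₃, stg₃, n₃⟩, m₃, P₃, T₃, U₃, u₃, v₃, r₃⟩, hr₃⟩ :=
      Runs.exists_rounds (𝒪 := 𝒪) (c := invBody mm) e₂.test
      (Runs.iteFalse (by simp [Test.Holds, hlv σ₂ e₂, NatExp.eval])
        (Runs.iteFalse (by simp [Test.Holds, hlv σ₂ e₂, NatExp.eval, st₂])
          (Runs.iteTrue (by simp [Test.Holds, hlv σ₂ e₂, NatExp.eval, st₂])
            (invSecond_runs hm e₂ hA₂ (isMat_matrix σ₂ (dbl k) 11 (k * S))))))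
    set P := σ₂.matrix (dbl k) 11 (k * S) with hPdef
    obtain ⟨σ₄, p₄, hr₄⟩ := ih σ₃ e₃ z₃
    have n₄ : ∀ a, a < 100 → a ≠ 10 → a ≠ 11 → a ≠ 12 → a ≠ 20 → a ≠ 21 →
        σ₄.nat a = σ.nat a := fun a h1 h2 h3 h4 h5 h6 => by
      rw [p₄.nat a h1 h2 h3 h4 h5 h6, n₃ a h1 h2 h4 h5 h6, n₂ a h1 h2 h3 h4 h5 h6]
    have e₄ : InvEnv K S (k + 1) σ₄ := hσ.congr p₄.lev hk
      (n₄ 13 (by norm_num) (by norm_num) (by norm_num) (by norm_num) (by norm_num) (by norm_num))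
      (n₄ 14 (by norm_num) (by norm_num) (by norm_num) (by norm_num) (by norm_num) (by norm_num))
      (n₄ 15 (by norm_num) (by norm_num) (by norm_num) (by norm_num) (by norm_num) (by norm_num))
    have st₄ : σ₄.nat 12 (k + 1) = 2 := by rw [p₄.stage _ (by omega), st₃]
    -- assemble
    obtain ⟨σ₅, ⟨⟨B, hB, b₁₁, b₁₂, b₂₁, b₂₂⟩, lev₅, n₅, r₅⟩, hr₅⟩ :=
      Runs.exists_rounds (𝒪 := 𝒪) (c := invBody mm) e₄.test
      (Runs.iteFalse (by simp [Test.Holds, hlv σ₄ e₄, NatExp.eval])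
        (Runs.iteFalse (by simp [Test.Holds, hlv σ₄ e₄, NatExp.eval, st₄])
          (Runs.iteFalse (by simp [Test.Holds, hlv σ₄ e₄, NatExp.eval, st₄])
            (invThird_runs hm e₄
              (P₃.mono fun c hc => p₄.mem 12 c (by simp) hc)
              (T₃.mono fun c hc => p₄.mem 13 c (by simp) hc)
              (U₃.mono fun c hc => p₄.mem 14 c (by simp) hc)
              (isMat_matrix σ₄ (dbl k) 11 (k * S))))))
    set R := σ₄.matrix (dbl k) 11 (k * S) with hRdef
    have bad₁ : σ₁.nat 11 = σ.nat 11 :=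
      n₁ 11 (by norm_num) (by norm_num) (by norm_num) (by norm_num) (by norm_num)
    have bad₃ : σ₃.nat 11 = σ₂.nat 11 :=
      n₃ 11 (by norm_num) (by norm_num) (by norm_num) (by norm_num) (by norm_num)
    have bad₅ : σ₅.nat 11 = σ₄.nat 11 :=
      n₅ 11 (by norm_num) (by norm_num) (by norm_num) (by norm_num)
    refine ⟨σ₅, ⟨lev₅, fun h => ?_, fun A' hA' hH hb => ?_, fun j hj => ?_,
      fun a h1 h2 h3 h4 h5 h6 => ?_, fun a c ha hc => ?_,
      fun a h1 h2 h3 h4 h5 h6 h7 h8 => ?_⟩, ?_⟩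
    · rw [bad₅]
      refine p₄.bad ?_
      rw [bad₃]
      exact p₂.bad (by rwa [bad₁])
    · obtain rfl : A' = A := IsMat.unique (R := dbl k + dbl k) (C := dbl k + dbl k) hA' hA
      replace hH : A.IsHermitian := hH
      change (σ₅.nat 11 0 = 0 ↔ A.PosDef) ∧ (A.PosDef → IsMat σ₅ 11 ((k + 1) * S) (dbl k + dbl k) A⁻¹)
      have ok₂ := p₂.ok _ m₁ hH.blk₁₁ (by rw [bad₁]; exact hb)
      rw [hH.posDef_iff_blocks, bad₅]
      by_cases h11 : (Matrix.blk₁₁ A).PosDef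
      · have hP : P = (Matrix.blk₁₁ A)⁻¹ := (ok₂.2 h11).matrix_eq
        rw [hP] at m₃
        have ok₄ := p₄.ok _ m₃ hH.schur (by rw [bad₃]; exact ok₂.1.2 h11)
        refine ⟨ok₄.1.trans ⟨fun h => ⟨h11, h⟩, fun h => h.2⟩, fun h => ?_⟩
        have hR : R = (Matrix.schur A)⁻¹ := (ok₄.2 h.2).matrix_eq
        rw [hP, hR] at b₁₁ b₁₂ b₂₁
        rw [hR] at b₂₂
        rw [← (hH.posDef_iff_blocks.2 h).inv_eq_of_blocks b₁₁ b₁₂ b₂₁ b₂₂]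
        exact hB
      -- If the first block is not positive definite, the flag is up before the second recursive
      -- call, and `bad` keeps it up whatever that call works on.
      · have hbad : σ₄.nat 11 0 ≠ 0 := p₄.bad (by rw [bad₃]; exact fun h => h11 (ok₂.1.1 h))
        exact ⟨⟨fun h => absurd h hbad, fun h => absurd h.1 h11⟩, fun h => absurd h.1 h11⟩
    · rw [n₅ 12 (by norm_num) (by norm_num) (by norm_num) (by norm_num),
        p₄.stage j (by omega), stg₃ j hj, p₂.stage j (by omega), stg₁ j hj]
    · rw [n₅ a h1 h2 h5 h6, n₄ a h1 h2 h3 h4 h5 h6]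
    · have hS : (k + 1) * S ≤ c := le_trans (Nat.mul_le_mul_right S (by omega)) hc
      have h5 : σ₅.real a = σ₄.real a := r₅ a (by omega) (by omega) (by omega) (by omega)
      rw [h5, p₄.mem a c ha hS]
      rcases ha with rfl | ha
      · rw [u₃ c hS, mem₂ c hS]
      · rw [v₃ a c ha hc, p₂.mem a c (Or.inr ha) hS, r₁ a (by omega) (by omega)]
    · rw [r₅ a h1 h3 h7 h8, p₄.real a h1 h2 h3 h4 h5 h6 h7 h8, r₃ a h1 h2 h4 h5 h6 h7,
        p₂.real a h1 h2 h3 h4 h5 h6 h7 h8, r₁ a h2 h7]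
    -- The two recursive calls cost `2 · 300 (k + 1) W(h) ≤ 300 (k + 1) W(2h)` with `h = dbl k`; the
    -- work at this level fits into the remaining `300 W(2h)`.
    · refine (((hr₁.trans hr₂).trans (hr₃.trans hr₄)).trans hr₅).le ?_
      have h2W := hm.two_mul_le (dbl k)
      change _ ≤ 300 * (((k + 1 : ℕ) : ℝ) + 1) * W (dbl k + dbl k)
      push_cast
      have hk0 : (0 : ℝ) ≤ k := Nat.cast_nonneg k
      nlinarith [mul_le_mul_of_nonneg_left h2W hk0]

end RealRAM

/-! ### Padding to a power of two. -/

namespace Matrix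

variable {n N : ℕ}

/-- The block diagonal matrix with blocks `M` and `1`. -/
def pad (N : ℕ) (M : SqMat n) : SqMat N := of fun i j =>
  if h : (i : ℕ) < n ∧ (j : ℕ) < n then M ⟨i, h.1⟩ ⟨j, h.2⟩ else if i = j then 1 else 0

theorem pad_submatrix (d : ℕ) (M : SqMat n) :
    (pad (n + d) M).submatrix finSumFinEquiv finSumFinEquiv = fromBlocks M 0 0 1 := by
  ext i j
  rcases i with i | i <;> rcases j with j | j
  · simp [pad]
  · have : Fin.castAdd d i ≠ Fin.natAdd n j := fun h => by
      have := congrArg Fin.val h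
      simp at this
      omega
    simp [pad, this]
  · have : Fin.natAdd n i ≠ Fin.castAdd d j := fun h => by
      have := congrArg Fin.val h
      simp at this
      omega
    simp [pad, this]
  · simp [pad, one_apply]

theorem pad_eq (d : ℕ) (M : SqMat n) :
    pad (n + d) M = (fromBlocks M 0 0 (1 : SqMat d)).submatrix finSumFinEquiv.symm
      finSumFinEquiv.symm := by
  rw [← pad_submatrix]
  simp

/-- Halving needs orders that are powers of two. An added identity block changes neither
definiteness nor, by `pad_inv`, the relevant block of the inverse. -/
theorem pad_posDef_iff (hN : n ≤ N) {M : SqMat n} : (pad N M).PosDef ↔ M.PosDef := by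
  obtain ⟨d, rfl⟩ := Nat.exists_eq_add_of_le hN
  have h1 : (pad (n + d) M).PosDef ↔ (fromBlocks M 0 0 (1 : SqMat d)).PosDef := by
    constructor
    · intro h
      have := h.submatrix (finSumFinEquiv (m := n) (n := d)).injective
      rwa [pad_submatrix] at this
    · intro h
      rw [pad_eq]
      exact h.submatrix (finSumFinEquiv (m := n) (n := d)).symm.injective
  rw [h1]
  constructor
  · intro h
    have h' := h.submatrix (Sum.inl_injective (α := Fin n) (β := Fin d))
    have e : (fromBlocks M 0 0 (1 : SqMat d)).submatrix Sum.inl Sum.inl = M := by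
      ext i j; rfl
    rwa [e] at h'
  · intro h
    let _ : Invertible (1 : SqMat d) := invertibleOne
    have h2 := PosDef.fromBlocks₂₂ M (0 : Matrix (Fin n) (Fin d) ℝ) (D := (1 : SqMat d)) .one
    simp only [conjTranspose_zero, Matrix.zero_mul, sub_zero] at h2
    refine (h2.2 h.posSemidef).posDef_iff_det_ne_zero.2 ?_
    rw [det_fromBlocks_zero₂₁, det_one, mul_one]
    exact h.det_pos.ne'

theorem pad_inv (hN : n ≤ N) {M : SqMat n} (hM : IsUnit M.det) : (pad N M)⁻¹ = pad N M⁻¹ := by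
  obtain ⟨d, rfl⟩ := Nat.exists_eq_add_of_le hN
  apply inv_eq_right_inv
  rw [pad_eq, pad_eq, submatrix_mul_equiv, fromBlocks_multiply]
  simp [mul_nonsing_inv _ hM]

theorem pad_isHermitian (hN : n ≤ N) {M : SqMat n} (hM : M.IsHermitian) :
    (pad N M).IsHermitian := by
  obtain ⟨d, rfl⟩ := Nat.exists_eq_add_of_le hN
  rw [pad_eq]
  refine IsHermitian.submatrix ?_ _
  exact IsHermitian.fromBlocks hM (by simp) isHermitian_one

end Matrix

/-! ### Inversion of `F - x I` with a test of definiteness. -/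

namespace RealRAM

variable {𝒪 : Oracle} {σ : Store} {n K S : ℕ}

/-- The scalars that describe the size of the problem. -/
structure Mach (n K S : ℕ) (σ : Store) : Prop where
  order : σ.nat 0 0 = n
  pos : 0 < n
  top : σ.nat 14 0 = K
  seg : σ.nat 15 0 = S
  pow : ∀ l ≤ K, σ.nat 13 l = dbl l
  sq_le : dbl K * dbl K ≤ S
  le : n ≤ dbl K

theorem Mach.congr {σ' : Store} (h : Mach n K S σ) (h0 : σ'.nat 0 = σ.nat 0)
    (h13 : σ'.nat 13 = σ.nat 13) (h14 : σ'.nat 14 = σ.nat 14)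
    (h15 : σ'.nat 15 = σ.nat 15) : Mach n K S σ' :=
  ⟨by rw [h0]; exact h.order, h.pos, by rw [h14]; exact h.top, by rw [h15]; exact h.seg,
    by rw [h13]; exact h.pow, h.sq_le, h.le⟩

theorem Mach.lowNat {σ' : Store} (h : Mach n K S σ) (hl : LowNat σ σ') : Mach n K S σ' :=
  h.congr (hl _ (by norm_num) (by norm_num) (by norm_num))
    (hl _ (by norm_num) (by norm_num) (by norm_num))
    (hl _ (by norm_num) (by norm_num) (by norm_num))
    (hl _ (by norm_num) (by norm_num) (by norm_num))

theorem Mach.agree {σ' : Store} {dst : ℕ} (h : Mach n K S σ) (hl : Agree dst σ σ') :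
    Mach n K S σ' := h.lowNat hl.lowNat

def ordE : NatExp := .get 0 (.lit 0)
def padE : NatExp := .get 13 (.get 14 (.lit 0))
def topE : NatExp := .mul (.get 14 (.lit 0)) (.get 15 (.lit 0))
/-- The entry of the identity matrix at the counters. -/
def deltaE : RealExp := .ofNat (.sub (.lit 1)
  (.add (.sub (.get 20 (.lit 0)) (.get 21 (.lit 0))) (.sub (.get 21 (.lit 0)) (.get 20 (.lit 0)))))

theorem Mach.eval_ordE (h : Mach n K S σ) : ordE.eval σ = n := h.order
theorem Mach.eval_padE (h : Mach n K S σ) : padE.eval σ = dbl K := by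
  rw [padE, NatExp.eval, NatExp.eval, NatExp.eval, h.top]; exact h.pow K le_rfl
theorem Mach.eval_topE (h : Mach n K S σ) : topE.eval σ = K * S := by
  simp [topE, NatExp.eval, h.top, h.seg]
theorem eval_deltaE {i j : ℕ} (hi : σ.nat 20 0 = i) (hj : σ.nat 21 0 = j) :
    deltaE.eval σ = if i = j then 1 else 0 := by
  simp only [deltaE, RealExp.eval, NatExp.eval, hi, hj]
  split_ifs with h
  · simp [h]
  · have : 1 - (i - j + (j - i)) = 0 := by omega
    simp [this]

/-- Invert `F - x I`, where `F` is in the real array `20` and `x` in the real array `27`: the inverse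
is put into the real array `19`, its trace into the real array `18`, and cell `0` of the array `11`
tells whether the matrix is not positive definite. -/
def resolvent (mm : Program) : Program :=
  .seq (fill padE padE 10 topE padE deltaE)
    (.seq (fill ordE ordE 10 topE padE
        (.sub (rd 20 (.lit 0) ordE) (.mul (.get 27 (.lit 0)) deltaE)))
      (.seq (.setNat 12 (.get 14 (.lit 0)) (.lit 0))
        (.seq (.setNat 11 (.lit 0) (.lit 0))
          (.seq (.setNat 10 (.lit 0) (.get 14 (.lit 0)))
            (.seq (.loop invTest (invBody mm))
              (.seq (fill ordE ordE 19 (.lit 0) ordE (rd 11 topE padE))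
                (acc ordE (.lit 1) 18 (rd 19 (.lit 0) (.add ordE (.lit 1))))))))))

theorem resolvent_runs {mm : Program} {W : ℕ → ℝ} (hm : MulProg mm W) (hσ : Mach n K S σ)
    {F : SqMat n} (hF : F.IsHermitian) (hF20 : IsMat σ 20 0 n F) {x : ℝ}
    (hx : σ.real 27 0 = x) :
    Runs 𝒪 (resolvent mm) σ (400 * (K + 1) * W (dbl K)) 0 fun σ' =>
      (σ'.nat 11 0 = 0 ↔ (F - x • (1 : SqMat n)).PosDef) ∧
      ((F - x • (1 : SqMat n)).PosDef → IsMat σ' 19 0 n (F - x • (1 : SqMat n))⁻¹ ∧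
        σ'.real 18 0 = ((F - x • (1 : SqMat n))⁻¹).trace) ∧
      (∀ a, a < 100 → a < 10 ∨ 12 < a → a ≠ 20 → a ≠ 21 → σ'.nat a = σ.nat a) ∧
      ∀ a, a < 100 → a < 10 ∨ 19 < a → σ'.real a = σ.real a := by
  have hn := hσ.pos
  have hN := dbl_pos K
  have hnN := hσ.le
  have h1 : (1 : ℝ) ≤ n := by exact_mod_cast hn
  have h2 : (n : ℝ) ≤ dbl K := by exact_mod_cast hnN
  have hsq := hm.sq_le (dbl K) hN
  have hK0 : (0 : ℝ) ≤ K := Nat.cast_nonneg K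
  set M : SqMat n := F - x • (1 : SqMat n) with hM
  have hMH : M.IsHermitian := by
    have := Matrix.isHermitian_one (n := Fin n) (α := ℝ)
    unfold Matrix.IsHermitian at *
    rw [hM, Matrix.conjTranspose_sub, Matrix.conjTranspose_smul, this, hF]
    simp
  have hW : (1 : ℝ) ≤ W (dbl K) := by nlinarith
  have hnn : (n : ℝ) * n ≤ W (dbl K) := by nlinarith
  refine (Runs.seq (K₁ := 0) (K₂ := 0) (fill_mat_runs (off := K * S) (stride := dbl K)
    (1 : SqMat (dbl K)) hN hN le_rfl
    (fun σ' h => (hσ.agree h).eval_padE) (fun σ' h => (hσ.agree h).eval_padE)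
    (fun σ' h => (hσ.agree h).eval_topE) (fun σ' h => (hσ.agree h).eval_padE)
    fun i j σ' h hi hj => ?_)
    (N₂ := 9 * (n * n) + (1 + (1 + (1 + (300 * (K + 1) * W (dbl K) + 1 +
      (9 * (n * n) + 10 * (n * (1 : ℕ)))))))) ?_).le ?_
  · rw [eval_deltaE hi hj, Matrix.one_apply]
    simp [Fin.ext_iff]
  swap
  · push_cast
    nlinarith [mul_nonneg hK0 (zero_le_one.trans hW)]
  rintro σ₁ ⟨a₁, m₁, -⟩
  have s₁ := hσ.agree a₁
  refine Runs.seq (K₁ := 0) (K₂ := 0) (fill_mat_runs (off := K * S) (stride := dbl K)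
    M hn hn hnN
    (fun σ' h => (s₁.agree h).eval_ordE) (fun σ' h => (s₁.agree h).eval_ordE)
    (fun σ' h => (s₁.agree h).eval_topE) (fun σ' h => (s₁.agree h).eval_padE)
    fun i j σ' h hi hj => ?_) ?_
  · simp only [RealExp.eval, rd_eval hi hj, eval_deltaE hi hj, NatExp.eval,
      (s₁.agree h).eval_ordE, h.real 20 (by norm_num : 20 ≠ 10),
      h.real 27 (by norm_num : 27 ≠ 10), a₁.real 20 (by norm_num : 20 ≠ 10),
      a₁.real 27 (by norm_num : 27 ≠ 10), hx, hF20 i j]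
    simp [hM, Matrix.one_apply, Fin.ext_iff]
  rintro σ₂ ⟨a₂, m₂, u₂⟩
  have s₂ := s₁.agree a₂
  have l₂ := a₁.lowNat.trans a₂.lowNat
  refine Runs.seq (K₁ := 0) (K₂ := 0)
    (Runs.setNat (Q := fun τ => τ = σ₂.writeNat 12 K 0) (by simp [NatExp.eval, s₂.top])) ?_
  rintro _ rfl
  refine Runs.seq (K₁ := 0) (K₂ := 0)
    (Runs.setNat (Q := fun τ => τ = (σ₂.writeNat 12 K 0).writeNat 11 0 0)
      (by simp [NatExp.eval])) ?_
  rintro _ rfl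
  refine Runs.seq (K₁ := 0) (K₂ := 0)
    (Runs.setNat (Q := fun τ => τ = ((σ₂.writeNat 12 K 0).writeNat 11 0 0).writeNat 10 0 K)
      (by simp [NatExp.eval, Store.writeNat, s₂.top])) ?_
  rintro _ rfl
  set σ₃ := ((σ₂.writeNat 12 K 0).writeNat 11 0 0).writeNat 10 0 K with hσ₃
  have n₃ : ∀ a, a ≠ 10 → a ≠ 11 → a ≠ 12 → σ₃.nat a = σ₂.nat a := fun a h1 h2 h3 => by
    simp [hσ₃, Store.writeNat, h1, h2, h3]
  have s₃ : Mach n K S σ₃ := s₂.congr (n₃ _ (by norm_num) (by norm_num) (by norm_num))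
    (n₃ _ (by norm_num) (by norm_num) (by norm_num))
    (n₃ _ (by norm_num) (by norm_num) (by norm_num))
    (n₃ _ (by norm_num) (by norm_num) (by norm_num))
  have e₃ : InvEnv K S K σ₃ :=
    ⟨by simp [hσ₃, Store.writeNat], le_rfl, s₃.top, s₃.seg, s₃.pow, s₃.sq_le⟩
  obtain ⟨σ₄, p₄, hr₄⟩ := exists_invPost (𝒪 := 𝒪) hm K σ₃ e₃ (by simp [hσ₃, Store.writeNat])
  -- The identity of order `dbl K` was written first and then overwritten by `M` in its upper left
  -- corner.
  have hpad : IsMat σ₃ 10 (K * S) (dbl K) (Matrix.pad (dbl K) M) := by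
    intro i j
    change σ₂.real 10 _ = _
    by_cases h : (i : ℕ) < n ∧ (j : ℕ) < n
    · rw [Matrix.pad, Matrix.of_apply, dif_pos h]
      exact m₂ ⟨i, h.1⟩ ⟨j, h.2⟩
    · rw [Matrix.pad, Matrix.of_apply, dif_neg h, u₂ _ fun i' j' => ?_, m₁ i j, Matrix.one_apply]
      exact cell_ne (by omega) (by omega) (by omega)
  have ok := p₄.ok _ hpad (Matrix.pad_isHermitian hnN hMH) (by simp [hσ₃, Store.writeNat])
  rw [Matrix.pad_posDef_iff hnN] at ok
  have n₄ : ∀ a, a < 100 → a < 10 ∨ 12 < a → a ≠ 20 → a ≠ 21 → σ₄.nat a = σ.nat a :=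
    fun a h1 h2 h3 h4 => by
      rw [p₄.nat a h1 (by omega) (by omega) (by omega) h3 h4, n₃ a (by omega) (by omega) (by omega),
        l₂ a h1 h3 h4]
  have s₄ : Mach n K S σ₄ := hσ.congr (n₄ _ (by norm_num) (by norm_num) (by norm_num) (by norm_num))
    (n₄ _ (by norm_num) (by norm_num) (by norm_num) (by norm_num))
    (n₄ _ (by norm_num) (by norm_num) (by norm_num) (by norm_num))
    (n₄ _ (by norm_num) (by norm_num) (by norm_num) (by norm_num))
  refine Runs.seq (K₁ := 0) (K₂ := 0) (Q₁ := fun τ => τ = σ₄) (hr₄ 1 0 _ (Runs.loopFalse ?_ rfl)) ?_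
  · simp [invTest, Test.Holds, NatExp.eval, lvE, p₄.lev, s₄.top]
  intro τ hτ
  rw [hτ]
  set G : SqMat n := Matrix.of fun i j => σ₄.real 11 (K * S + i * dbl K + j) with hG
  refine Runs.seq (K₁ := 0) (K₂ := 0) (fill_mat_runs (off := 0) (stride := n)
    G hn hn le_rfl
    (fun σ' h => (s₄.agree h).eval_ordE) (fun σ' h => (s₄.agree h).eval_ordE)
    (fun _ _ => rfl) (fun σ' h => (s₄.agree h).eval_ordE)
    fun i j σ' h hi hj => ?_) ?_
  · rw [rd_eval hi hj, (s₄.agree h).eval_topE, (s₄.agree h).eval_padE, h.real 11 (by norm_num)]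
    rfl
  rintro σ₅ ⟨a₅, m₅, -⟩
  have s₅ := s₄.agree a₅
  -- A single column with stride `n + 1` runs through the diagonal of the stored inverse.
  refine (acc_runs (fun i _ => if h : i < n then G ⟨i, h⟩ ⟨i, h⟩ else 0) hn one_pos
    (fun σ' h => (s₅.agree h).eval_ordE) (fun _ _ => rfl) fun i hi j hj σ' h hi' hj' => ?_).mono
    le_rfl ?_
  · obtain rfl : j = 0 := by omega
    rw [rd_eval hi' hj', h.real 19 (by norm_num), dif_pos hi, ← m₅ ⟨i, hi⟩ ⟨i, hi⟩]
    simp only [NatExp.eval, (s₅.agree h).eval_ordE]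
    congr 1; ring
  rintro σ₆ ⟨a₆, t₆⟩
  refine ⟨?_, fun hpd => ?_, fun a h1 h2 h3 h4 => ?_, fun a h1 h2 => ?_⟩
  · rw [a₆.nat 11 (by norm_num) (by norm_num), a₅.nat 11 (by norm_num) (by norm_num)]
    exact ok.1
  · have hinv : G = M⁻¹ := by
      have h3 := ok.2 hpd
      rw [Matrix.pad_inv hnN ((Matrix.isUnit_iff_isUnit_det _).1 hpd.isUnit)] at h3
      ext i j
      rw [hG, Matrix.of_apply]
      refine (h3 ⟨i, by omega⟩ ⟨j, by omega⟩).trans ?_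
      simp [Matrix.pad]
    rw [← hinv]
    refine ⟨m₅.congr (a₆.real 19 (by norm_num)), ?_⟩
    rw [t₆, Matrix.trace, ← Fin.sum_univ_eq_sum_range fun i =>
      ∑ _j ∈ Finset.range 1, if h : i < n then G ⟨i, h⟩ ⟨i, h⟩ else 0]
    simp
  · rw [a₆.nat a h3 h4, a₅.nat a h3 h4, n₄ a h1 h2 h3 h4]
  · have h₃ : σ₃.real a = σ₂.real a := rfl
    rw [a₆.real a (by omega), a₅.real a (by omega), p₄.real a h1 (by omega) (by omega) (by omega)
      (by omega) (by omega) (by omega) (by omega), h₃, a₂.real a (by omega), a₁.real a (by omega)]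

end RealRAM

/-! ### Bisection for the root. -/

namespace RealRAM

variable {𝒪 : Oracle} {σ : Store} {n K S : ℕ}

theorem Runs.setScalar (σ : Store) (a : ℕ) (e : RealExp) :
    Runs 𝒪 (.setReal a (.lit 0) e) σ 1 0 fun τ =>
      τ.real a 0 = e.eval σ ∧ τ.nat = σ.nat ∧ ∀ b, b ≠ a → τ.real b = σ.real b :=
  Runs.setReal ⟨by simp [Store.writeReal, NatExp.eval], rfl, fun _ h => Function.update_of_ne h _ _⟩

/-- The memories agree on the arrays of natural numbers with `p` and on those of reals with `q`. -/
structure Keep (p q : ℕ → Prop) (σ σ' : Store) : Prop where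
  nat : ∀ a, p a → σ'.nat a = σ.nat a
  real : ∀ a, q a → σ'.real a = σ.real a

theorem Keep.refl (p q : ℕ → Prop) (σ : Store) : Keep p q σ σ := ⟨fun _ _ => rfl, fun _ _ => rfl⟩

theorem Keep.trans {p q : ℕ → Prop} {σ₁ σ₂ σ₃ : Store} (h : Keep p q σ₁ σ₂)
    (h' : Keep p q σ₂ σ₃) : Keep p q σ₁ σ₃ :=
  ⟨fun a ha => (h'.nat a ha).trans (h.nat a ha), fun a ha => (h'.real a ha).trans (h.real a ha)⟩

/-- The arrays of natural numbers not used as work space. -/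
def NatKept (a : ℕ) : Prop := a < 100 ∧ (a < 10 ∨ 12 < a) ∧ a ≠ 20 ∧ a ≠ 21

/-- The arrays of reals that are not used by the root search. -/
def RootKept (a : ℕ) : Prop :=
  a < 100 ∧ (a < 10 ∨ 19 < a) ∧ a ≠ 21 ∧ a ≠ 25 ∧ a ≠ 26 ∧ a ≠ 27

theorem Mach.keep {q : ℕ → Prop} {σ' : Store} (h : Mach n K S σ) (hk : Keep NatKept q σ σ') :
    Mach n K S σ' :=
  h.congr (hk.nat _ (by norm_num [NatKept])) (hk.nat _ (by norm_num [NatKept]))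
    (hk.nat _ (by norm_num [NatKept])) (hk.nat _ (by norm_num [NatKept]))

def scal (a : ℕ) : RealExp := .get a (.lit 0)

theorem eval_scal (a : ℕ) : (scal a).eval σ = σ.real a 0 := rfl

/-- The scaled trace at the point in the real array `27`. -/
def normTraceE : RealExp :=
  .mul (.div (.mul (scal 23) (scal 27)) (.ofNat ordE)) (scal 18)

def rootTest : Test :=
  .realLt (.mul (.div (.mul (.mul (scal 23) (scal 23)) (scal 23))
    (.mul (.ofNat (.lit 32)) (.ofNat ordE))) (scal 25)) (.sub (scal 26) (scal 25))

def rootBody (mm : Program) : Program :=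
  .seq (.setReal 27 (.lit 0) (.div (.add (scal 25) (scal 26)) (.ofNat (.lit 2))))
    (.seq (resolvent mm)
      (.ite (.and (.natLt (.get 11 (.lit 0)) (.lit 1)) (.realLt normTraceE (.ofNat (.lit 1))))
        (.setReal 25 (.lit 0) (scal 27)) (.setReal 26 (.lit 0) (scal 27))))

/-- Bisection for the root `θ*`, and the computation of `X`. -/
def rootProg (mm : Program) : Program :=
  .seq (.setReal 27 (.lit 0) (.ofNat (.lit 0)))
    (.seq (resolvent mm)
      (.seq (.setReal 25 (.lit 0) (.div (.ofNat (.lit 1)) (.mul (.ofNat (.lit 2)) (scal 18))))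
        (.seq (.setReal 26 (.lit 0) (.div (.ofNat ordE) (scal 18)))
          (.seq (.loop rootTest (rootBody mm))
            (.seq (.setReal 27 (.lit 0) (scal 25))
              (.seq (resolvent mm)
                (fill ordE ordE 21 (.lit 0) ordE
                  (.mul (.div (.mul (scal 23) (scal 25)) (.ofNat ordE))
                    (rd 19 (.lit 0) ordE)))))))))

/-- The memory holds a matrix `F` and an accuracy `e`. -/
structure RootEnv (n K S : ℕ) (F : SqMat n) (e : ℝ) (σ : Store) : Prop where
  mach : Mach n K S σ
  mat : IsMat σ 20 0 n F
  acc : σ.real 23 0 = e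

variable {F : SqMat n} {e : ℝ}

theorem RootEnv.keep {σ' : Store} (h : RootEnv n K S F e σ) (hk : Keep NatKept RootKept σ σ') :
    RootEnv n K S F e σ' :=
  ⟨h.mach.keep hk, h.mat.congr (hk.real 20 (by norm_num [RootKept])), by
    rw [hk.real 23 (by norm_num [RootKept]), h.acc]⟩

theorem RootEnv.resolvent_runs {mm : Program} {W : ℕ → ℝ} (hm : MulProg mm W)
    (hσ : RootEnv n K S F e σ) (hF : F.IsHermitian) :
    Runs 𝒪 (resolvent mm) σ (400 * (K + 1) * W (dbl K)) 0 fun σ' =>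
      (σ'.nat 11 0 = 0 ↔ (F - σ.real 27 0 • (1 : SqMat n)).PosDef) ∧
      ((F - σ.real 27 0 • (1 : SqMat n)).PosDef →
        IsMat σ' 19 0 n (F - σ.real 27 0 • (1 : SqMat n))⁻¹ ∧
        σ'.real 18 0 = ((F - σ.real 27 0 • (1 : SqMat n))⁻¹).trace) ∧
      Keep NatKept RootKept σ σ' ∧ σ'.real 25 = σ.real 25 ∧ σ'.real 26 = σ.real 26 ∧
      σ'.real 27 = σ.real 27 := by
  refine (RealRAM.resolvent_runs hm hσ.mach hF hσ.mat rfl).mono le_rfl ?_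
  rintro σ' ⟨h1, h2, h3, h4⟩
  exact ⟨h1, h2, ⟨fun a ha => h3 a ha.1 ha.2.1 ha.2.2.1 ha.2.2.2,
    fun a ha => h4 a ha.1 ha.2.1⟩, h4 _ (by norm_num) (by norm_num),
    h4 _ (by norm_num) (by norm_num), h4 _ (by norm_num) (by norm_num)⟩

theorem Keep.of_scalar {a : ℕ} {σ' : Store} (ha : ¬ RootKept a) (hn : σ'.nat = σ.nat)
    (hr : ∀ b, b ≠ a → σ'.real b = σ.real b) : Keep NatKept RootKept σ σ' :=
  ⟨fun b _ => by rw [hn], fun b hb => hr b fun h => ha (h ▸ hb)⟩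

theorem rootBody_runs {mm : Program} {W : ℕ → ℝ} (hm : MulProg mm W)
    (hσ : RootEnv n K S F e σ) (hF : F.IsHermitian) (he : 0 < e) {θs lo hi : ℝ}
    (hs : (F - θs • (1 : SqMat n)).PosDef) (hs1 : RobustSDP.normTrace e F θs = 1)
    (hlo : σ.real 25 0 = lo) (hhi : σ.real 26 0 = hi) (h0 : 0 < lo) (h1 : lo < θs)
    (h2 : θs ≤ hi) :
    Runs 𝒪 (rootBody mm) σ (400 * (K + 1) * W (dbl K) + 3) 0 fun σ' =>
      Keep NatKept RootKept σ σ' ∧ ∃ lo' hi', σ'.real 25 0 = lo' ∧ σ'.real 26 0 = hi' ∧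
        lo ≤ lo' ∧ lo' < θs ∧ θs ≤ hi' ∧ hi' - lo' = (hi - lo) / 2 := by
  have hn := hσ.mach.pos
  refine (Runs.seq (K₁ := 0) (K₂ := 0) (Runs.setScalar σ 27 _)
    (N₂ := 400 * (K + 1) * W (dbl K) + (1 + 1)) ?_).le (by linarith)
  rintro σ₁ ⟨v₁, n₁, r₁⟩
  have v₁' : σ₁.real 27 0 = (lo + hi) / 2 := by
    rw [v₁]; simp [RealExp.eval, NatExp.eval, eval_scal, hlo, hhi]
  have k₁ : Keep NatKept RootKept σ σ₁ := .of_scalar (by norm_num [RootKept]) n₁ r₁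
  have s₁ := hσ.keep k₁
  refine Runs.seq (K₁ := 0) (K₂ := 0) (s₁.resolvent_runs hm hF) ?_
  rintro σ₂ ⟨flag, inv, k₂, r25, r26, r27⟩
  have s₂ := s₁.keep k₂
  rw [v₁'] at flag inv
  have k₀₂ := k₁.trans k₂
  have hlo₂ : σ₂.real 25 0 = lo := by rw [r25, r₁ 25 (by norm_num), hlo]
  have hhi₂ : σ₂.real 26 0 = hi := by rw [r26, r₁ 26 (by norm_num), hhi]
  have hmid₂ : σ₂.real 27 0 = (lo + hi) / 2 := by rw [r27, v₁']
  -- The stored trace is meaningful only if the matrix is positive definite; the comparison with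
  -- `lt_root_iff` uses it under that condition.
  have key : (Test.and (.natLt (.get 11 (.lit 0)) (.lit 1))
      (.realLt normTraceE (.ofNat (.lit 1)))).Holds σ₂ ↔ (lo + hi) / 2 < θs := by
    rw [RobustSDP.lt_root_iff hF hn he hs hs1 (by linarith) (h0.trans h1)]
    simp only [Test.Holds, NatExp.eval, RealExp.eval, normTraceE, eval_scal, s₂.mach.eval_ordE,
      hmid₂, s₂.acc, Nat.lt_one_iff, flag, RobustSDP.normTrace, Nat.cast_one]
    refine and_congr_right fun hpd => ?_
    rw [(inv hpd).2]
  by_cases hc : (lo + hi) / 2 < θs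
  · refine Runs.iteTrue (key.2 hc) ((Runs.setScalar σ₂ 25 _).mono le_rfl ?_)
    rintro σ₃ ⟨v₃, n₃, r₃⟩
    refine ⟨k₀₂.trans (.of_scalar (by norm_num [RootKept]) n₃ r₃), (lo + hi) / 2, hi, ?_, ?_, ?_, hc,
      h2, by ring⟩
    · rw [v₃, eval_scal, hmid₂]
    · rw [r₃ 26 (by norm_num), hhi₂]
    · linarith
  · refine Runs.iteFalse (key.not.2 hc) ((Runs.setScalar σ₂ 26 _).mono le_rfl ?_)
    rintro σ₃ ⟨v₃, n₃, r₃⟩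
    refine ⟨k₀₂.trans (.of_scalar (by norm_num [RootKept]) n₃ r₃), lo, (lo + hi) / 2, ?_, ?_, le_rfl,
      h1, not_lt.1 hc, by ring⟩
    · rw [r₃ 25 (by norm_num), hlo₂]
    · rw [v₃, eval_scal, hmid₂]

/-- `M` bounds the remaining halvings: the interval is at most `2^M` times as long as the target `δ
lo₀`, and the test compares its length with `δ` times the current lower end, which is at least
`lo₀`. -/
theorem rootLoop_runs {mm : Program} {W : ℕ → ℝ} (hm : MulProg mm W) (hF : F.IsHermitian)
    (he : 0 < e) {θs lo₀ : ℝ} (hlo₀ : 0 < lo₀)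
    (hs : (F - θs • (1 : SqMat n)).PosDef) (hs1 : RobustSDP.normTrace e F θs = 1) (M : ℕ) :
    ∀ (σ : Store) (lo hi : ℝ), RootEnv n K S F e σ → σ.real 25 0 = lo → σ.real 26 0 = hi →
      lo₀ ≤ lo → lo < θs → θs ≤ hi → hi - lo ≤ e ^ 3 / (32 * n) * lo₀ * 2 ^ M →
      Runs 𝒪 (.loop rootTest (rootBody mm)) σ (1 + M * (400 * (K + 1) * W (dbl K) + 4)) 0
        fun σ' => Keep NatKept RootKept σ σ' ∧ lo₀ ≤ σ'.real 25 0 ∧ σ'.real 25 0 < θs ∧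
          θs - σ'.real 25 0 ≤ e ^ 3 / (32 * n) * σ'.real 25 0 := by
  have key : ∀ (σ : Store) (lo hi : ℝ), RootEnv n K S F e σ → σ.real 25 0 = lo →
      σ.real 26 0 = hi → (rootTest.Holds σ ↔ e ^ 3 / (32 * n) * lo < hi - lo) := by
    intro σ lo hi hσ h1 h2
    simp only [rootTest, Test.Holds, RealExp.eval, NatExp.eval, eval_scal, hσ.acc, h1, h2,
      hσ.mach.eval_ordE]
    rw [show e ^ 3 = e * e * e by ring]
    norm_num
  have hδ : 0 ≤ e ^ 3 / (32 * (n : ℝ)) := by positivity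
  induction M with
  | zero =>
    intro σ lo hi hσ h1 h2 h3 h4 h5 h6
    have : e ^ 3 / (32 * (n : ℝ)) * lo₀ ≤ e ^ 3 / (32 * n) * lo := by gcongr
    refine (Runs.loopFalse ((key σ lo hi hσ h1 h2).not.2 ?_) ⟨.refl _ _ _, ?_, ?_, ?_⟩).le (by simp)
    · simp at h6; linarith
    · rwa [h1]
    · rwa [h1]
    · simp at h6; rw [h1]; linarith
  | succ M ih =>
    intro σ lo hi hσ h1 h2 h3 h4 h5 h6
    have hB := ((rootBody_runs (𝒪 := 𝒪) hm hσ hF he hs hs1 h1 h2 (hlo₀.trans_le h3) h4 h5)).cost_nonneg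
    have hM : (0 : ℝ) ≤ M := Nat.cast_nonneg M
    by_cases hc : e ^ 3 / (32 * n) * lo < hi - lo
    · refine (Runs.loopTrue (K₁ := 0) (K₂ := 0) ((key σ lo hi hσ h1 h2).2 hc)
        (rootBody_runs hm hσ hF he hs hs1 h1 h2 (hlo₀.trans_le h3) h4 h5)
        (N₂ := 1 + M * (400 * (K + 1) * W (dbl K) + 4)) ?_).le ?_
      · rintro σ₁ ⟨k₁, lo', hi', g1, g2, g3, g4, g5, g6⟩
        refine (ih σ₁ lo' hi' (hσ.keep k₁) g1 g2 (h3.trans g3) g4 g5 ?_).mono le_rfl ?_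
        · rw [g6]; rw [pow_succ (2 : ℝ) M] at h6; linarith
        · rintro σ₂ ⟨k₂, h⟩
          exact ⟨k₁.trans k₂, h⟩
      · push_cast; linarith
    · refine (Runs.loopFalse ((key σ lo hi hσ h1 h2).not.2 hc)
        ⟨.refl _ _ _, by rwa [h1], by rwa [h1], by rw [h1]; linarith⟩).le ?_
      · have : 0 ≤ ((M + 1 : ℕ) : ℝ) * (400 * (K + 1) * W (dbl K) + 4) := by
          apply mul_nonneg (Nat.cast_nonneg _); linarith
        linarith

theorem rootProg_runs {mm : Program} {W : ℕ → ℝ} (hm : MulProg mm W)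
    (hσ : RootEnv n K S F e σ) (hF : F.PosDef) (he : 0 < e) (he1 : e < 1) {M : ℕ}
    (hM : 64 * (n : ℝ) ^ 2 ≤ e ^ 3 * 2 ^ M) :
    Runs 𝒪 (rootProg mm) σ (800 * (M + 2) * (K + 1) * W (dbl K)) 0 fun σ' =>
      Keep NatKept RootKept σ σ' ∧
      RobustSDP.IsApproxRoot e (e ^ 3 / (32 * n)) F (σ'.real 25 0) ∧
      IsMat σ' 21 0 n ((e * σ'.real 25 0 / n) • (F - σ'.real 25 0 • (1 : SqMat n))⁻¹) := by
  have hn := hσ.mach.pos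
  have hn' : (0 : ℝ) < n := by exact_mod_cast hn
  have hN := dbl_pos K
  have h1n : (1 : ℝ) ≤ n := by exact_mod_cast hn
  have h2n : (n : ℝ) ≤ dbl K := by exact_mod_cast hσ.mach.le
  have hsq := hm.sq_le (dbl K) hN
  obtain ⟨θs, hs0, hs, hs1⟩ := RobustSDP.exists_root hF hn he
  obtain ⟨ht, hlo, hhi⟩ := RobustSDP.root_mem_Ioo hF hn he he1 hs0 hs hs1
  set t := (F⁻¹).trace with htdef
  set R := 400 * (K + 1) * W (dbl K) with hR
  have hK0 : (0 : ℝ) ≤ K := Nat.cast_nonneg K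
  have hM0 : (0 : ℝ) ≤ M := Nat.cast_nonneg M
  have hRn : 400 * ((n : ℝ) * n) ≤ R := by
    have : (n : ℝ) * n ≤ W (dbl K) := by nlinarith
    rw [hR]
    nlinarith [mul_nonneg hK0 (by nlinarith : 0 ≤ W (dbl K))]
  have hnn : (1 : ℝ) ≤ (n : ℝ) * n := by nlinarith
  have hδ : 0 < e ^ 3 / (32 * (n : ℝ)) := by positivity
  refine (Runs.seq (K₁ := 0) (K₂ := 0) (Runs.setScalar σ 27 _)
    (N₂ := R + (1 + (1 + ((1 + M * (R + 4)) + (1 + (R + 9 * (n * n))))))) ?_).le ?_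
  swap
  · have : 800 * (M + 2) * (K + 1) * W (dbl K) = 2 * (M + 2) * R := by rw [hR]; ring
    rw [this]
    nlinarith
  rintro σ₁ ⟨v₁, n₁, r₁⟩
  have v₁' : σ₁.real 27 0 = 0 := by rw [v₁]; simp [RealExp.eval, NatExp.eval]
  have k₁ : Keep NatKept RootKept σ σ₁ := .of_scalar (by norm_num [RootKept]) n₁ r₁
  have s₁ := hσ.keep k₁
  refine Runs.seq (K₁ := 0) (K₂ := 0) (s₁.resolvent_runs hm hF.1) ?_
  rintro σ₂ ⟨-, inv, k₂, -, -, -⟩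
  have s₂ := s₁.keep k₂
  rw [v₁', zero_smul, sub_zero] at inv
  have t₂ := (inv hF).2
  refine Runs.seq (K₁ := 0) (K₂ := 0) (Runs.setScalar σ₂ 25 _) ?_
  rintro σ₃ ⟨v₃, n₃, r₃⟩
  have k₃ : Keep NatKept RootKept σ₂ σ₃ := .of_scalar (by norm_num [RootKept]) n₃ r₃
  have s₃ := s₂.keep k₃
  refine Runs.seq (K₁ := 0) (K₂ := 0) (Runs.setScalar σ₃ 26 _) ?_
  rintro σ₄ ⟨v₄, n₄, r₄⟩
  have k₄ : Keep NatKept RootKept σ₃ σ₄ := .of_scalar (by norm_num [RootKept]) n₄ r₄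
  have s₄ := s₃.keep k₄
  have lo₄ : σ₄.real 25 0 = 1 / (2 * t) := by
    rw [r₄ 25 (by norm_num), v₃]
    simp [RealExp.eval, NatExp.eval, eval_scal, t₂, htdef]
  have hi₄ : σ₄.real 26 0 = n / t := by
    rw [v₄]
    simp only [RealExp.eval, s₃.mach.eval_ordE, eval_scal, r₃ 18 (by norm_num), t₂, htdef]
  refine Runs.seq (K₁ := 0) (K₂ := 0) (rootLoop_runs hm hF.1 he (lo₀ := 1 / (2 * t))
    (by positivity) hs hs1 M σ₄ _ _ s₄ lo₄ hi₄ le_rfl hlo hhi.le ?_) ?_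
  -- The search starts from `[1/(2t), n/t]`; `64 n² ≤ e³ 2^M` is exactly `n/t ≤ δ · (1/(2t)) · 2^M`
  -- with `δ = e³/(32 n)`.
  · have h5 : (n : ℝ) / t ≤ e ^ 3 / (32 * n) * (1 / (2 * t)) * 2 ^ M := by
      have : e ^ 3 / (32 * n) * (1 / (2 * t)) * 2 ^ M = e ^ 3 * 2 ^ M / (64 * n * t) := by
        field_simp; ring
      rw [this, div_le_div_iff₀ ht (by positivity)]
      nlinarith
    have h6 : 0 < 1 / (2 * t) := by positivity
    linarith
  rintro σ₅ ⟨k₅, g1, g2, g3⟩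
  have s₅ := s₄.keep k₅
  refine Runs.seq (K₁ := 0) (K₂ := 0) (Runs.setScalar σ₅ 27 _) ?_
  rintro σ₆ ⟨v₆, n₆, r₆⟩
  have k₆ : Keep NatKept RootKept σ₅ σ₆ := .of_scalar (by norm_num [RootKept]) n₆ r₆
  have s₆ := s₅.keep k₆
  rw [eval_scal] at v₆
  set θ := σ₅.real 25 0 with hθ
  refine Runs.seq (K₁ := 0) (K₂ := 0) (s₆.resolvent_runs hm hF.1) ?_
  rintro σ₇ ⟨-, inv₇, k₇, r25, -, -⟩
  have s₇ := s₆.keep k₇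
  rw [v₆] at inv₇
  have hθ₇ : σ₇.real 25 0 = θ := by rw [r25, r₆ 25 (by norm_num)]
  have m₇ := (inv₇ (RobustSDP.posDef_sub_smul_mono hF.1 g2.le hs)).1
  refine (fill_mat_runs (off := 0) (stride := n)
    ((e * θ / n) • (F - θ • (1 : SqMat n))⁻¹) hn hn le_rfl
    (fun σ' h => (s₇.mach.agree h).eval_ordE) (fun σ' h => (s₇.mach.agree h).eval_ordE)
    (fun _ _ => rfl) (fun σ' h => (s₇.mach.agree h).eval_ordE)
    fun i j σ' h hi hj => ?_).mono le_rfl ?_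
  · simp only [RealExp.eval, rd_eval hi hj, eval_scal, h.real 23 (by norm_num : 23 ≠ 21),
      h.real 25 (by norm_num : 25 ≠ 21), h.real 19 (by norm_num : 19 ≠ 21), s₇.acc, hθ₇,
      (s₇.mach.agree h).eval_ordE, NatExp.eval, m₇ i j, Matrix.smul_apply, smul_eq_mul]
  rintro σ₈ ⟨a₈, m₈, -⟩
  have hθ₈ : σ₈.real 25 0 = θ := by rw [a₈.real 25 (by norm_num), hθ₇]
  have k₈ : Keep NatKept RootKept σ₇ σ₈ :=
    ⟨fun a ha => a₈.nat a ha.2.2.1 ha.2.2.2, fun a ha => a₈.real a ha.2.2.1⟩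
  refine ⟨k₁.trans (k₂.trans (k₃.trans (k₄.trans (k₅.trans (k₆.trans (k₇.trans k₈)))))), ?_, ?_⟩
  · rw [hθ₈, RobustSDP.isApproxRoot_iff hF hn he]
    refine ⟨θs, hs0, hs, hs1, ?_, g2⟩
    -- From `θs ≤ (1 + δ) θ` and `(1 - δ)(1 + δ) ≤ 1`.
    nlinarith [mul_nonneg hδ.le hδ.le, mul_pos hδ hs0]
  · rw [hθ₈]; exact m₈

end RealRAM

/-! ### One iteration of the algorithm as a program. -/

namespace RobustSDP

variable {n m r : ℕ} {P : RobustSDP n m r}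

/-- The oracle is only known to be correct on positive semidefinite matrices, so this is needed
before `X` is submitted. -/
theorem IsApproxRoot.posDef_smul_inv {e δ θ : ℝ} {F : SqMat n} (hF : F.PosDef) (hn : 0 < n)
    (he : 0 < e) (hδ : δ < 1) (h : IsApproxRoot e δ F θ) :
    ((e * θ / n) • (F - θ • (1 : SqMat n))⁻¹).PosDef := by
  rw [isApproxRoot_iff hF hn he] at h
  obtain ⟨θs, hs0, hs, hs1, h1, h2⟩ := h
  have hn' : (0 : ℝ) < n := by exact_mod_cast hn
  have hθ : 0 < θ := lt_of_lt_of_le (mul_pos (by linarith) hs0) h1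
  exact (posDef_sub_smul_mono hF.1 h2.le hs).inv.smul (by positivity)

end RobustSDP

namespace RealRAM

open RobustSDP

variable {𝒪 : Oracle} {σ : Store} {n m r K S : ℕ} {P : RobustSDP n m r}

theorem Keep.weaken {p q p' q' : ℕ → Prop} {σ' : Store} (h : Keep p q σ σ')
    (hp : ∀ a, p' a → p a) (hq : ∀ a, q' a → q a) : Keep p' q' σ σ' :=
  ⟨fun a ha => h.nat a (hp a ha), fun a ha => h.real a (hq a ha)⟩

theorem Keep.scalar {p q : ℕ → Prop} {a : ℕ} {σ' : Store} (ha : ¬ q a) (hn : σ'.nat = σ.nat)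
    (hr : ∀ b, b ≠ a → σ'.real b = σ.real b) : Keep p q σ σ' :=
  ⟨fun b _ => by rw [hn], fun b hb => hr b fun h => ha (h ▸ hb)⟩

theorem Agree.keep {p q : ℕ → Prop} {dst : ℕ} {σ' : Store} (h : Agree dst σ σ') (h20 : ¬ p 20)
    (h21 : ¬ p 21) (hd : ¬ q dst) : Keep p q σ σ' :=
  ⟨fun a ha => h.nat a (fun h' => h20 (h' ▸ ha)) fun h' => h21 (h' ▸ ha),
    fun a ha => h.real a fun h' => hd (h' ▸ ha)⟩

theorem Mach.keep' {p q : ℕ → Prop} {σ' : Store} (h : Mach n K S σ) (hk : Keep p q σ σ')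
    (h0 : p 0) (h13 : p 13) (h14 : p 14) (h15 : p 15) : Mach n K S σ' :=
  h.congr (hk.nat _ h0) (hk.nat _ h13) (hk.nat _ h14) (hk.nat _ h15)

theorem isMat_writeMatrix (σ : Store) (a : ℕ) (M : SqMat n) :
    IsMat (σ.writeMatrix n a M) a 0 n M := by
  intro i j
  have hn : 0 < n := i.pos
  have hlt : 0 + (i : ℕ) * n + j < n * n := by nlinarith [i.2, j.2]
  have h1 : (0 + (i : ℕ) * n + j) / n = i := by
    rw [zero_add, mul_comm, Nat.mul_add_div hn, Nat.div_eq_of_lt j.2, add_zero]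
  have h2 : (0 + (i : ℕ) * n + j) % n = j := by
    rw [zero_add, mul_comm, Nat.mul_add_mod, Nat.mod_eq_of_lt j.2]
  simp only [Store.writeMatrix, Function.update_self, dif_pos hlt]
  congr 1 <;> exact Fin.ext (by assumption)

theorem frob_eq_sum_range (A X : SqMat n) : frob A X =
    ∑ i ∈ Finset.range n, ∑ j ∈ Finset.range n,
      if h : i < n ∧ j < n then A ⟨i, h.1⟩ ⟨j, h.2⟩ * X ⟨j, h.2⟩ ⟨i, h.1⟩ else 0 := by
  rw [frob, Matrix.trace, ← Fin.sum_univ_eq_sum_range fun i =>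
    ∑ j ∈ Finset.range n,
      if h : i < n ∧ j < n then A ⟨i, h.1⟩ ⟨j, h.2⟩ * X ⟨j, h.2⟩ ⟨i, h.1⟩ else 0]
  refine Finset.sum_congr rfl fun i _ => ?_
  rw [← Fin.sum_univ_eq_sum_range fun j =>
    if h : (i : ℕ) < n ∧ j < n then A ⟨i, h.1⟩ ⟨j, h.2⟩ * X ⟨j, h.2⟩ ⟨i, h.1⟩ else 0]
  simp [Matrix.mul_apply]

/-- The inner product of the matrices in the real arrays `a` and `21`. -/
def frobProg (a dst : ℕ) : Program :=
  acc ordE ordE dst (.mul (rd a (.lit 0) ordE)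
    (.get 21 (.add (.mul (.get 21 (.lit 0)) ordE) (.get 20 (.lit 0)))))

theorem frobProg_runs (hσ : Mach n K S σ) {A X : SqMat n} {a dst : ℕ} (hA : IsMat σ a 0 n A)
    (hX : IsMat σ 21 0 n X) (ha : a ≠ dst) (hd : 21 ≠ dst) :
    Runs 𝒪 (frobProg a dst) σ (10 * (n * n)) 0 fun σ' => Agree dst σ σ' ∧
      σ'.real dst 0 = frob A X := by
  rw [frob_eq_sum_range]
  refine acc_runs _ hσ.pos hσ.pos (fun σ' h => (hσ.agree h).eval_ordE)
    (fun σ' h => (hσ.agree h).eval_ordE) fun i hi j hj σ' h hi' hj' => ?_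
  rw [dif_pos ⟨hi, hj⟩, ← hA ⟨i, hi⟩ ⟨j, hj⟩, ← hX ⟨j, hj⟩ ⟨i, hi⟩]
  simp only [RealExp.eval, rd_eval hi' hj', NatExp.eval, (hσ.agree h).eval_ordE, hi', hj',
    h.real a ha, h.real 21 hd, zero_add]

/-- Choose the step: root, oracle call, error `ν` and step size `τ`. -/
def iterHead (mm : Program) : Program :=
  .seq (rootProg mm) (.seq (.callOracle 21 23 22) (.seq (frobProg 22 29) (.seq (frobProg 20 30)
    (.seq (.setReal 24 (.lit 0) (.div (.sub (scal 29) (scal 30)) (.add (scal 29) (scal 30))))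
      (.setReal 31 (.lit 0) (.div (.mul (.mul (scal 23) (scal 25)) (scal 24))
        (.mul (.mul (.ofNat (.lit 4)) (.ofNat ordE)) (.add (scal 29) (scal 30)))))))))

def HeadNat (a : ℕ) : Prop := NatKept a ∧ a ≠ 23

def HeadReal (a : ℕ) : Prop :=
  RootKept a ∧ a ≠ 22 ∧ a ≠ 24 ∧ a ≠ 29 ∧ a ≠ 30 ∧ a ≠ 31

theorem iterHead_runs {mm : Program} {W : ℕ → ℝ} (hm : MulProg mm W)
    {f : SqMat n → Fin m × SqMat n} (hf : ∀ Y : SqMat n, Y.PosSemidef → P.IsArgmax Y (f Y))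
    {e : ℝ} {y : Weights n m} (hσ : RootEnv n K S (combine y) e σ) (hy : P.Good y) (he : 0 < e)
    (he2 : e ≤ 1 / 2) {M : ℕ} (hM : 64 * (n : ℝ) ^ 2 ≤ e ^ 3 * 2 ^ M) :
    Runs (oracleOf f) (iterHead mm) σ (900 * (M + 2) * (K + 1) * W (dbl K)) 1 fun σ' =>
      Keep HeadNat HeadReal σ σ' ∧ ∃ θ X ν p τ, IterData P e y θ X ν p τ ∧
        P.AlgIteration e y θ X ν ((1 - τ) • y + τ • Finsupp.single p 1) ∧
        σ'.real 25 0 = θ ∧ IsMat σ' 21 0 n X ∧ IsMat σ' 22 0 n p.2 ∧ σ'.nat 23 0 = p.1 ∧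
        σ'.real 24 0 = ν ∧ σ'.real 31 0 = τ := by
  have hn := hσ.mach.pos
  have hn' : (1 : ℝ) ≤ n := by exact_mod_cast hn
  have h2n : (n : ℝ) ≤ dbl K := by exact_mod_cast hσ.mach.le
  have hsq := hm.sq_le (dbl K) (dbl_pos K)
  have hF := hy.posDef
  have hδ : e ^ 3 / (32 * (n : ℝ)) < 1 := by
    rw [div_lt_one (by positivity)]
    have : e ^ 3 ≤ 1 := pow_le_one₀ he.le (by linarith)
    linarith
  refine (Runs.seq (K₁ := 0) (K₂ := 1) (rootProg_runs hm hσ hF he (by linarith) hM)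
    (N₂ := (1 + n * n) + (10 * (n * n) + (10 * (n * n) + (1 + 1)))) ?_).le ?_
  swap
  · have h1 : (n : ℝ) * n ≤ W (dbl K) := by nlinarith
    have h2 : (1 : ℝ) ≤ n * n := by nlinarith
    have h3 : (0 : ℝ) ≤ M := Nat.cast_nonneg M
    have h4 : (0 : ℝ) ≤ K := Nat.cast_nonneg K
    have h5 : (2 : ℝ) ≤ (M + 2) * (K + 1) := by nlinarith
    have h6 : 2 * W (dbl K) ≤ (M + 2) * (K + 1) * W (dbl K) := by
      apply mul_le_mul_of_nonneg_right h5; linarith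
    linarith
  rintro σ₁ ⟨k₁, hroot, hX₁⟩
  set θ := σ₁.real 25 0 with hθ
  set X := (e * θ / n) • (combine y - θ • (1 : SqMat n))⁻¹ with hX
  have hXpd : X.PosDef := hroot.posDef_smul_inv hF hn he hδ
  have hp := hf X hXpd.posSemidef
  set p := f X with hpdef
  have s₁ := hσ.keep k₁
  have hk₁ : Keep HeadNat HeadReal σ σ₁ := k₁.weaken (fun a h => h.1) fun a h => h.1
  refine Runs.seq (K₁ := 1) (K₂ := 0)
    (Q₁ := fun τ => τ = (σ₁.writeNat 23 0 p.1).writeMatrix n 22 p.2)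
    ⟨_, _, 1, Exec.callOracle σ₁ 21 23 22, ?_, le_rfl, ?_⟩ ?_
  · change ((1 + n * n : ℕ) : ℝ) ≤ _
    push_cast; exact le_rfl
  · have : (oracleOf f).answer (σ₁.matrix (oracleOf f).n 21 0) = ((p.1 : ℕ), p.2) := by
      change (((f (σ₁.matrix n 21 0)).1 : ℕ), (f (σ₁.matrix n 21 0)).2) = _
      rw [hX₁.matrix_eq]
    rw [this]
    rfl
  intro σ₂ hσ₂
  have k₂ : Keep HeadNat HeadReal σ₁ σ₂ := by
    rw [hσ₂]
    exact ⟨fun a ha => Function.update_of_ne ha.2 _ _,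
      fun a ha => Function.update_of_ne ha.2.1 _ _⟩
  have m₂ : IsMat σ₂ 22 0 n p.2 := by rw [hσ₂]; exact isMat_writeMatrix _ _ _
  have i₂ : σ₂.nat 23 0 = p.1 := by
    rw [hσ₂]; simp [Store.writeMatrix, Store.writeNat]
  have r₂ : ∀ a, a ≠ 22 → σ₂.real a = σ₁.real a := fun a ha => by
    rw [hσ₂]; exact Function.update_of_ne ha _ _
  clear hσ₂
  have hk₂ := hk₁.trans k₂
  have kk : ∀ {σ'}, Keep HeadNat HeadReal σ σ' → RootEnv n K S (combine y) e σ' := fun h =>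
    ⟨hσ.mach.keep' h (by norm_num [HeadNat, NatKept]) (by norm_num [HeadNat, NatKept])
      (by norm_num [HeadNat, NatKept]) (by norm_num [HeadNat, NatKept]),
      hσ.mat.congr (h.real 20 (by norm_num [HeadReal, RootKept])),
      by rw [h.real 23 (by norm_num [HeadReal, RootKept]), hσ.acc]⟩
  have X₂ : IsMat σ₂ 21 0 n X := hX₁.congr (r₂ 21 (by norm_num))
  refine Runs.seq (K₁ := 0) (K₂ := 0) (frobProg_runs (kk hk₂).mach m₂ X₂ (by norm_num)
    (by norm_num)) ?_
  rintro σ₃ ⟨a₃, v₃⟩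
  have hk₃ := hk₂.trans (a₃.keep (by norm_num [HeadNat, NatKept]) (by norm_num [HeadNat, NatKept])
    (by norm_num [HeadReal]))
  have X₃ : IsMat σ₃ 21 0 n X := X₂.congr (a₃.real 21 (by norm_num))
  refine Runs.seq (K₁ := 0) (K₂ := 0) (frobProg_runs (kk hk₃).mach (kk hk₃).mat X₃ (by norm_num)
    (by norm_num)) ?_
  rintro σ₄ ⟨a₄, v₄⟩
  have hk₄ := hk₃.trans (a₄.keep (by norm_num [HeadNat, NatKept]) (by norm_num [HeadNat, NatKept])
    (by norm_num [HeadReal]))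
  have w₄ : σ₄.real 29 0 = frob p.2 X := by rw [a₄.real 29 (by norm_num), v₃]
  refine Runs.seq (K₁ := 0) (K₂ := 0) (Runs.setScalar σ₄ 24 _) ?_
  rintro σ₅ ⟨v₅, n₅, r₅⟩
  simp only [RealExp.eval, eval_scal, w₄, v₄] at v₅
  have hk₅ := hk₄.trans (.scalar (by norm_num [HeadReal]) n₅ r₅)
  have hθ₅ : σ₅.real 25 0 = θ := by
    rw [r₅ 25 (by norm_num), a₄.real 25 (by norm_num), a₃.real 25 (by norm_num),
      r₂ 25 (by norm_num)]
  refine (Runs.setScalar σ₅ 31 _).mono le_rfl ?_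
  rintro σ₆ ⟨v₆, n₆, r₆⟩
  simp only [RealExp.eval, NatExp.eval, eval_scal, (kk hk₅).mach.eval_ordE, (kk hk₅).acc, hθ₅,
    r₅ 29 (by norm_num), r₅ 30 (by norm_num), w₄, v₄] at v₆
  have hk₆ := hk₅.trans (.scalar (by norm_num [HeadReal]) n₆ r₆)
  refine ⟨hk₆, θ, X, σ₅.real 24 0, p, σ₆.real 31 0, ?_, ?_, ?_, ?_, ?_, ?_, ?_, rfl⟩
  · exact iterData_of hn hy he he2 hroot hX hp v₅ (by rw [v₆]; norm_num)
  · exact ⟨hroot, hX, p, hp, v₅, _, by rw [v₆]; norm_num, rfl⟩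
  · rw [r₆ 25 (by norm_num), hθ₅]
  · exact X₃.congr (by rw [r₆ 21 (by norm_num), r₅ 21 (by norm_num), a₄.real 21 (by norm_num)])
  · exact m₂.congr (by rw [r₆ 22 (by norm_num), r₅ 22 (by norm_num), a₄.real 22 (by norm_num),
      a₃.real 22 (by norm_num)])
  · rw [n₆, n₅, a₄.nat 23 (by norm_num) (by norm_num), a₃.nat 23 (by norm_num) (by norm_num), i₂]
  · rw [r₆ 24 (by norm_num)]

def cntE : NatExp := .get 22 (.lit 0)

/-- Update the weights, the list of atoms and the matrix `F`. -/
def iterTail : Program :=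
  .seq (.setReal 35 (.lit 0) (scal 36))
    (.seq (.setReal 36 (.lit 0) (.mul (scal 36) (.sub (.ofNat (.lit 1)) (scal 31))))
      (.seq (.setReal 33 cntE (.div (scal 31) (scal 36)))
        (.seq (.setNat 3 cntE (.get 23 (.lit 0)))
          (.seq (fill ordE ordE 4 (.mul cntE (.mul ordE ordE)) ordE (rd 22 (.lit 0) ordE))
            (.seq (.setNat 22 (.lit 0) (.add cntE (.lit 1)))
              (.seq (fill ordE ordE 32 (.lit 0) ordE (.add (rd 20 (.lit 0) ordE)
                  (.mul (scal 31) (.sub (rd 22 (.lit 0) ordE) (rd 20 (.lit 0) ordE)))))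
                (fill ordE ordE 20 (.lit 0) ordE (rd 32 (.lit 0) ordE))))))))

def TailNat (a : ℕ) : Prop := a ≠ 20 ∧ a ≠ 21 ∧ a ≠ 3 ∧ a ≠ 22

def TailReal (a : ℕ) : Prop := a ≠ 35 ∧ a ≠ 36 ∧ a ≠ 33 ∧ a ≠ 4 ∧ a ≠ 32 ∧ a ≠ 20

/-- Weights are stored up to a common factor `c`, so scaling by `1 - τ` only changes `c`, and the
new atom gets the raw weight `τ / (c (1 - τ))`. The old factor, saved in array `35`, together with
one atom less still represents the previous weights, so nothing has to be copied. -/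
theorem iterTail_runs (hσ : Mach n K S σ) {A F : SqMat n} (hA : IsMat σ 22 0 n A)
    (hF : IsMat σ 20 0 n F) {τ c : ℝ} {k : ℕ} (hτ : σ.real 31 0 = τ) (hc : σ.real 36 0 = c)
    (hk : σ.nat 22 0 = k) :
    Runs 𝒪 iterTail σ (32 * (n * n)) 0 fun σ' => Keep TailNat TailReal σ σ' ∧
      σ'.real 35 0 = c ∧ σ'.real 36 0 = c * (1 - τ) ∧
      σ'.real 33 k = τ / (c * (1 - τ)) ∧ (∀ j, j ≠ k → σ'.real 33 j = σ.real 33 j) ∧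
      σ'.nat 3 k = σ.nat 23 0 ∧ (∀ j, j ≠ k → σ'.nat 3 j = σ.nat 3 j) ∧
      IsMat σ' 4 (k * (n * n)) n A ∧ (∀ j < k * (n * n), σ'.real 4 j = σ.real 4 j) ∧
      σ'.nat 22 0 = k + 1 ∧ IsMat σ' 20 0 n (F + τ • (A - F)) := by
  have hn := hσ.pos
  have h1n : (1 : ℝ) ≤ n := by exact_mod_cast hn
  have mk : ∀ {σ'}, Keep TailNat TailReal σ σ' → Mach n K S σ' := fun h => hσ.keep' h
    (by norm_num [TailNat]) (by norm_num [TailNat]) (by norm_num [TailNat]) (by norm_num [TailNat])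
  refine (Runs.seq (K₁ := 0) (K₂ := 0) (Runs.setScalar σ 35 _)
    (N₂ := 1 + (1 + (1 + (9 * (n * n) + (1 + (9 * (n * n) + 9 * (n * n))))))) ?_).le (by nlinarith)
  rintro σ₁ ⟨v₁, n₁, r₁⟩
  rw [eval_scal, hc] at v₁
  have k₁ : Keep TailNat TailReal σ σ₁ := .scalar (by norm_num [TailReal]) n₁ r₁
  refine Runs.seq (K₁ := 0) (K₂ := 0) (Runs.setScalar σ₁ 36 _) ?_
  rintro σ₂ ⟨v₂, n₂, r₂⟩
  simp only [RealExp.eval, NatExp.eval, eval_scal, r₁ 36 (by norm_num), r₁ 31 (by norm_num), hc,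
    hτ, Nat.cast_one] at v₂
  have k₂ := k₁.trans (.scalar (by norm_num [TailReal]) n₂ r₂)
  have hk₂ : cntE.eval σ₂ = k := by rw [cntE, NatExp.eval, n₂, n₁]; exact hk
  refine Runs.seq (K₁ := 0) (K₂ := 0)
    (Runs.setReal (Q := fun τ => τ = σ₂.writeReal 33 k (σ₂.real 31 0 / σ₂.real 36 0))
      (by rw [hk₂]; rfl)) ?_
  intro σ₃ e₃
  have n₃ : σ₃.nat = σ₂.nat := by rw [e₃]; rfl
  have r₃ : ∀ a, a ≠ 33 → σ₃.real a = σ₂.real a := fun a ha => by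
    rw [e₃]; exact Function.update_of_ne ha _ _
  have v₃ : σ₃.real 33 k = τ / (c * (1 - τ)) := by
    rw [e₃]
    simp only [Store.writeReal, Function.update_self, v₂]
    rw [r₂ 31 (by norm_num), r₁ 31 (by norm_num), hτ]
  have v₃' : ∀ j, j ≠ k → σ₃.real 33 j = σ.real 33 j := fun j hj => by
    rw [e₃]
    simp only [Store.writeReal, Function.update_self]
    rw [Function.update_of_ne hj, r₂ 33 (by norm_num), r₁ 33 (by norm_num)]
  clear e₃
  have k₃ := k₂.trans (.scalar (by norm_num [TailReal]) n₃ r₃)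
  have hk₃ : cntE.eval σ₃ = k := by rw [cntE, NatExp.eval, n₃, n₂, n₁]; exact hk
  refine Runs.seq (K₁ := 0) (K₂ := 0)
    (Runs.setNat (Q := fun τ => τ = σ₃.writeNat 3 k (σ₃.nat 23 0))
      (by rw [hk₃]; rfl)) ?_
  intro σ₄ e₄
  have r₄ : σ₄.real = σ₃.real := by rw [e₄]; rfl
  have n₄ : ∀ a, a ≠ 3 → σ₄.nat a = σ₃.nat a := fun a ha => by
    rw [e₄]; exact Function.update_of_ne ha _ _
  have v₄ : σ₄.nat 3 k = σ.nat 23 0 := by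
    rw [e₄]
    simp only [Store.writeNat, Function.update_self]
    rw [n₃, n₂, n₁]
  have v₄' : ∀ j, j ≠ k → σ₄.nat 3 j = σ.nat 3 j := fun j hj => by
    rw [e₄]
    simp only [Store.writeNat, Function.update_self]
    rw [Function.update_of_ne hj, n₃, n₂, n₁]
  clear e₄
  have k₄ : Keep TailNat TailReal σ σ₄ := k₃.trans ⟨fun a ha => n₄ a ha.2.2.1, fun a _ => by rw [r₄]⟩
  have A₄ : IsMat σ₄ 22 0 n A := hA.congr (k₄.real 22 (by norm_num [TailReal]))
  have c₄ : σ₄.nat 22 0 = k := by rw [n₄ 22 (by norm_num), n₃, n₂, n₁, hk]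
  refine Runs.seq (K₁ := 0) (K₂ := 0) (fill_mat_runs (off := k * (n * n)) (stride := n) A hn hn le_rfl
    (fun σ' h => ((mk k₄).agree h).eval_ordE) (fun σ' h => ((mk k₄).agree h).eval_ordE)
    (fun σ' h => ?_) (fun σ' h => ((mk k₄).agree h).eval_ordE)
    fun i j σ' h hi hj => ?_) ?_
  · rw [NatExp.eval, NatExp.eval, ((mk k₄).agree h).eval_ordE, cntE, NatExp.eval,
      h.nat 22 (by norm_num) (by norm_num)]
    rw [NatExp.eval, c₄]
  · rw [rd_eval hi hj, ((mk k₄).agree h).eval_ordE, h.real 22 (by norm_num)]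
    exact A₄ i j
  rintro σ₅ ⟨a₅, m₅, u₅⟩
  have k₅ := k₄.trans (a₅.keep (by norm_num [TailNat]) (by norm_num [TailNat])
    (by norm_num [TailReal]))
  refine Runs.seq (K₁ := 0) (K₂ := 0)
    (Runs.setNat (Q := fun τ => τ = σ₅.writeNat 22 0 (k + 1)) ?_) ?_
  · simp only [NatExp.eval, cntE, a₅.nat 22 (by norm_num) (by norm_num), c₄]
  intro σ₆ e₆
  have r₆ : σ₆.real = σ₅.real := by rw [e₆]; rfl
  have n₆ : ∀ a, a ≠ 22 → σ₆.nat a = σ₅.nat a := fun a ha => by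
    rw [e₆]; exact Function.update_of_ne ha _ _
  have v₆ : σ₆.nat 22 0 = k + 1 := by rw [e₆]; simp [Store.writeNat]
  clear e₆
  have k₆ : Keep TailNat TailReal σ σ₆ :=
    k₅.trans ⟨fun a ha => n₆ a ha.2.2.2, fun a _ => by rw [r₆]⟩
  have A₆ : IsMat σ₆ 22 0 n A := hA.congr (k₆.real 22 (by norm_num [TailReal]))
  have F₆ : IsMat σ₆ 20 0 n F := hF.congr (by
    rw [r₆, a₅.real 20 (by norm_num), r₄, r₃ 20 (by norm_num), r₂ 20 (by norm_num),
      r₁ 20 (by norm_num)])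
  have τ₆ : σ₆.real 31 0 = τ := by rw [k₆.real 31 (by norm_num [TailReal]), hτ]
  refine Runs.seq (K₁ := 0) (K₂ := 0) (fill_mat_runs (off := 0) (stride := n) (F + τ • (A - F)) hn hn
    le_rfl (fun σ' h => ((mk k₆).agree h).eval_ordE) (fun σ' h => ((mk k₆).agree h).eval_ordE)
    (fun σ' h => rfl) (fun σ' h => ((mk k₆).agree h).eval_ordE)
    fun i j σ' h hi hj => ?_) ?_
  · simp only [RealExp.eval, rd_eval hi hj, ((mk k₆).agree h).eval_ordE, eval_scal,
      h.real 22 (by norm_num : 22 ≠ 32), h.real 20 (by norm_num : 20 ≠ 32),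
      h.real 31 (by norm_num : 31 ≠ 32), NatExp.eval, A₆ i j, F₆ i j, τ₆]
    simp
  rintro σ₇ ⟨a₇, m₇, -⟩
  have k₇ := k₆.trans (a₇.keep (by norm_num [TailNat]) (by norm_num [TailNat])
    (by norm_num [TailReal]))
  refine (fill_mat_runs (off := 0) (stride := n) (F + τ • (A - F)) hn hn
    le_rfl (fun σ' h => ((mk k₇).agree h).eval_ordE) (fun σ' h => ((mk k₇).agree h).eval_ordE)
    (fun σ' h => rfl) (fun σ' h => ((mk k₇).agree h).eval_ordE)
    fun i j σ' h hi hj => ?_).mono le_rfl ?_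
  · rw [rd_eval hi hj, ((mk k₇).agree h).eval_ordE, h.real 32 (by norm_num)]
    exact m₇ i j
  rintro σ₈ ⟨a₈, m₈, -⟩
  have k₈ := k₇.trans (a₈.keep (by norm_num [TailNat]) (by norm_num [TailNat])
    (by norm_num [TailReal]))
  have back : ∀ a, a ≠ 20 → a ≠ 32 → σ₈.real a = σ₅.real a := fun a h1 h2 => by
    rw [a₈.real a h1, a₇.real a h2, r₆]
  have back' : ∀ a, a ≠ 20 → a ≠ 32 → a ≠ 4 → σ₈.real a = σ₃.real a := fun a h1 h2 h3 => by
    rw [back a h1 h2, a₅.real a h3, r₄]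
  have nback : ∀ a, a ≠ 20 → a ≠ 21 → σ₈.nat a = σ₆.nat a := fun a h1 h2 => by
    rw [a₈.nat a h1 h2, a₇.nat a h1 h2]
  refine ⟨k₈, ?_, ?_, ?_, fun j hj => ?_, ?_, fun j hj => ?_, ?_, fun j hj => ?_, ?_, m₈⟩
  · rw [back' 35 (by norm_num) (by norm_num) (by norm_num), r₃ 35 (by norm_num),
      r₂ 35 (by norm_num), v₁]
  · rw [back' 36 (by norm_num) (by norm_num) (by norm_num), r₃ 36 (by norm_num), v₂]
  · rw [back' 33 (by norm_num) (by norm_num) (by norm_num), v₃]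
  · rw [back' 33 (by norm_num) (by norm_num) (by norm_num), v₃' j hj]
  · rw [nback 3 (by norm_num) (by norm_num), n₆ 3 (by norm_num),
      a₅.nat 3 (by norm_num) (by norm_num), v₄]
  · rw [nback 3 (by norm_num) (by norm_num), n₆ 3 (by norm_num),
      a₅.nat 3 (by norm_num) (by norm_num), v₄' j hj]
  · exact m₅.congr (back 4 (by norm_num) (by norm_num))
  · rw [back 4 (by norm_num) (by norm_num), u₅ j fun i' j' => by rw [add_assoc]; omega, r₄,
      r₃ 4 (by norm_num), r₂ 4 (by norm_num), r₁ 4 (by norm_num)]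
  · rw [nback 22 (by norm_num) (by norm_num), v₆]

end RealRAM

/-! ### Machine representation of the states, main loop and output. -/

namespace RealRAM

open RobustSDP

variable {𝒪 : Oracle} {σ σ' : Store} {n m r K S : ℕ} {P : RobustSDP n m r} {ε : ℝ}

/-- The first `k` atoms with their weights, up to a common factor. -/
def atomSum (n : ℕ) (σ : Store) (idx : ℕ → Fin m) (k : ℕ) : Weights n m :=
  ∑ j ∈ Finset.range k, Finsupp.single (idx j, σ.matrix n 4 (j * (n * n))) (σ.real 33 j)

theorem atomSum_congr {idx idx' : ℕ → Fin m} {k : ℕ} (h1 : ∀ j < k, idx' j = idx j)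
    (h2 : ∀ j < k, σ'.real 33 j = σ.real 33 j)
    (h3 : ∀ c < k * (n * n), σ'.real 4 c = σ.real 4 c) :
    atomSum n σ' idx' k = atomSum n σ idx k := by
  refine Finset.sum_congr rfl fun j hj => ?_
  rw [Finset.mem_range] at hj
  rw [h1 j hj, h2 j hj]
  congr 2
  ext i l
  refine h3 _ ?_
  have h4 : (j + 1) * (n * n) ≤ k * (n * n) := Nat.mul_le_mul_right _ hj
  have h5 : (i + 1 : ℕ) * n ≤ n * n := Nat.mul_le_mul_right _ i.2
  have := l.2
  nlinarith

/-- The memory represents the state `q`, with `k` atoms. -/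
structure Rep (K S : ℕ) (ε : ℝ) (P : RobustSDP n m r) (q : AlgState n m) (k : ℕ) (σ : Store) :
    Prop where
  env : RootEnv n K S (combine q.y) (phaseEps q.s) σ
  eps : σ.real 0 0 = ε
  nu : σ.real 24 0 = q.ν
  cnt : σ.nat 22 0 = k
  factor_pos : 0 < σ.real 36 0
  atoms : ∃ idx : ℕ → Fin m, (∀ j < k, σ.nat 3 j = idx j) ∧
    q.y = σ.real 36 0 • atomSum n σ idx k ∧
    (q = P.algInit ∨ 0 < k ∧ q.yPrev = σ.real 35 0 • atomSum n σ idx (k - 1) ∧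
      IsMat σ 21 0 n q.X ∧ σ.real 25 0 = q.θ)

def phaseProg : Program :=
  .seq (.setReal 23 (.lit 0) (.div (scal 23) (.ofNat (.lit 2))))
    (.setReal 24 (.lit 0) (.ofNat (.lit 1)))

theorem Rep.nextPhase_runs {q : AlgState n m} {k : ℕ} (h : Rep K S ε P q k σ)
    (hν : q.ν ≤ phaseEps q.s) :
    Runs 𝒪 phaseProg σ 2 0
      (Rep K S ε P ⟨q.s + 1, 1, q.y, q.yPrev, q.θ, q.X⟩ k) := by
  refine (Runs.seq (K₁ := 0) (K₂ := 0) (Runs.setScalar σ 23 _)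
    fun σ₁ ⟨v₁, n₁, r₁⟩ => (Runs.setScalar σ₁ 24 _).mono le_rfl
      fun σ₂ ⟨v₂, n₂, r₂⟩ => ?_).le (by norm_num)
  have n₀ : σ₂.nat = σ.nat := by rw [n₂, n₁]
  have r₀ : ∀ a, a ≠ 23 → a ≠ 24 → σ₂.real a = σ.real a := fun a h1 h2 => by rw [r₂ a h2, r₁ a h1]
  obtain ⟨idx, hidx, hy, hprev⟩ := h.atoms
  have hs : ∀ j, atomSum n σ₂ idx j = atomSum n σ idx j := fun j => atomSum_congr (fun _ _ => rfl)
    (fun _ _ => by rw [r₀ 33 (by norm_num) (by norm_num)])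
    (fun _ _ => by rw [r₀ 4 (by norm_num) (by norm_num)])
  refine ⟨⟨h.env.mach.congr (by rw [n₀]) (by rw [n₀]) (by rw [n₀]) (by rw [n₀]),
    h.env.mat.congr (r₀ 20 (by norm_num) (by norm_num)), ?_⟩, ?_, ?_, ?_, ?_, idx, ?_, ?_, ?_⟩
  · rw [r₂ 23 (by norm_num), v₁, phaseEps_succ]
    simp [RealExp.eval, NatExp.eval, eval_scal, h.env.acc]
  · rw [r₀ 0 (by norm_num) (by norm_num), h.eps]
  · rw [v₂]; simp [RealExp.eval, NatExp.eval]
  · rw [n₀, h.cnt]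
  · rw [r₀ 36 (by norm_num) (by norm_num)]; exact h.factor_pos
  · rw [n₀]; exact hidx
  · rw [r₀ 36 (by norm_num) (by norm_num), hs]; exact hy
  · right
    rcases hprev with hq | ⟨h1, h2, h3, h4⟩
    -- The initial state has `ν = 1 > ε_0`, so no phase ends there and its placeholders are never
    -- carried over.
    · have := phaseEps_le q.s
      rw [hq] at hν this
      simp only [algInit] at hν this
      linarith
    · refine ⟨h1, ?_, h3.congr (r₀ 21 (by norm_num) (by norm_num)), ?_⟩
      · rw [r₀ 35 (by norm_num) (by norm_num), hs]; exact h2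
      · rw [r₀ 25 (by norm_num) (by norm_num)]; exact h4

theorem Rep.iteration_runs {mm : Program} {W : ℕ → ℝ} (hm : MulProg mm W)
    {f : SqMat n → Fin m × SqMat n} (hf : ∀ Y : SqMat n, Y.PosSemidef → P.IsArgmax Y (f Y))
    {q : AlgState n m} {k : ℕ} (h : Rep K S ε P q k σ) (hy : P.Good q.y)
    {M : ℕ} (hM : 64 * (n : ℝ) ^ 2 ≤ phaseEps q.s ^ 3 * 2 ^ M) :
    Runs (oracleOf f) (.seq (iterHead mm) iterTail) σ
      (900 * (M + 2) * (K + 1) * W (dbl K) + 32 * (n * n)) 1 fun σ' =>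
      ∃ θ X ν y', P.AlgIteration (phaseEps q.s) q.y θ X ν y' ∧
        Rep K S ε P ⟨q.s, ν, y', q.y, θ, X⟩ (k + 1) σ' := by
  refine Runs.seq (K₁ := 1) (K₂ := 0)
    (iterHead_runs hm hf h.env hy (phaseEps_pos _) (phaseEps_le _) hM) ?_
  rintro σ₁ ⟨k₁, θ, X, ν, p, τ, hd, hiter, hθ, hX, hA, hp, hν, hτ⟩
  have s₁ : Mach n K S σ₁ := h.env.mach.keep' k₁ (by norm_num [HeadNat, NatKept])
    (by norm_num [HeadNat, NatKept]) (by norm_num [HeadNat, NatKept])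
    (by norm_num [HeadNat, NatKept])
  refine (iterTail_runs s₁ hA (h.env.mat.congr (k₁.real 20 (by norm_num [HeadReal, RootKept]))) hτ
    (k₁.real 36 (by norm_num [HeadReal, RootKept]) ▸ rfl : σ₁.real 36 0 = σ.real 36 0)
    (k := k) (by rw [k₁.nat 22 (by norm_num [HeadNat, NatKept]), h.cnt])).mono le_rfl ?_
  rintro σ₂ ⟨k₂, c₂, c₂', w₂, w₂', i₂, i₂', m₂, m₂', n₂, F₂⟩
  refine ⟨θ, X, ν, _, hiter, ?_⟩
  obtain ⟨idx, hidx, hy', -⟩ := h.atoms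
  set c := σ.real 36 0 with hc
  have hc0 : 0 < c := h.factor_pos
  have hτ1 : 0 < 1 - τ := by linarith [hd.τ_lt]
  have hs : atomSum n σ₂ (Function.update idx k p.1) k = atomSum n σ idx k := by
    refine atomSum_congr (fun j hj => Function.update_of_ne hj.ne _ _) (fun j hj => ?_)
      fun j hj => ?_
    · rw [w₂' j hj.ne, k₁.real 33 (by norm_num [HeadReal, RootKept])]
    · rw [m₂' j hj, k₁.real 4 (by norm_num [HeadReal, RootKept])]
  refine ⟨⟨s₁.keep' k₂ (by norm_num [TailNat]) (by norm_num [TailNat]) (by norm_num [TailNat])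
    (by norm_num [TailNat]), ?_, ?_⟩, ?_, ?_, n₂, ?_, Function.update idx k p.1, fun j hj => ?_, ?_,
    Or.inr ⟨Nat.succ_pos k, ?_, ?_, ?_⟩⟩
  · rw [combine_convex]; exact F₂
  · rw [k₂.real 23 (by norm_num [TailReal]), k₁.real 23 (by norm_num [HeadReal, RootKept])]
    exact h.env.acc
  · rw [k₂.real 0 (by norm_num [TailReal]), k₁.real 0 (by norm_num [HeadReal, RootKept]), h.eps]
  · rw [k₂.real 24 (by norm_num [TailReal]), hν]
  · rw [c₂']; positivity
  · rcases Nat.lt_succ_iff_lt_or_eq.1 hj with hj | rfl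
    · rw [i₂' j hj.ne, Function.update_of_ne hj.ne, k₁.nat 3 (by norm_num [HeadNat, NatKept]),
        hidx j hj]
    · rw [i₂, hp, Function.update_self]
  -- Raw weight times new factor is `τ / (c (1 - τ)) · c (1 - τ) = τ`; this needs `τ < 1`.
  · change (1 - τ) • q.y + τ • Finsupp.single p 1 = _
    rw [atomSum, Finset.sum_range_succ, ← atomSum, hs, Function.update_self, m₂.matrix_eq, c₂', w₂,
      smul_add, hy', smul_smul, mul_comm (1 - τ), Finsupp.smul_single, Finsupp.smul_single]
    congr 2
    simp only [smul_eq_mul, mul_one]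
    field_simp
  · rw [Nat.add_sub_cancel, hs, c₂]; exact hy'
  · exact hX.congr (k₂.real 21 (by norm_num [TailReal]))
  · rw [k₂.real 25 (by norm_num [TailReal]), hθ]

def mainBody (mm : Program) : Program :=
  .ite (.realLt (scal 23) (scal 24)) (.seq (iterHead mm) iterTail) phaseProg

def mainTest : Test := .realLt (scal 0) (scal 23)

theorem Rep.mainBody_runs {mm : Program} {W : ℕ → ℝ} (hm : MulProg mm W)
    {f : SqMat n → Fin m × SqMat n} (hf : ∀ Y : SqMat n, Y.PosSemidef → P.IsArgmax Y (f Y))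
    {q : AlgState n m} {k : ℕ} (h : Rep K S ε P q k σ) (hy : P.Good q.y) (hε : 0 < ε)
    (hq : ε < phaseEps q.s) {M : ℕ} (hM : 64 * (n : ℝ) ^ 2 ≤ ε ^ 3 * 2 ^ M) :
    Runs (oracleOf f) (mainBody mm) σ (1000 * (M + 2) * (K + 1) * W (dbl K)) 1 fun σ' =>
      ∃ q' k', P.AlgStep ε q q' ∧ k' ≤ k + 1 ∧ Rep K S ε P q' k' σ' := by
  have hn1 : (1 : ℝ) ≤ n := by exact_mod_cast h.env.mach.pos
  have h2n : (n : ℝ) ≤ dbl K := by exact_mod_cast h.env.mach.le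
  have hsq := hm.sq_le (dbl K) (dbl_pos K)
  have h1 : (n : ℝ) * n ≤ W (dbl K) := by nlinarith
  have h2 : (1 : ℝ) ≤ n * n := by nlinarith
  have h3 : (0 : ℝ) ≤ M := Nat.cast_nonneg M
  have h4 : (0 : ℝ) ≤ K := Nat.cast_nonneg K
  have h5 : (2 : ℝ) ≤ (M + 2) * (K + 1) := by nlinarith
  have h6 : 2 * W (dbl K) ≤ (M + 2) * (K + 1) * W (dbl K) := by
    apply mul_le_mul_of_nonneg_right h5; linarith
  have key : (Test.realLt (scal 23) (scal 24)).Holds σ ↔ phaseEps q.s < q.ν := by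
    simp only [Test.Holds, eval_scal, h.env.acc, h.nu]
  by_cases hc : phaseEps q.s < q.ν
  · have hM' : 64 * (n : ℝ) ^ 2 ≤ phaseEps q.s ^ 3 * 2 ^ M :=
      hM.trans (by gcongr)
    refine (Runs.iteTrue (key.2 hc) (h.iteration_runs hm hf hy hM')).mono (by linarith) ?_
    rintro σ' ⟨θ, X, ν, y', h7, h8⟩
    exact ⟨_, _, .inner q θ X ν y' hq hc h7, le_rfl, h8⟩
  · rw [not_lt] at hc
    obtain ⟨σ', s, k', g1, g2, g3, g4⟩ :=
      Runs.iteFalse (c := .seq (iterHead mm) iterTail) (key.not.2 hc.not_gt)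
        (h.nextPhase_runs (𝒪 := oracleOf f) hc)
    refine ⟨σ', s, k', g1, g2.trans (by linarith), by omega, _, _, .nextPhase q hq hc,
      Nat.le_succ k, g4⟩

/-- The bound `T` for the length of all runs serves as fuel. Changes of phase add no atom, so the
number of atoms is only bounded by `r + t`. -/
theorem mainLoop_runs {mm : Program} {W : ℕ → ℝ} (hm : MulProg mm W)
    {f : SqMat n → Fin m × SqMat n} (hf : ∀ Y : SqMat n, Y.PosSemidef → P.IsArgmax Y (f Y))
    (hn : 0 < n) (hε : 0 < ε) {M T : ℕ} (hM : 64 * (n : ℝ) ^ 2 ≤ ε ^ 3 * 2 ^ M)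
    (hT : ∀ t q, RunOf P ε t q → t ≤ T) :
    ∀ (d t k : ℕ) (q : AlgState n m) (σ : Store), RunOf P ε t q → Rep K S ε P q k σ → T ≤ t + d →
      k ≤ r + t →
      Runs (oracleOf f) (.loop mainTest (mainBody mm)) σ
        (1 + d * (1000 * (M + 2) * (K + 1) * W (dbl K) + 1)) d fun σ' =>
        ∃ q' k', Relation.ReflTransGen (P.AlgStep ε) P.algInit q' ∧ phaseEps q'.s ≤ ε ∧
          k' ≤ r + T ∧ Rep K S ε P q' k' σ' := by
  intro d
  induction d with
  | zero =>
    intro t k q σ hrun h ht hk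
    by_cases hq : ε < phaseEps q.s
    -- With the fuel used up, one more round would produce a run longer than `T`.
    · obtain ⟨_, _, _, _, _, _, q', _, hstep, _⟩ :=
        h.mainBody_runs hm hf (hrun.runInv hn).1 hε hq hM
      have := hT _ _ (hrun.step hstep)
      omega
    · refine (Runs.loopFalse ?_ ⟨q, k, hrun.reachable, not_lt.1 hq, ?_, h⟩).le (by simp)
      · simpa only [mainTest, Test.Holds, eval_scal, h.env.acc, h.eps] using hq
      · have := hT _ _ hrun
        omega
  | succ d ih =>
    intro t k q σ hrun h ht hk
    have hT' := hT _ _ hrun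
    by_cases hq : ε < phaseEps q.s
    · have hb := h.mainBody_runs hm hf (hrun.runInv hn).1 hε hq hM
      obtain ⟨σ', s, c, g1, g2, g3, g4⟩ := Runs.loopTrue (b := mainTest)
        (by simpa only [mainTest, Test.Holds, eval_scal, h.env.acc, h.eps] using hq) hb
        (N₂ := 1 + d * (1000 * (M + 2) * (K + 1) * W (dbl K) + 1)) (K₂ := d)
        (fun σ₁ ⟨q', k', hstep, hk', h'⟩ => ih (t + 1) k' q' σ₁ (hrun.step hstep) h' (by omega)
          (by omega))
      refine ⟨σ', s, c, g1, g2.trans ?_, by omega, g4⟩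
      push_cast
      linarith
    · have hW : 0 ≤ W (dbl K) := (mul_self_nonneg _).trans (hm.sq_le (dbl K) (dbl_pos K))
      obtain ⟨σ', s, c, g1, g2, g3, g4⟩ := Runs.loopFalse (𝒪 := oracleOf f) (b := mainTest)
        (c := mainBody mm) (σ := σ) (Q := fun σ' =>
          ∃ q' k', Relation.ReflTransGen (P.AlgStep ε) P.algInit q' ∧ phaseEps q'.s ≤ ε ∧
          k' ≤ r + T ∧ Rep K S ε P q' k' σ')
        (by simpa only [mainTest, Test.Holds, eval_scal, h.env.acc, h.eps] using hq)
        ⟨q, k, hrun.reachable, not_lt.1 hq, by omega, h⟩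
      refine ⟨σ', s, c, g1, g2.trans ?_, by omega, g4⟩
      have : 0 ≤ ((d + 1 : ℕ) : ℝ) * (1000 * (M + 2) * (K + 1) * W (dbl K) + 1) := by positivity
      linarith

def outWeightLoop : Program :=
  forLoop 24 (.get 2 (.lit 0)) (.setReal 3 (.get 24 (.lit 0))
    (.div (.mul (scal 35) (.get 33 (.get 24 (.lit 0)))) (scal 25)))

/-- Write the output. -/
def outProg : Program :=
  .seq (fill ordE ordE 2 (.lit 0) ordE
    (.mul (.div (.sub (.ofNat (.lit 1)) (.mul (.ofNat (.lit 2)) (scal 23)))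
      (.mul (.mul (.add (.ofNat (.lit 1)) (.mul (.ofNat (.lit 2)) (scal 23)))
        (.add (.ofNat (.lit 1)) (.mul (.ofNat (.lit 2)) (scal 23)))) (scal 25)))
      (rd 21 (.lit 0) ordE)))
    (.seq (.setNat 2 (.lit 0) (.sub cntE (.lit 1))) outWeightLoop)

/-- The accuracy cell already holds the value of the phase that is not performed, hence the factor
`2` in the program; the atom added last is dropped because the returned weights precede the last
update. -/
theorem Rep.outProg_runs {q : AlgState n m} {k : ℕ} (h : Rep K S ε P q k σ)
    (hq : q.s ≠ 0) :
    Runs 𝒪 outProg σ (9 * (n * n) + 3 + 3 * k) 0 fun σ' =>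
      OutputIs σ' (((1 - phaseEps (q.s - 1)) / ((1 + phaseEps (q.s - 1)) ^ 2 * q.θ)) • q.X)
        ((1 / q.θ) • q.yPrev) := by
  obtain ⟨idx, hidx, -, hq' | ⟨hk, hprev, hX, hθ⟩⟩ := h.atoms
  · exact absurd (by rw [hq']; rfl) hq
  have hn := h.env.mach.pos
  have he : phaseEps (q.s - 1) = 2 * phaseEps q.s := by
    obtain ⟨s, hs⟩ := Nat.exists_eq_succ_of_ne_zero hq
    rw [hs, Nat.succ_sub_one, Nat.succ_eq_add_one, phaseEps_succ]; ring
  set X' := ((1 - phaseEps (q.s - 1)) / ((1 + phaseEps (q.s - 1)) ^ 2 * q.θ)) • q.X with hX'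
  have s₀ := h.env.mach
  refine (Runs.seq (K₁ := 0) (K₂ := 0) (fill_mat_runs (off := 0) (stride := n) X' hn hn le_rfl
    (fun σ' h => (s₀.agree h).eval_ordE) (fun σ' h => (s₀.agree h).eval_ordE) (fun _ _ => rfl)
    (fun σ' h => (s₀.agree h).eval_ordE) fun i j σ' g hi hj => ?_)
    (N₂ := 1 + (2 + ((k - 1 : ℕ) : ℝ) * (1 + 2))) ?_).le ?_
  · simp only [RealExp.eval, rd_eval hi hj, eval_scal, NatExp.eval, (s₀.agree g).eval_ordE,
      g.real 23 (by norm_num : 23 ≠ 2), g.real 25 (by norm_num : 25 ≠ 2),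
      g.real 21 (by norm_num : 21 ≠ 2), h.env.acc, hθ, hX i j, hX', he, Matrix.smul_apply,
      smul_eq_mul, Nat.cast_one, Nat.cast_ofNat, sq]
  swap
  · have : ((k - 1 : ℕ) : ℝ) ≤ k := by exact_mod_cast Nat.sub_le k 1
    linarith
  rintro σ₁ ⟨a₁, m₁, -⟩
  refine Runs.seq (K₁ := 0) (K₂ := 0)
    (Runs.setNat (Q := fun τ => τ = σ₁.writeNat 2 0 (k - 1)) ?_) ?_
  · simp only [NatExp.eval, cntE, a₁.nat 22 (by norm_num) (by norm_num), h.cnt]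
  intro σ₂ e₂
  have r₂ : σ₂.real = σ₁.real := by rw [e₂]; rfl
  have n₂ : ∀ a, a ≠ 2 → σ₂.nat a = σ₁.nat a := fun a ha => by
    rw [e₂]; exact Function.update_of_ne ha _ _
  have v₂ : σ₂.nat 2 0 = k - 1 := by rw [e₂]; simp [Store.writeNat]
  clear e₂
  let I : ℕ → Store → Prop := fun j τ => (∀ a, a ≠ 24 → τ.nat a = σ₂.nat a) ∧
    (∀ a, a ≠ 3 → τ.real a = σ₂.real a) ∧
    ∀ i < j, τ.real 3 i = σ.real 35 0 * σ.real 33 i / q.θ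
  have r₀ : ∀ a, a ≠ 2 → a ≠ 3 → ∀ j τ, I j τ → τ.real a = σ.real a := fun a h1 h2 j τ hI => by
    rw [hI.2.1 a h2, r₂, a₁.real a h1]
  refine (forLoop_runs (B := 1) (R := k - 1) (I := I)
    ⟨fun a ha => Function.update_of_ne ha _ _, fun _ _ => rfl, fun _ h => absurd h (by omega)⟩
    (fun j τ hI => by rw [NatExp.eval, hI.1 2 (by norm_num)]; exact v₂) ?_).mono le_rfl ?_
  · intro j hj τ hI hc
    refine Runs.setReal ⟨?_, ?_, ?_, ?_⟩
    · exact hc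
    · intro a ha
      exact (Function.update_of_ne ha _ _).trans (hI.1 a ha)
    · intro a ha
      exact (Function.update_of_ne ha _ _).trans (hI.2.1 a ha)
    · intro i hi
      simp only [RealExp.eval, NatExp.eval, eval_scal, hc, r₀ 35 (by norm_num) (by norm_num) j τ hI,
        r₀ 33 (by norm_num) (by norm_num) j τ hI, r₀ 25 (by norm_num) (by norm_num) j τ hI, hθ,
        Store.writeNat, Store.writeReal, Function.update_self]
      rcases Nat.lt_succ_iff_lt_or_eq.1 hi with hi | rfl
      · rw [Function.update_of_ne hi.ne]; exact hI.2.2 i hi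
      · rw [Function.update_self]
  · intro σ₃ hI
    have n₃ : σ₃.nat 2 0 = k - 1 := by rw [hI.1 2 (by norm_num), v₂]
    have n₃' : σ₃.nat 3 = σ.nat 3 := by
      rw [hI.1 3 (by norm_num), n₂ 3 (by norm_num), a₁.nat 3 (by norm_num) (by norm_num)]
    refine ⟨(IsMat.matrix_eq (m₁.congr (by rw [hI.2.1 2 (by norm_num), r₂]))).symm,
      fun j => idx j, fun j => ?_, ?_⟩
    · rw [n₃']
      exact hidx j (by have := j.2; omega)
    · rw [hprev, atomSum, Fin.sum_univ_eq_sum_range (fun j =>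
        Finsupp.single (idx j, σ₃.matrix n 4 (j * (n * n))) (σ₃.real 3 j)), n₃, smul_smul,
        Finset.smul_sum]
      refine Finset.sum_congr rfl fun j hj => ?_
      rw [Finset.mem_range] at hj
      rw [hI.2.2 j hj, Finsupp.smul_single, Store.matrix, Store.matrix,
        r₀ 4 (by norm_num) (by norm_num) _ _ hI]
      congr 1
      rw [smul_eq_mul]; ring

end RealRAM

/-! ### Preparation: powers of two and the initial state. -/

namespace RealRAM

open RobustSDP

variable {𝒪 : Oracle} {σ σ' : Store} {n m r K S : ℕ} {P : RobustSDP n m r} {ε : ℝ}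

/-- Compute the powers of two up to the order of the matrices. -/
def levelsProg : Program :=
  .seq (.setNat 13 (.lit 0) (.lit 1))
    (.seq (.loop (.natLt padE ordE)
      (.seq (.setNat 13 (.add (.get 14 (.lit 0)) (.lit 1)) (.add padE padE))
        (.setNat 14 (.lit 0) (.add (.get 14 (.lit 0)) (.lit 1)))))
      (.setNat 15 (.lit 0) (.mul padE padE)))

/-- `K` is the least level with `n ≤ dbl K`; its minimality makes the doubling loop stop exactly
there. -/
theorem levelsProg_runs (h0 : σ.nat 0 0 = n) (hn : 0 < n) (h14 : σ.nat 14 0 = 0)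
    (hK : n ≤ dbl K) (hK' : ∀ l < K, dbl l < n) :
    Runs 𝒪 levelsProg σ (3 + 3 * K) 0 fun σ' => Mach n K (dbl K * dbl K) σ' ∧
      σ'.real = σ.real ∧ ∀ a, a ≠ 13 → a ≠ 14 → a ≠ 15 → σ'.nat a = σ.nat a := by
  let J : ℕ → Store → Prop := fun l τ => τ.nat 14 0 = l ∧ (∀ i ≤ l, τ.nat 13 i = dbl i) ∧
    τ.real = σ.real ∧ ∀ a, a ≠ 13 → a ≠ 14 → τ.nat a = σ.nat a
  have hpad : ∀ l τ, J l τ → padE.eval τ = dbl l := fun l τ h => by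
    rw [padE, NatExp.eval, NatExp.eval, NatExp.eval, h.1, h.2.1 l le_rfl]
  have hord : ∀ l τ, J l τ → ordE.eval τ = n := fun l τ h => by
    rw [ordE, NatExp.eval, NatExp.eval, h.2.2.2 0 (by norm_num) (by norm_num), h0]
  have key : ∀ d l τ, l + d = K → J l τ → Runs 𝒪 (.loop (.natLt padE ordE)
      (.seq (.setNat 13 (.add (.get 14 (.lit 0)) (.lit 1)) (.add padE padE))
        (.setNat 14 (.lit 0) (.add (.get 14 (.lit 0)) (.lit 1))))) τ (1 + 3 * d) 0 (J K) := by
    intro d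
    induction d with
    | zero =>
      intro l τ hl hJ
      obtain rfl : l = K := by omega
      exact (Runs.loopFalse (by rw [Test.Holds, hpad l τ hJ, hord l τ hJ]; omega) hJ).le (by simp)
    | succ d ih =>
      intro l τ hl hJ
      refine (Runs.loopTrue (K₁ := 0) (K₂ := 0) (N₁ := 1 + 1) (N₂ := 1 + 3 * d) (Q₁ := J (l + 1))
        ?_ (Runs.seq (K₁ := 0) (K₂ := 0)
          (Runs.setNat (Q := fun τ' => τ' = τ.writeNat 13 (l + 1) (dbl (l + 1))) ?_) ?_)
        fun τ' h' => ih (l + 1) τ' (by omega) h').le (by push_cast; linarith)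
      · rw [Test.Holds, hpad l τ hJ, hord l τ hJ]; exact hK' l (by omega)
      · simp only [NatExp.eval, hpad l τ hJ, hJ.1, dbl]
      · intro τ' e'
        refine Runs.setNat ?_
        have h14' : τ'.nat 14 0 = l := by rw [e']; exact hJ.1
        simp only [NatExp.eval, h14']
        refine ⟨by simp [Store.writeNat], fun i hi => ?_, by rw [e']; exact hJ.2.2.1,
          fun a h1 h2 => ?_⟩
        · rw [e']
          simp only [Store.writeNat]
          rw [Function.update_of_ne (by norm_num), Function.update_self]
          rcases Nat.le_succ_iff.1 hi with hi | rfl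
          · rw [Function.update_of_ne (by omega)]; exact hJ.2.1 i hi
          · rw [Function.update_self]
        · rw [e']
          simp only [Store.writeNat]
          rw [Function.update_of_ne h2, Function.update_of_ne h1]
          exact hJ.2.2.2 a h1 h2
  refine (Runs.seq (K₁ := 0) (K₂ := 0)
    (Runs.setNat (Q := fun τ => τ = σ.writeNat 13 0 1) rfl) (N₂ := (1 + 3 * K) + 1) ?_).le
    (by linarith)
  intro σ₁ e₁
  refine Runs.seq (K₁ := 0) (K₂ := 0) (key K 0 σ₁ (by omega) ?_) fun τ hτ => Runs.setNat ?_
  · rw [e₁]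
    refine ⟨h14, fun i hi => ?_, rfl, fun a h1 _ => Function.update_of_ne h1 _ _⟩
    obtain rfl : i = 0 := by omega
    simp [Store.writeNat, dbl]
  · simp only [NatExp.eval, hpad K τ hτ]
    exact ⟨⟨hord K τ hτ, hn, hτ.1, by simp [Store.writeNat], hτ.2.1, le_rfl, hK⟩, hτ.2.2.1,
      fun a h1 h2 h3 => (Function.update_of_ne h3 _ _).trans (hτ.2.2.2 a h1 h2)⟩

def startE : NatExp := .get 0 (.lit 1)

def ctrE : NatExp := .get 24 (.lit 0)

/-- Accumulate the combination of the starting matrices. -/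
def startSum : Program :=
  forLoop 24 startE
    (.seq (fill ordE ordE 32 (.lit 0) ordE (.add (rd 20 (.lit 0) ordE)
        (.div (rd 1 (.mul ctrE (.mul ordE ordE)) ordE) (.ofNat startE))))
      (fill ordE ordE 20 (.lit 0) ordE (rd 32 (.lit 0) ordE)))

/-- The starting data in memory. -/
structure StartMem (ε : ℝ) (P : RobustSDP n m r) (σ : Store) : Prop where
  card : σ.nat 0 1 = r
  idx : ∀ j : Fin r, σ.nat 1 j = P.startIdx j
  mat : ∀ j : Fin r, IsMat σ 1 (j * (n * n)) n (P.start j)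
  eps : σ.real 0 0 = ε
  zero : IsMat σ 20 0 n (0 : SqMat n)

def InitNat (a : ℕ) : Prop := a ≠ 3 ∧ a ≠ 20 ∧ a ≠ 21 ∧ a ≠ 22 ∧ a ≠ 24

def SumReal (a : ℕ) : Prop := a ≠ 20 ∧ a ≠ 32

theorem startSum_runs (hσ : Mach n K S σ) (h : StartMem ε P σ) :
    Runs 𝒪 startSum σ (2 + r * (18 * (n * n) + 2)) 0 fun σ' =>
      (∀ a, a ≠ 20 → a ≠ 21 → a ≠ 24 → σ'.nat a = σ.nat a) ∧
      (∀ a, SumReal a → σ'.real a = σ.real a) ∧ IsMat σ' 20 0 n (combine P.initWeights) := by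
  have hn := hσ.pos
  let A : ℕ → SqMat n := fun j => if h : j < r then P.start ⟨j, h⟩ else 0
  let I : ℕ → Store → Prop := fun j τ => (∀ a, a ≠ 20 → a ≠ 21 → a ≠ 24 → τ.nat a = σ.nat a) ∧
    (∀ a, SumReal a → τ.real a = σ.real a) ∧
    IsMat τ 20 0 n (∑ i ∈ Finset.range j, (1 / (r : ℝ)) • A i)
  have mI : ∀ j τ, I j τ → Mach n K S τ := fun j τ hI => hσ.congr
    (hI.1 _ (by norm_num) (by norm_num) (by norm_num))
    (hI.1 _ (by norm_num) (by norm_num) (by norm_num))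
    (hI.1 _ (by norm_num) (by norm_num) (by norm_num))
    (hI.1 _ (by norm_num) (by norm_num) (by norm_num))
  have hr : ∀ j τ, I j τ → startE.eval τ = r := fun j τ hI => by
    rw [startE, NatExp.eval, NatExp.eval, hI.1 0 (by norm_num) (by norm_num) (by norm_num), h.card]
  refine (forLoop_runs (B := 18 * (n * n)) (R := r) (I := I) ⟨?_, fun _ _ => rfl, ?_⟩ hr ?_).mono
    le_rfl ?_
  · exact fun a _ _ h3 => Function.update_of_ne h3 _ _
  · rw [Finset.sum_range_zero]
    exact h.zero.congr rfl
  · intro j hj τ hI hc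
    have hτ := mI j τ hI
    refine (Runs.seq (K₁ := 0) (K₂ := 0) (fill_mat_runs (off := 0) (stride := n)
      (∑ i ∈ Finset.range (j + 1), (1 / (r : ℝ)) • A i) hn hn le_rfl
      (fun σ' h => (hτ.agree h).eval_ordE) (fun σ' h => (hτ.agree h).eval_ordE) (fun _ _ => rfl)
      (fun σ' h => (hτ.agree h).eval_ordE) fun i l σ' g hi hl => ?_)
      (N₂ := 9 * (n * n)) ?_).le (by linarith)
    · have e1 : startE.eval σ' = r := by
        rw [← hr j τ hI, startE, NatExp.eval, NatExp.eval, g.nat 0 (by norm_num) (by norm_num)]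
        rfl
      have e2 : ctrE.eval σ' = j := by
        rw [ctrE, NatExp.eval, NatExp.eval, g.nat 24 (by norm_num) (by norm_num), hc]
      have e3 := h.mat ⟨j, hj⟩ i l
      simp only [RealExp.eval, rd_eval hi hl, NatExp.eval, (hτ.agree g).eval_ordE,
        g.real 20 (by norm_num : 20 ≠ 32), g.real 1 (by norm_num : 1 ≠ 32), e1, e2, hI.2.2 i l,
        hI.2.1 1 (by norm_num [SumReal]), e3]
      rw [Finset.sum_range_succ]
      simp only [A, dif_pos hj, Matrix.add_apply, Matrix.smul_apply, smul_eq_mul]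
      ring
    · rintro τ₁ ⟨a₁, m₁, -⟩
      have h₁ := hτ.agree a₁
      refine (fill_mat_runs (off := 0) (stride := n)
        (∑ i ∈ Finset.range (j + 1), (1 / (r : ℝ)) • A i) hn hn le_rfl
        (fun σ' h => (h₁.agree h).eval_ordE) (fun σ' h => (h₁.agree h).eval_ordE) (fun _ _ => rfl)
        (fun σ' h => (h₁.agree h).eval_ordE) fun i l σ' g hi hl => ?_).mono le_rfl ?_
      · rw [rd_eval hi hl, (h₁.agree g).eval_ordE, g.real 32 (by norm_num)]
        exact m₁ i l
      · rintro τ₂ ⟨a₂, m₂, -⟩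
        refine ⟨?_, fun a h1 h2 h3 => ?_, fun a ha => ?_, m₂⟩
        · rw [a₂.nat 24 (by norm_num) (by norm_num), a₁.nat 24 (by norm_num) (by norm_num), hc]
        · refine (Function.update_of_ne h3 _ _).trans ?_
          rw [a₂.nat a h1 h2, a₁.nat a h1 h2, hI.1 a h1 h2 h3]
        · exact (a₂.real a ha.1).trans ((a₁.real a ha.2).trans (hI.2.1 a ha))
  · rintro σ' ⟨h1, h2, h3⟩
    refine ⟨h1, h2, ?_⟩
    rw [combine_initWeights, Finset.smul_sum]
    rw [← Fin.sum_univ_eq_sum_range fun i => (1 / (r : ℝ)) • A i] at h3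
    simpa [A] using h3

def startIdxLoop : Program := forLoop 24 startE (.setNat 3 ctrE (.get 1 ctrE))

theorem startIdxLoop_runs (h : StartMem ε P σ) :
    Runs 𝒪 startIdxLoop σ (2 + r * (1 + 2)) 0 fun σ' =>
      (∀ a, a ≠ 24 → a ≠ 3 → σ'.nat a = σ.nat a) ∧ σ'.real = σ.real ∧
      ∀ j : Fin r, σ'.nat 3 j = P.startIdx j := by
  let I : ℕ → Store → Prop := fun j τ => (∀ a, a ≠ 24 → a ≠ 3 → τ.nat a = σ.nat a) ∧
    τ.real = σ.real ∧ ∀ i : Fin r, (i : ℕ) < j → τ.nat 3 i = P.startIdx i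
  have hr : ∀ j τ, I j τ → startE.eval τ = r := fun j τ hI => by
    rw [startE, NatExp.eval, NatExp.eval, hI.1 0 (by norm_num) (by norm_num), h.card]
  refine (forLoop_runs (B := 1) (R := r) (I := I)
    ⟨fun a h1 _ => Function.update_of_ne h1 _ _, rfl, fun i hi => absurd hi (by omega)⟩ hr ?_).mono
    le_rfl fun σ' hI => ⟨hI.1, hI.2.1, fun j => hI.2.2 j j.2⟩
  intro j hj τ hI hc
  refine Runs.setNat ⟨hc, fun a h1 h2 => ?_, hI.2.1, fun i hi => ?_⟩
  · exact (Function.update_of_ne h1 _ _).trans ((Function.update_of_ne h2 _ _).trans (hI.1 a h1 h2))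
  · simp only [Store.writeNat, ctrE, NatExp.eval, hc, hI.1 1 (by norm_num) (by norm_num)]
    rw [Function.update_of_ne (by norm_num), Function.update_self]
    rcases Nat.lt_succ_iff_lt_or_eq.1 hi with hi | hi
    · rw [Function.update_of_ne hi.ne]; exact hI.2.2 i hi
    · rw [hi, Function.update_self, ← h.idx i, hi]

/-- Set up the initial state. -/
def initProg : Program :=
  .seq (fill startE (.mul ordE ordE) 4 (.lit 0) (.mul ordE ordE) (rd 1 (.lit 0) (.mul ordE ordE)))
    (.seq (fill (.lit 1) startE 33 (.lit 0) startE (.ofNat (.lit 1)))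
      (.seq startIdxLoop (.seq startSum
        (.seq (.setReal 36 (.lit 0) (.div (.ofNat (.lit 1)) (.ofNat startE)))
          (.seq (.setNat 22 (.lit 0) startE)
            (.seq (.setReal 23 (.lit 0) (.div (.ofNat (.lit 1)) (.ofNat (.lit 2))))
              (.setReal 24 (.lit 0) (.ofNat (.lit 1)))))))))

theorem StartMem.of_eq (h : StartMem ε P σ) (h0 : σ'.nat 0 = σ.nat 0) (h1 : σ'.nat 1 = σ.nat 1)
    (h2 : σ'.real 0 = σ.real 0) (h3 : σ'.real 1 = σ.real 1) (h4 : σ'.real 20 = σ.real 20) :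
    StartMem ε P σ' :=
  ⟨by rw [h0, h.card], fun j => by rw [h1, h.idx], fun j => (h.mat j).congr h3, by rw [h2, h.eps],
    h.zero.congr h4⟩

theorem initProg_runs (hσ : Mach n K S σ) (h : StartMem ε P σ) :
    Runs 𝒪 initProg σ (50 * (r * n ^ 2)) 0 (Rep K S ε P P.algInit r) := by
  have hn := hσ.pos
  have hr0 := P.pos_of_start hn
  have hr1 : (1 : ℝ) ≤ r := by exact_mod_cast hr0
  have hn1 : (1 : ℝ) ≤ n := by exact_mod_cast hn
  have eS : ∀ τ, τ.nat 0 = σ.nat 0 → startE.eval τ = r := fun τ hτ => by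
    rw [startE, NatExp.eval, NatExp.eval, hτ, h.card]
  have eN : ∀ τ, τ.nat 0 = σ.nat 0 → (NatExp.mul ordE ordE).eval τ = n * n := fun τ hτ => by
    rw [NatExp.eval, ordE, NatExp.eval, NatExp.eval, hτ, hσ.order]
  -- The starting matrices are copied as one `r × n²` table and become the first `r` atoms, with raw
  -- weights `1` and common factor `1 / r`.
  refine (Runs.seq (K₁ := 0) (K₂ := 0) (fill_runs (R := r) (C := n * n) (off := 0) (stride := n * n)
    (fun i j => σ.real 1 (i * (n * n) + j)) hr0 (Nat.mul_pos hn hn) le_rfl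
    (fun τ g => eS τ (g.nat 0 (by norm_num) (by norm_num)))
    (fun τ g => eN τ (g.nat 0 (by norm_num) (by norm_num))) (fun _ _ => rfl)
    (fun τ g => eN τ (g.nat 0 (by norm_num) (by norm_num))) fun i _ j _ τ g hi hj => ?_)
    (N₂ := 9 * ((1 : ℕ) * r) + ((2 + r * (1 + 2)) + ((2 + r * (18 * (n * n) + 2)) +
      (1 + (1 + (1 + 1)))))) ?_).le ?_
  · rw [rd_eval hi hj, eN τ (g.nat 0 (by norm_num) (by norm_num)), g.real 1 (by norm_num),
      NatExp.eval, zero_add]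
  swap
  · push_cast
    have h1 : (1 : ℝ) ≤ (n : ℝ) * n := by nlinarith
    have h2 : (r : ℝ) * 1 ≤ r * (n * n) := mul_le_mul_of_nonneg_left h1 (by linarith)
    nlinarith
  rintro σ₁ ⟨a₁, m₁, -⟩
  refine Runs.seq (K₁ := 0) (K₂ := 0) (fill_runs (R := 1) (C := r) (off := 0) (stride := r)
    (fun _ _ => 1) one_pos hr0 le_rfl (fun _ _ => rfl)
    (fun τ g => eS τ ((g.nat 0 (by norm_num) (by norm_num)).trans
      (a₁.nat 0 (by norm_num) (by norm_num)))) (fun _ _ => rfl)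
    (fun τ g => eS τ ((g.nat 0 (by norm_num) (by norm_num)).trans
      (a₁.nat 0 (by norm_num) (by norm_num)))) fun i _ j _ τ g hi hj => ?_) ?_
  · simp [RealExp.eval, NatExp.eval]
  rintro σ₂ ⟨a₂, m₂, -⟩
  have n₂ : ∀ a, a ≠ 20 → a ≠ 21 → σ₂.nat a = σ.nat a := fun a h1 h2 => by
    rw [a₂.nat a h1 h2, a₁.nat a h1 h2]
  have r₂ : ∀ a, a ≠ 4 → a ≠ 33 → σ₂.real a = σ.real a := fun a h1 h2 => by
    rw [a₂.real a h2, a₁.real a h1]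
  have h₂ : StartMem ε P σ₂ := h.of_eq (n₂ _ (by norm_num) (by norm_num))
    (n₂ _ (by norm_num) (by norm_num)) (r₂ _ (by norm_num) (by norm_num))
    (r₂ _ (by norm_num) (by norm_num)) (r₂ _ (by norm_num) (by norm_num))
  refine Runs.seq (K₁ := 0) (K₂ := 0) (startIdxLoop_runs h₂) ?_
  rintro σ₃ ⟨n₃, r₃, i₃⟩
  have h₃ : StartMem ε P σ₃ := h₂.of_eq (n₃ _ (by norm_num) (by norm_num))
    (n₃ _ (by norm_num) (by norm_num)) (by rw [r₃]) (by rw [r₃]) (by rw [r₃])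
  have mach : ∀ τ, (∀ a, InitNat a → τ.nat a = σ.nat a) → Mach n K S τ := fun τ g => hσ.congr
    (g _ (by norm_num [InitNat])) (g _ (by norm_num [InitNat])) (g _ (by norm_num [InitNat]))
    (g _ (by norm_num [InitNat]))
  have n₃' : ∀ a, InitNat a → σ₃.nat a = σ.nat a := fun a ha => by
    rw [n₃ a ha.2.2.2.2 ha.1, n₂ a ha.2.1 ha.2.2.1]
  refine Runs.seq (K₁ := 0) (K₂ := 0) (startSum_runs (mach σ₃ n₃') h₃) ?_
  rintro σ₄ ⟨n₄, r₄, F₄⟩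
  have n₄' : ∀ a, InitNat a → σ₄.nat a = σ.nat a := fun a ha => by
    rw [n₄ a ha.2.1 ha.2.2.1 ha.2.2.2.2, n₃' a ha]
  refine Runs.seq (K₁ := 0) (K₂ := 0) (Runs.setScalar σ₄ 36 _) ?_
  rintro σ₅ ⟨v₅, n₅, r₅⟩
  have e₅ : startE.eval σ₅ = r := eS σ₅ (by rw [n₅]; exact n₄' 0 (by norm_num [InitNat]))
  have v₅' : σ₅.real 36 0 = 1 / r := by
    rw [v₅]
    simp only [RealExp.eval, NatExp.eval, eS σ₄ (n₄' 0 (by norm_num [InitNat])), Nat.cast_one]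
  refine Runs.seq (K₁ := 0) (K₂ := 0) (Runs.setNat (Q := fun τ => τ = σ₅.writeNat 22 0 r)
    (by rw [e₅]; rfl)) ?_
  intro σ₆ e₆
  have r₆ : σ₆.real = σ₅.real := by rw [e₆]; rfl
  have n₆ : ∀ a, a ≠ 22 → σ₆.nat a = σ₄.nat a := fun a ha => by
    rw [e₆, ← n₅]; exact Function.update_of_ne ha _ _
  have v₆ : σ₆.nat 22 0 = r := by rw [e₆]; simp [Store.writeNat]
  clear e₆
  refine Runs.seq (K₁ := 0) (K₂ := 0) (Runs.setScalar σ₆ 23 _) ?_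
  rintro σ₇ ⟨v₇, n₇, r₇⟩
  refine (Runs.setScalar σ₇ 24 _).mono le_rfl ?_
  rintro σ₈ ⟨v₈, n₈, r₈⟩
  have n₈' : σ₈.nat = σ₆.nat := by rw [n₈, n₇]
  have nback : ∀ a, InitNat a → σ₈.nat a = σ.nat a := fun a ha => by
    rw [n₈', n₆ a ha.2.2.2.1, n₄' a ha]
  have rb₄ : ∀ a, a ≠ 23 → a ≠ 24 → a ≠ 36 → σ₈.real a = σ₄.real a := fun a h1 h2 h3 => by
    rw [r₈ a h2, r₇ a h1, r₆, r₅ a h3]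
  have rb₂ : ∀ a, a ≠ 23 → a ≠ 24 → a ≠ 36 → SumReal a → σ₈.real a = σ₂.real a :=
    fun a h1 h2 h3 h4 => by rw [rb₄ a h1 h2 h3, r₄ a h4, r₃]
  refine ⟨⟨mach σ₈ nback, F₄.congr (rb₄ 20 (by norm_num) (by norm_num) (by norm_num)), ?_⟩, ?_, ?_,
    ?_, ?_, fun j => if h : j < r then P.startIdx ⟨j, h⟩ else P.startIdx ⟨0, hr0⟩, ?_, ?_, Or.inl rfl⟩
  · rw [r₈ 23 (by norm_num), v₇]
    simp [RealExp.eval, NatExp.eval, algInit, phaseEps]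
  · rw [rb₂ 0 (by norm_num) (by norm_num) (by norm_num) (by norm_num [SumReal]),
      r₂ 0 (by norm_num) (by norm_num), h.eps]
  · rw [v₈]; simp [RealExp.eval, NatExp.eval, algInit]
  · rw [n₈', v₆]
  · rw [r₈ 36 (by norm_num), r₇ 36 (by norm_num), r₆, v₅']; positivity
  · intro j hj
    simp only [dif_pos hj]
    rw [n₈', n₆ 3 (by norm_num), n₄ 3 (by norm_num) (by norm_num) (by norm_num)]
    exact i₃ ⟨j, hj⟩
  · rw [r₈ 36 (by norm_num), r₇ 36 (by norm_num), r₆, v₅', atomSum, ← Fin.sum_univ_eq_sum_range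
      (fun j => Finsupp.single ((if h : j < r then P.startIdx ⟨j, h⟩ else P.startIdx ⟨0, hr0⟩),
        σ₈.matrix n 4 (j * (n * n))) (σ₈.real 33 j)), Finset.smul_sum]
    change P.initWeights = _
    rw [initWeights]
    refine Finset.sum_congr rfl fun j _ => ?_
    have h33 : σ₈.real 33 j = 1 := by
      rw [rb₂ 33 (by norm_num) (by norm_num) (by norm_num) (by norm_num [SumReal])]
      simpa using m₂ 0 one_pos j j.2
    have h4 : σ₈.matrix n 4 (j * (n * n)) = P.start j := by
      refine IsMat.matrix_eq fun i l => ?_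
      have hlt : (i : ℕ) * n + l < n * n := by nlinarith [i.2, l.2]
      have := m₁ j j.2 _ hlt
      rw [zero_add, ← add_assoc] at this
      rw [rb₂ 4 (by norm_num) (by norm_num) (by norm_num) (by norm_num [SumReal]),
        a₂.real 4 (by norm_num), this]
      exact h.mat j i l
    rw [h33, h4, dif_pos j.2, Finsupp.smul_single]
    simp

theorem eq_of_mul_add_eq {N a b a' b' : ℕ} (hb : b < N) (hb' : b' < N)
    (h : a * N + b = a' * N + b') : a = a' ∧ b = b' := by
  have hN : 0 < N := by omega
  have h1 := congrArg (· / N) h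
  simp only [mul_comm _ N, Nat.mul_add_div hN, Nat.div_eq_of_lt hb, Nat.div_eq_of_lt hb',
    add_zero] at h1
  subst h1
  exact ⟨rfl, by omega⟩

theorem startMem_inputStore (P : RobustSDP n m r) (ε : ℝ) : StartMem ε P (inputStore P ε) := by
  refine ⟨by simp [inputStore], fun j => by simp [inputStore], fun j i l => ?_,
    by simp [inputStore], fun _ _ => by simp [inputStore]⟩
  -- The input array is described by a sum over all entries; uniqueness of the digits `(j, i, l)`
  -- leaves a single summand.
  have key : ∀ (j' : Fin r) (i' l' : Fin n), ((j : ℕ) * (n * n) + (i : ℕ) * n + (l : ℕ) =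
      (j' : ℕ) * (n * n) + (i' : ℕ) * n + (l' : ℕ)) → j = j' ∧ i = i' ∧ l = l' := by
    intro j' i' l' h
    rw [add_assoc, add_assoc] at h
    obtain ⟨h1, h2⟩ := eq_of_mul_add_eq (N := n * n) (by nlinarith [i.2, l.2])
      (by nlinarith [i'.2, l'.2]) h
    obtain ⟨h3, h4⟩ := eq_of_mul_add_eq l.2 l'.2 h2
    exact ⟨Fin.ext h1, Fin.ext h3, Fin.ext h4⟩
  simp only [inputStore, one_ne_zero, if_false, if_true]
  rw [Finset.sum_eq_single j, Finset.sum_eq_single i, Finset.sum_eq_single l, if_pos rfl]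
  · exact fun l' _ hl => if_neg fun h => hl (key _ _ _ h).2.2.symm
  · simp
  · exact fun i' _ hi => Finset.sum_eq_zero fun l' _ => if_neg fun h => hi (key _ _ _ h).2.1.symm
  · simp
  · exact fun j' _ hj => Finset.sum_eq_zero fun i' _ => Finset.sum_eq_zero fun l' _ =>
      if_neg fun h => hj (key _ _ _ h).1.symm
  · simp

end RealRAM

/-! ### The whole program and its total cost. -/

namespace RealRAM

open RobustSDP

variable {n m r K : ℕ} {P : RobustSDP n m r} {ε : ℝ}

def mainProg (mm : Program) : Program :=
  .seq levelsProg (.seq initProg (.seq (.loop mainTest (mainBody mm)) outProg))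

theorem mainProg_runs {mm : Program} {W : ℕ → ℝ} (hm : MulProg mm W)
    {f : SqMat n → Fin m × SqMat n} (hf : ∀ Y : SqMat n, Y.PosSemidef → P.IsArgmax Y (f Y))
    (hn : 0 < n) (hε : 0 < ε) (hε2 : ε < 1 / 2) (hK : n ≤ dbl K) (hK' : ∀ l < K, dbl l < n)
    {M T : ℕ} (hM : 64 * (n : ℝ) ^ 2 ≤ ε ^ 3 * 2 ^ M) (hT : ∀ t q, RunOf P ε t q → t ≤ T) :
    Runs (oracleOf f) (mainProg mm) (inputStore P ε)
      ((3 + 3 * K) + (50 * (r * n ^ 2) + ((1 + T * (1000 * (M + 2) * (K + 1) * W (dbl K) + 1)) +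
        (9 * (n * n) + 3 + 3 * (r + T))))) T
      fun σ => ∃ X y, OutputIs σ X y ∧ P.AlgReturns ε X y := by
  rw [← zero_add T]
  refine Runs.seq (levelsProg_runs (σ := inputStore P ε) (by simp [inputStore]) hn
    (by simp [inputStore]) hK hK') ?_
  rintro σ₁ ⟨h₁, r₁, n₁⟩
  simp only [zero_add]
  rw [← zero_add T]
  have s₁ : StartMem ε P σ₁ := (startMem_inputStore P ε).of_eq
    (n₁ 0 (by norm_num) (by norm_num) (by norm_num))
    (n₁ 1 (by norm_num) (by norm_num) (by norm_num)) (by rw [r₁]) (by rw [r₁]) (by rw [r₁])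
  refine Runs.seq (initProg_runs h₁ s₁) ?_
  intro σ₂ h₂
  simp only [zero_add]
  refine Runs.seq (K₂ := 0)
    (mainLoop_runs hm hf hn hε hM hT T 0 r P.algInit σ₂ .init h₂ (by omega) (by omega)) ?_
  rintro σ₃ ⟨q, k, hq, hqε, hk, h₃⟩
  have hs : q.s ≠ 0 := fun h0 => by
    rw [h0] at hqε
    norm_num [phaseEps] at hqε
    linarith
  refine (h₃.outProg_runs hs).mono ?_ fun σ' h => ⟨_, _, h, q, hq, hqε, rfl, rfl⟩
  have : (k : ℝ) ≤ r + T := by exact_mod_cast hk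
  linarith

theorem dbl_eq (k : ℕ) : (dbl k : ℝ) = 2 ^ k := by
  induction k with
  | zero => simp [dbl]
  | succ k ih => rw [dbl, Nat.cast_add, ih]; ring

theorem exists_level (hn : 0 < n) : ∃ K, n ≤ dbl K ∧ (∀ l < K, dbl l < n) ∧ dbl K ≤ 2 * n := by
  have hex : ∃ K, n ≤ dbl K := ⟨n, by
    have := @Nat.lt_two_pow_self n
    have h : ((2 ^ n : ℕ) : ℝ) = dbl n := by rw [dbl_eq]; norm_num
    have h' : 2 ^ n = dbl n := by exact_mod_cast h
    omega⟩
  classical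
  refine ⟨Nat.find hex, Nat.find_spec hex, fun l hl => not_le.1 (Nat.find_min hex hl), ?_⟩
  rcases h : Nat.find hex with _ | k
  · simp [dbl]; omega
  · have := Nat.find_min hex (m := k) (by omega)
    rw [dbl]; omega

theorem le_two_mul_log {k : ℕ} {x : ℝ} (h : (2 : ℝ) ^ k ≤ x) : (k : ℝ) ≤ 2 * Real.log x := by
  have h1 := Real.log_le_log (by positivity) h
  rw [Real.log_pow] at h1
  have h2 := Real.log_two_gt_d9
  nlinarith [Nat.cast_nonneg (α := ℝ) k]

theorem exists_le_two_pow {x : ℝ} (hx : 1 ≤ x) :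
    ∃ M : ℕ, x ≤ 2 ^ M ∧ (M : ℝ) ≤ 2 * Real.log x + 1 := by
  have h0 := Real.log_nonneg hx
  refine ⟨⌈2 * Real.log x⌉₊, ?_, (Nat.ceil_lt_add_one (by linarith)).le⟩
  have h1 := Nat.le_ceil (2 * Real.log x)
  have h2 := Real.log_two_gt_d9
  rw [← Real.log_le_log_iff (by linarith) (by positivity), Real.log_pow]
  nlinarith

/-- `ε < 1/2` gives `64 ≤ ε⁻⁶`, so `64 n² / ε³ ≤ (n / ε)⁹`; a binary logarithm is at most twice the
natural one, whence `18`. -/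
theorem exists_rounds_bound (hn : 0 < n) (hε : 0 < ε) (hε2 : ε < 1 / 2) :
    ∃ M : ℕ, 64 * (n : ℝ) ^ 2 ≤ ε ^ 3 * 2 ^ M ∧ (M : ℝ) ≤ 18 * Real.log (n / ε) + 1 := by
  have hn1 : (1 : ℝ) ≤ n := by exact_mod_cast hn
  have hx : 64 * (n : ℝ) ^ 2 / ε ^ 3 ≤ (n / ε) ^ 9 := by
    rw [div_pow, div_le_div_iff₀ (by positivity) (by positivity)]
    have h1 : ε ^ 6 ≤ (1 / 2) ^ 6 := by gcongr
    have h2 : (n : ℝ) ^ 2 ≤ n ^ 9 := pow_le_pow_right₀ hn1 (by norm_num)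
    calc 64 * (n : ℝ) ^ 2 * ε ^ 9 = 64 * n ^ 2 * ε ^ 6 * ε ^ 3 := by ring
      _ ≤ 64 * n ^ 9 * (1 / 2) ^ 6 * ε ^ 3 := by gcongr
      _ = _ := by ring
  have hx1 : 1 ≤ 64 * (n : ℝ) ^ 2 / ε ^ 3 := by
    rw [le_div_iff₀ (by positivity)]
    have : ε ^ 3 ≤ 1 := pow_le_one₀ hε.le (by linarith)
    nlinarith
  obtain ⟨M, h1, h2⟩ := exists_le_two_pow hx1
  refine ⟨M, ?_, ?_⟩
  · rw [div_le_iff₀ (by positivity)] at h1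
    linarith
  · have h3 := Real.log_le_log (by linarith) hx
    rw [Real.log_pow] at h3
    push_cast at h3
    linarith

/-- The total cost of the program, in terms of the parameters of the problem. -/
theorem cost_le {D ω L w : ℝ} {M T : ℕ} (hn : 0 < n) (hr : 0 < r) (hε : 0 < ε)
    (hε2 : ε < 1 / 2) (hL : 1 / 2 ≤ L) (hK : dbl K ≤ 2 * n)
    (hM : (M : ℝ) ≤ 18 * Real.log (n / ε) + 1) (hT : (T : ℝ) ≤ 500 * (n * L / ε ^ 2))
    (hω : 2 ≤ ω) (hw1 : 1 ≤ w) (hw : w ≤ D * (n : ℝ) ^ ω) {t : ℝ} (ht : 0 ≤ t) :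
    (3 + 3 * K) + (50 * (r * (n : ℝ) ^ 2) + ((1 + T * (1000 * (M + 2) * (K + 1) * w + 1)) +
        (9 * ((n : ℝ) * n) + 3 + 3 * (r + T)))) + T * t ≤
      (30002000 * D + 600) * (1 + Real.log (n / ε)) ^ 2 *
          ((n : ℝ) ^ (ω + 1) * L / ε ^ (5 / 2 : ℝ) + n * t * L / ε ^ 2)
        + (30002000 * D + 600) * (r * (n : ℝ) ^ 2) := by
  have hn1 : (1 : ℝ) ≤ n := by exact_mod_cast hn
  have hr1 : (1 : ℝ) ≤ r := by exact_mod_cast hr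
  set ℓ := 1 + Real.log (n / ε) with hℓ
  -- `2^K ≤ 2 n ≤ n / ε`, so the depth of the inversion is logarithmic.
  have hKℓ : (K : ℝ) + 1 ≤ 3 * ℓ := by
    have h1 : (2 : ℝ) ^ K ≤ n / ε := by
      rw [← dbl_eq, le_div_iff₀ hε]
      have : (dbl K : ℝ) ≤ 2 * n := by exact_mod_cast hK
      nlinarith
    have h2 := le_two_mul_log h1
    have h3 : 0 ≤ Real.log (n / ε) := Real.log_nonneg (by
      rw [le_div_iff₀ hε]; linarith)
    linarith
  have hℓ1 : 1 ≤ ℓ := by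
    have : 0 ≤ Real.log (n / ε) := Real.log_nonneg (by rw [le_div_iff₀ hε]; linarith)
    linarith
  have hMℓ : (M : ℝ) + 2 ≤ 20 * ℓ := by linarith
  set V := (n : ℝ) ^ ω with hV
  have hV1 : 1 ≤ V := Real.one_le_rpow hn1 (by linarith)
  have hVn : (n : ℝ) ^ (ω + 1) = V * n := by
    rw [Real.rpow_add (by linarith), Real.rpow_one]
  have hD : 0 < D := by
    by_contra! h
    nlinarith
  have hE : 0 < ε ^ (5 / 2 : ℝ) := Real.rpow_pos_of_pos hε _
  -- The number of iterations has only `ε²` in the denominator; since `ε < 1`, this is stronger than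
  -- what `ε^(5/2)` requires.
  have hE2 : ε ^ (5 / 2 : ℝ) ≤ ε ^ 2 := by
    rw [← Real.rpow_two]
    exact Real.rpow_le_rpow_of_exponent_ge hε (by linarith) (by norm_num)
  have hE1 : ε ^ (5 / 2 : ℝ) ≤ 1 := hE2.trans (pow_le_one₀ hε.le (by linarith))
  rw [hVn]
  set Z := V * n * L / ε ^ (5 / 2 : ℝ) with hZ
  have hL0 : 0 < L := by linarith
  have hZ1 : 1 ≤ 2 * Z := by
    rw [hZ, mul_div_assoc', le_div_iff₀ hE]
    have h1 : 1 ≤ V * n := by nlinarith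
    nlinarith
  have hTV : T * V ≤ 500 * Z := by
    calc (T : ℝ) * V ≤ 500 * (n * L / ε ^ 2) * V := by gcongr
      _ ≤ 500 * (n * L / ε ^ (5 / 2 : ℝ)) * V := by gcongr
      _ = 500 * Z := by rw [hZ]; ring
  have hT0 : (0 : ℝ) ≤ T := Nat.cast_nonneg T
  have hℓ2 : 1 ≤ ℓ ^ 2 := by nlinarith
  have hDV : 1 ≤ D * V := hw1.trans hw
  -- `1000 · 20 · 3 = 60000`, with one factor `ℓ` from the bisection and one from the depth of the
  -- inversion. The extra `1 + 3` pays, per transition, for the test of the main loop and for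
  -- writing one weight of the output.
  have hB : 1000 * ((M : ℝ) + 2) * (K + 1) * w + 1 + 3 ≤ 60004 * ℓ ^ 2 * (D * V) := by
    have h1 : 1000 * ((M : ℝ) + 2) * (K + 1) * w ≤ 1000 * (20 * ℓ) * (3 * ℓ) * (D * V) := by gcongr
    have h2 : 1 ≤ ℓ ^ 2 * (D * V) := by nlinarith
    nlinarith
  have hTB : T * (1000 * ((M : ℝ) + 2) * (K + 1) * w + 1 + 3) ≤ 30002000 * D * ℓ ^ 2 * Z := by
    calc T * (1000 * ((M : ℝ) + 2) * (K + 1) * w + 1 + 3) ≤ T * (60004 * ℓ ^ 2 * (D * V)) := by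
          gcongr
      _ = 60004 * ℓ ^ 2 * D * (T * V) := by ring
      _ ≤ 60004 * ℓ ^ 2 * D * (500 * Z) := by gcongr
      _ = _ := by ring
  have hTt : T * t ≤ 500 * ℓ ^ 2 * (n * t * L / ε ^ 2) := by
    have h0 : 0 ≤ n * t * L / ε ^ 2 := by positivity
    calc T * t ≤ 500 * (n * L / ε ^ 2) * t := by gcongr
      _ = 500 * 1 * (n * t * L / ε ^ 2) := by ring
      _ ≤ _ := by gcongr
  have hZ0 : 0 ≤ Z := by linarith
  have hℓZ : 3 * (K : ℝ) ≤ 18 * (ℓ ^ 2 * Z) := by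
    have h1 : ℓ ≤ ℓ ^ 2 * (2 * Z) := by
      calc ℓ = ℓ * 1 * 1 := by ring
        _ ≤ ℓ * ℓ * (2 * Z) := by gcongr
        _ = _ := by ring
    linarith
  have hrn : 7 + 9 * ((n : ℝ) * n) + 3 * r ≤ 19 * (r * n ^ 2) := by
    have h1 : 1 ≤ (n : ℝ) ^ 2 := one_le_pow₀ hn1
    have h2 : (r : ℝ) * 1 ≤ r * n ^ 2 := by gcongr
    have h3 : 1 * (n : ℝ) ^ 2 ≤ r * n ^ 2 := by gcongr
    rw [← sq]
    linarith
  have hrn0 : 0 ≤ (r : ℝ) * n ^ 2 := by positivity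
  have hu : 0 ≤ ℓ ^ 2 * (n * t * L / ε ^ 2) := by positivity
  have hv : 0 ≤ ℓ ^ 2 * Z := by positivity
  have hDr := mul_nonneg hD.le hrn0
  have hDu := mul_nonneg hD.le hu
  clear_value Z ℓ
  generalize (n : ℝ) * t * L / ε ^ 2 = U at *
  generalize (r : ℝ) * n ^ 2 = R at *
  generalize 1000 * ((M : ℝ) + 2) * (K + 1) * w = B at *
  linarith

end RealRAM

open RobustSDP RealRAM in
theorem RealRAM.IsMatMulExponent.exists_program {ω : ℝ} (hω : IsMatMulExponent ω) :
    ∃ (prog : Program) (C : ℝ), ∀ (n m r : ℕ) (P : RobustSDP n m r) (ε : ℝ), 0 < n → 0 < ε →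
      ε < 1 / 2 → ∀ f : SqMat n → Fin m × SqMat n,
        (∀ Y : SqMat n, Y.PosSemidef → P.IsArgmax Y (f Y)) →
        ∃ (σ : Store) (steps calls : ℕ) (X : SqMat n) (y : Weights n m),
          Exec (oracleOf f) prog (inputStore P ε) σ steps calls ∧ OutputIs σ X y ∧
          P.AlgReturns ε X y ∧ ∀ T : ℝ, 0 ≤ T → (steps : ℝ) + calls * T ≤
            C * (1 + Real.log (n / ε)) ^ 2 *
                ((n : ℝ) ^ (ω + 1) * Real.log (2 * P.psi) / ε ^ (5 / 2 : ℝ)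
                  + n * T * Real.log (2 * P.psi) / ε ^ 2)
              + C * (r * (n : ℝ) ^ 2) := by
  obtain ⟨mm, C₀, hC₀, hω2, hm⟩ := hω.exists_mulProg
  refine ⟨mainProg mm, 30002000 * (C₀ * 2 ^ ω) + 600, fun n m r P ε hn hε hε2 f hf => ?_⟩
  -- The answer for the identity maximizes the trace. Thus the existence of the oracle bounds the
  -- uncertainty sets and turns `psi` into a genuine supremum.
  have htr : ∀ i, ∀ A ∈ P.𝒜 i, A.trace ≤ frob (f 1).2 1 := fun i A hA => by
    simpa [frob] using (hf 1 Matrix.PosSemidef.one).2 i A hA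
  obtain ⟨K, hK1, hK2, hK3⟩ := exists_level hn
  obtain ⟨M, hM1, hM2⟩ := exists_rounds_bound hn hε hε2
  set L := Real.log (2 * P.psi) with hL
  have hL2 : 1 / 2 ≤ L := half_le_log_two_psi (one_le_psi hn htr)
  have hn1 : (1 : ℝ) ≤ n := by exact_mod_cast hn
  have hb0 : 0 ≤ 500 * (n * L / ε ^ 2) := by positivity
  obtain ⟨σ, s, k, hex, hs, hk, X, y, hout, hret⟩ := mainProg_runs (K := K) (M := M)
    (T := ⌊500 * (n * L / ε ^ 2)⌋₊) hm hf hn hε hε2 hK1 hK2 hM1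
    fun t q h => Nat.le_floor (h.le hn htr hε hε2)
  refine ⟨σ, s, k, X, y, hex, hout, hret, fun t ht => ?_⟩
  have hdbl1 : (1 : ℝ) ≤ dbl K := by exact_mod_cast dbl_pos K
  have hw1 : 1 ≤ C₀ * (dbl K : ℝ) ^ ω := by
    have := hm.sq_le _ (dbl_pos K)
    nlinarith
  have hw : C₀ * (dbl K : ℝ) ^ ω ≤ C₀ * 2 ^ ω * (n : ℝ) ^ ω := by
    rw [mul_assoc, ← Real.mul_rpow (by norm_num) (by linarith)]
    have : (dbl K : ℝ) ≤ 2 * n := by exact_mod_cast hK3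
    gcongr
  refine le_trans ?_ (cost_le hn (P.pos_of_start hn) hε hε2 hL2 hK3 hM2 (Nat.floor_le hb0) hω2 hw1
    hw ht)
  have h1 : (k : ℝ) ≤ (⌊500 * (n * L / ε ^ 2)⌋₊ : ℝ) := by exact_mod_cast hk
  exact add_le_add hs (mul_le_mul_of_nonneg_right h1 ht)

end

theorem mainTheorem5 :
    (∃ C : ℝ, 0 < C ∧
      ∀ (n m r : ℕ) (P : RobustSDP n m r) (ε : ℝ), 0 < n → 0 < ε → ε < 1 / 2 →
        ∀ (X : SqMat n) (y : RobustSDP.Weights n m), P.AlgReturns ε X y →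
          (∀ p, 0 ≤ y p) ∧ P.IsOptimalPair (C * ε) X (RobustSDP.toMeasure y)) ∧
    (∀ ω : ℝ, RealRAM.IsMatMulExponent ω →
      ∃ (prog : RealRAM.Program) (C : ℝ) (k : ℕ),
        ∀ (n m r : ℕ) (P : RobustSDP n m r) (ε : ℝ), 0 < n → 0 < ε → ε < 1 / 2 →
        ∀ f : SqMat n → Fin m × SqMat n,
          (∀ Y : SqMat n, Y.PosSemidef → P.IsArgmax Y (f Y)) →
          ∃ (σ : RealRAM.Store) (steps calls : ℕ) (X : SqMat n) (y : RobustSDP.Weights n m),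
            RealRAM.Exec (RealRAM.oracleOf f) prog (RealRAM.inputStore P ε) σ steps calls ∧
            RealRAM.OutputIs σ X y ∧
            P.AlgReturns ε X y ∧
            ∀ T : ℝ, 0 ≤ T →
              (steps : ℝ) + calls * T ≤
                C * (1 + Real.log (n / ε)) ^ k *
                    ((n : ℝ) ^ (ω + 1) * Real.log (2 * P.psi) / ε ^ (5 / 2 : ℝ)
                      + n * T * Real.log (2 * P.psi) / ε ^ 2)
                  + C * (r * (n : ℝ) ^ 2)) := by
  refine ⟨⟨10, by norm_num, fun n m r P ε hn _ hε2 X y h =>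
    RobustSDP.isOptimalPair_of_returns hn hε2 h⟩, fun ω hω => ?_⟩
  obtain ⟨prog, C, h⟩ := hω.exists_program
  exact ⟨prog, C, 2, h⟩
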